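/- Let $X$ be a closed (compact, Hausdorff, without boundary) oriented smooth manifold of dimension $2n$. Let $\Omega(X)$ be the space of orientation-compatible symplectic forms on $X$, i.e. closed non-degenerate smooth $2$-forms $\omega$ such that $\omega^n$ is a volume form inducing the given orientation; it carries the topology induced from the $C^\infty$ topology on the space of closed $2$-forms. Let $\mathrm{Diff}_0(X)$ be the group of diffeomorphisms of $X$ that are smoothly isotopic to the identity (through diffeomorphisms), acting on $\Omega(X)$ by pullback, and give $\tilde{\mathcal M}_X=\Omega(X)/\mathrm{Diff}_0(X)$ the quotient topology. Let $H^2(X;\mathbb R)$ be the second de Rham cohomology of $X$ with its canonical topology as a (finite-dimensional) real vector space. Then the map $s:\Omega(X)\to H^2(X;\mathbb R)$, $\omega\mapsto[\omega]$, descends to a map $\tilde s:\tilde{\mathcal M}_X\to H^2(X;\mathbb R)$, and $\tilde s$ is a local homeomorphism. -/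

import Mathlib

open Set Topology
open scoped Manifold ContDiff UniformConvergence

noncomputable section

namespace SymplecticModuli

/-- The Euclidean space on which `m`-dimensional manifolds are modelled. -/
abbrev Model (m : ℕ) : Type := EuclideanSpace ℝ (Fin m)

section Forms

variable {m : ℕ} (X : Type*) [TopologicalSpace X] [ChartedSpace (Model m) X]

/-- A (not necessarily continuous) field of alternating `k`-linear forms on the tangent spaces of
the `m`-dimensional manifold `X`. -/
def RawForm (m : ℕ) (X : Type*) [TopologicalSpace X] [ChartedSpace (Model m) X] (k : ℕ) :
    Type _ :=
  ∀ x : X, TangentSpace (𝓡 m) x [⋀^Fin k]→L[ℝ] ℝ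

instance (k : ℕ) : AddCommGroup (RawForm m X k) :=
  inferInstanceAs (AddCommGroup (∀ x : X, TangentSpace (𝓡 m) x [⋀^Fin k]→L[ℝ] ℝ))

instance (k : ℕ) : Module ℝ (RawForm m X k) :=
  inferInstanceAs (Module ℝ (∀ x : X, TangentSpace (𝓡 m) x [⋀^Fin k]→L[ℝ] ℝ))

variable {X}

/-- The local expression of `w` in the chart `e`: the pullback of `w` by `e⁻¹`, which is a
differential form on the open set `e.target` of Euclidean space (values off `e.target` are
irrelevant). -/
def localRep {k : ℕ} (e : OpenPartialHomeomorph X (Model m)) (w : RawForm m X k) (y : Model m) :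
    Model m [⋀^Fin k]→L[ℝ] ℝ :=
  (w (e.symm y)).compContinuousLinearMap
    (mfderiv (𝓡 m) (𝓡 m) e.symm y : Model m →L[ℝ] TangentSpace (𝓡 m) (e.symm y))

lemma localRep_add {k : ℕ} (e : OpenPartialHomeomorph X (Model m)) (w η : RawForm m X k) :
    localRep e (w + η) = localRep e w + localRep e η := by
  rfl

lemma localRep_smul {k : ℕ} (e : OpenPartialHomeomorph X (Model m)) (c : ℝ) (w : RawForm m X k) :
    localRep e (c • w) = c • localRep e w := by
  rfl

lemma localRep_zero {k : ℕ} (e : OpenPartialHomeomorph X (Model m)) :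
    localRep e (0 : RawForm m X k) = 0 := by
  rfl

variable (m X) in
/-- The real vector space of smooth differential `k`-forms on `X`: the local expression in every
smooth chart is smooth. -/
def SmoothForm (k : ℕ) : Submodule ℝ (RawForm m X k) where
  carrier := {w | ∀ e ∈ IsManifold.maximalAtlas (𝓡 m) ∞ X,
    ContDiffOn ℝ ∞ (localRep e w) e.target}
  add_mem' := fun {a b} ha hb e he => by
    rw [localRep_add]
    exact (ha e he).add (hb e he)
  zero_mem' := fun e _ => by
    rw [localRep_zero]
    exact contDiffOn_const
  smul_mem' := fun c a ha e he => by
    rw [localRep_smul]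
    exact (ha e he).const_smul c

lemma SmoothForm.differentiableAt {k : ℕ} (w : SmoothForm m X k)
    {e : OpenPartialHomeomorph X (Model m)} (he : e ∈ IsManifold.maximalAtlas (𝓡 m) ∞ X)
    {y : Model m} (hy : y ∈ e.target) : DifferentiableAt ℝ (localRep e w.1) y :=
  ((w.2 e he).contDiffAt (e.open_target.mem_nhds hy)).differentiableAt (by simp)

/-- `IsExtDeriv α β` says that `β = dα`: in every smooth chart, the local expression of `β` is the
exterior derivative of the local expression of `α`. -/
def IsExtDeriv {k : ℕ} (α : SmoothForm m X k) (β : SmoothForm m X (k + 1)) : Prop :=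
  ∀ e ∈ IsManifold.maximalAtlas (𝓡 m) ∞ X, ∀ y ∈ e.target,
    localRep e β.1 y = extDeriv (localRep e α.1) y

lemma IsExtDeriv.add {k : ℕ} {α α' : SmoothForm m X k} {β β' : SmoothForm m X (k + 1)}
    (h : IsExtDeriv α β) (h' : IsExtDeriv α' β') : IsExtDeriv (α + α') (β + β') := by
  intro e he y hy
  have h1 : localRep e (α + α').1 = localRep e α.1 + localRep e α'.1 := localRep_add _ _ _
  have h2 : localRep e (β + β').1 = localRep e β.1 + localRep e β'.1 := localRep_add _ _ _
  rw [h1, h2, extDeriv_add (SmoothForm.differentiableAt α he hy)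
    (SmoothForm.differentiableAt α' he hy), Pi.add_apply,
    h e he y hy, h' e he y hy]

lemma IsExtDeriv.smul {k : ℕ} (c : ℝ) {α : SmoothForm m X k} {β : SmoothForm m X (k + 1)}
    (h : IsExtDeriv α β) : IsExtDeriv (c • α) (c • β) := by
  intro e he y hy
  have h1 : localRep e (c • α).1 = c • localRep e α.1 := localRep_smul _ _ _
  have h2 : localRep e (c • β).1 = c • localRep e β.1 := localRep_smul _ _ _
  rw [h1, h2, extDeriv_smul, Pi.smul_apply, h e he y hy]

lemma IsExtDeriv.zero {k : ℕ} : IsExtDeriv (0 : SmoothForm m X k) 0 := by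
  intro e he y hy
  have h := (IsExtDeriv.smul (m := m) (X := X) (k := k) 0 (α := 0) (β := 0))
  have h1 : localRep e (0 : SmoothForm m X k).1 = 0 := localRep_zero _
  have h2 : localRep e (0 : SmoothForm m X (k + 1)).1 = 0 := localRep_zero _
  rw [h1, h2]
  have h3 := extDeriv_smul (x := y) (0 : ℝ) (0 : Model m → Model m [⋀^Fin k]→L[ℝ] ℝ)
  simpa using h3.symm

variable (m X) in
/-- The space of closed smooth `k`-forms on `X`. -/
def ClosedForm (k : ℕ) : Submodule ℝ (SmoothForm m X k) where
  carrier := {w | IsExtDeriv w 0}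
  add_mem' := fun {a b} ha hb => by
    have h := IsExtDeriv.add ha hb
    rwa [add_zero] at h
  zero_mem' := IsExtDeriv.zero
  smul_mem' := fun c a ha => by
    have h := IsExtDeriv.smul c ha
    rwa [smul_zero] at h

variable (m X) in
/-- The exact 2-forms, as a subspace of the space of closed 2-forms on `X`. -/
def ExactTwoForm : Submodule ℝ (ClosedForm m X 2) where
  carrier := {β | ∃ α : SmoothForm m X 1, IsExtDeriv α β.1}
  add_mem' := fun {_ _} ⟨α, h⟩ ⟨α', h'⟩ => ⟨α + α', h.add h'⟩
  zero_mem' := ⟨0, IsExtDeriv.zero⟩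
  smul_mem' := fun c _ ⟨α, h⟩ => ⟨c • α, h.smul c⟩

variable (m X) in
/-- The de Rham cohomology `H^2(X; ℝ)`: closed 2-forms modulo exact 2-forms. -/
def H2 : Type _ := ClosedForm m X 2 ⧸ ExactTwoForm m X

instance : AddCommGroup (H2 m X) :=
  inferInstanceAs (AddCommGroup (ClosedForm m X 2 ⧸ ExactTwoForm m X))

instance : Module ℝ (H2 m X) :=
  inferInstanceAs (Module ℝ (ClosedForm m X 2 ⧸ ExactTwoForm m X))

/-- `H^2(X; ℝ)` carries the canonical topology of a real vector space (the finest vector space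
topology), which on a finite-dimensional space is the Euclidean topology. -/
instance : TopologicalSpace (H2 m X) := moduleTopology ℝ (H2 m X)

/-- The cohomology class of a closed 2-form. -/
def cohomClass (w : ClosedForm m X 2) : H2 m X := (ExactTwoForm m X).mkQ w

/-- The local expression of a smooth form in the smooth chart `e`, differentiated `j` times,
as an element of the space of functions with the topology of uniform convergence on
compact subsets of the image of the chart. -/
def localJet {k : ℕ} (w : SmoothForm m X k) (e : IsManifold.maximalAtlas (𝓡 m) ∞ X) (j : ℕ) :
    Model m →ᵤ[{K : Set (Model m) | IsCompact K ∧ K ⊆ e.1.target}]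
      (Model m [×j]→L[ℝ] (Model m [⋀^Fin k]→L[ℝ] ℝ)) :=
  UniformOnFun.ofFun _ (iteratedFDeriv ℝ j (localRep e.1 w.1))

/-- The `C^∞` topology on the space of smooth `k`-forms: convergence of all derivatives of the
local expressions, uniformly on compact subsets of smooth charts. The space of closed forms and its
subsets carry the induced topology. -/
instance (k : ℕ) : TopologicalSpace (SmoothForm m X k) :=
  TopologicalSpace.induced (fun w e j => localJet w e j) inferInstance

end Forms

section Symplectic

variable {n : ℕ} {X : Type*} [TopologicalSpace X] [ChartedSpace (Model (2 * n)) X]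

/-- The top power `w^n = w ∧ ⋯ ∧ w` of an alternating bilinear form, evaluated at `2n` vectors. -/
def topPower {V : Type*} [AddCommGroup V] [Module ℝ V] [TopologicalSpace V]
    (w : V [⋀^Fin 2]→L[ℝ] ℝ) (v : Fin (2 * n) → V) : ℝ :=
  (2 ^ n : ℝ)⁻¹ * ∑ σ : Equiv.Perm (Fin (2 * n)), ((Equiv.Perm.sign σ : ℤ) : ℝ) *
    ∏ i : Fin n, w ![v (σ ⟨2 * i.1, by omega⟩), v (σ ⟨2 * i.1 + 1, by omega⟩)]

variable (n X) in
/-- An orientation of the manifold `X`: an orientation of every tangent space, which is locally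
constant in suitable smooth charts. -/
structure ManifoldOrientation where
  /-- The orientation of the tangent space at `x`. -/
  at_point : ∀ x : X, Orientation ℝ (TangentSpace (𝓡 (2 * n)) x) (Fin (2 * n))
  locally_constant : ∀ x : X, ∃ e ∈ IsManifold.maximalAtlas (𝓡 (2 * n)) ∞ X,
    ∃ he : e.MDifferentiable (𝓡 (2 * n)) (𝓡 (2 * n)), x ∈ e.source ∧
    ∃ o₀ : Orientation ℝ (Model (2 * n)) (Fin (2 * n)), ∀ y (hy : y ∈ e.source),
      Orientation.map (Fin (2 * n)) (he.mfderiv hy).toLinearEquiv (at_point y) = o₀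

/-- Non-degeneracy of a 2-form. -/
def IsNondegenerate (w : RawForm (2 * n) X 2) : Prop :=
  ∀ (x : X) (u : TangentSpace (𝓡 (2 * n)) x), u ≠ 0 → ∃ v, w x ![u, v] ≠ 0

/-- `w^n` is a volume form whose orientation is the given one: it is positive on exactly the
positively oriented bases of the tangent spaces. -/
def IsOrientationCompatible (o : ManifoldOrientation n X) (w : RawForm (2 * n) X 2) : Prop :=
  ∀ (x : X) (b : Module.Basis (Fin (2 * n)) ℝ (TangentSpace (𝓡 (2 * n)) x)),
    0 < topPower (w x) b ↔ b.orientation = o.at_point x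

/-- The space `Ω(X)` of orientation-compatible symplectic forms, a subspace of the space of closed
2-forms. -/
def SymplecticForm (o : ManifoldOrientation n X) : Type _ :=
  {w : ClosedForm (2 * n) X 2 //
    IsNondegenerate w.1.1 ∧ IsOrientationCompatible o w.1.1}

instance (o : ManifoldOrientation n X) : TopologicalSpace (SymplecticForm o) :=
  inferInstanceAs (TopologicalSpace {w : ClosedForm (2 * n) X 2 //
    IsNondegenerate w.1.1 ∧ IsOrientationCompatible o w.1.1})

/-- Membership of `φ` in `Diff₀(X)`: there is a smooth isotopy `ψ_t`, `t ∈ [0, 1]`, through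
diffeomorphisms from the identity to `φ`. -/
def IsIsotopicToId (φ : X ≃ₘ⟮𝓡 (2 * n), 𝓡 (2 * n)⟯ X) : Prop :=
  ∃ ψ : ℝ → (X ≃ₘ⟮𝓡 (2 * n), 𝓡 (2 * n)⟯ X),
    ContMDiffOn (𝓘(ℝ, ℝ).prod (𝓡 (2 * n))) (𝓡 (2 * n)) ∞ (fun p : ℝ × X => ψ p.1 p.2)
      (Icc (0 : ℝ) 1 ×ˢ univ) ∧
    ψ 0 = Diffeomorph.refl (𝓡 (2 * n)) X ∞ ∧ ψ 1 = φ

/-- The pullback `φ^* w`. -/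
def pullback {k : ℕ} (φ : X → X) (w : RawForm (2 * n) X k) : RawForm (2 * n) X k :=
  fun x => (w (φ x)).compContinuousLinearMap (mfderiv (𝓡 (2 * n)) (𝓡 (2 * n)) φ x)

lemma pullback_id {k : ℕ} (w : RawForm (2 * n) X k) : pullback id w = w := by
  funext x
  ext v
  simp only [pullback, mfderiv_id]
  rfl

lemma pullback_comp {k : ℕ} (φ ψ : X ≃ₘ⟮𝓡 (2 * n), 𝓡 (2 * n)⟯ X) (w : RawForm (2 * n) X k) :
    pullback (ψ ∘ φ) w = pullback φ (pullback ψ w) := by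
  funext x
  ext v
  have h := mfderiv_comp x (ψ.mdifferentiable (by simp) (φ x)) (φ.mdifferentiable (by simp) x)
  simp only [pullback, h]
  rfl

lemma isIsotopicToId_refl :
    IsIsotopicToId (n := n) (X := X) (Diffeomorph.refl (𝓡 (2 * n)) X ∞) :=
  ⟨fun _ => Diffeomorph.refl _ _ _, contMDiff_snd.contMDiffOn, rfl, rfl⟩

lemma IsIsotopicToId.trans {φ ψ : X ≃ₘ⟮𝓡 (2 * n), 𝓡 (2 * n)⟯ X} (hφ : IsIsotopicToId φ)
    (hψ : IsIsotopicToId ψ) : IsIsotopicToId (φ.trans ψ) := by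
  obtain ⟨f, hf, hf0, hf1⟩ := hφ
  obtain ⟨g, hg, hg0, hg1⟩ := hψ
  refine ⟨fun t => (f t).trans (g t), ?_, ?_, ?_⟩
  · exact hg.comp (contMDiff_fst.contMDiffOn.prodMk hf) (fun p hp => ⟨hp.1, mem_univ _⟩)
  · simp [hf0, hg0]
  · simp [hf1, hg1]

lemma IsIsotopicToId.symm {φ : X ≃ₘ⟮𝓡 (2 * n), 𝓡 (2 * n)⟯ X} (hφ : IsIsotopicToId φ) :
    IsIsotopicToId φ.symm := by
  obtain ⟨f, hf, hf0, hf1⟩ := hφ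
  refine ⟨fun t => φ.symm.trans (f (1 - t)), ?_, ?_, ?_⟩
  · have h1 : ContMDiff (𝓘(ℝ, ℝ).prod (𝓡 (2 * n))) 𝓘(ℝ, ℝ) ∞ (fun p : ℝ × X => 1 - p.1) :=
      (contDiff_const.sub contDiff_id).contMDiff.comp contMDiff_fst
    have h2 : ContMDiff (𝓘(ℝ, ℝ).prod (𝓡 (2 * n))) (𝓡 (2 * n)) ∞
        (fun p : ℝ × X => φ.symm p.2) := φ.symm.contMDiff.comp contMDiff_snd
    refine hf.comp (h1.prodMk h2).contMDiffOn (fun p hp => ⟨?_, mem_univ _⟩)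
    have := hp.1
    simp only [mem_Icc] at this ⊢
    constructor <;> linarith
  · simp [hf1]
  · simp [hf0]

/-- Two symplectic forms are equivalent when they lie in the same orbit of `Diff₀(X)`. -/
instance orbitSetoid (o : ManifoldOrientation n X) : Setoid (SymplecticForm o) where
  r w η := ∃ φ : X ≃ₘ⟮𝓡 (2 * n), 𝓡 (2 * n)⟯ X, IsIsotopicToId φ ∧
    pullback φ w.1.1.1 = η.1.1.1
  iseqv :=
    { refl := fun w => ⟨Diffeomorph.refl _ _ _, isIsotopicToId_refl, pullback_id _⟩
      symm := by
        rintro w η ⟨φ, hφ, h⟩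
        refine ⟨φ.symm, hφ.symm, ?_⟩
        rw [← h, ← pullback_comp]
        have : (φ ∘ φ.symm : X → X) = id := funext fun x => φ.apply_symm_apply x
        rw [this, pullback_id]
      trans := by
        rintro w η θ ⟨φ, hφ, h⟩ ⟨ψ, hψ, h'⟩
        refine ⟨ψ.trans φ, hψ.trans hφ, ?_⟩
        rw [← h', ← h, ← pullback_comp]
        rfl }

/-- The quotient `Ω(X) / Diff₀(X)`, with the quotient topology. -/
abbrev ModuliTilde (o : ManifoldOrientation n X) : Type _ := Quotient (orbitSetoid o)

end Symplectic

end SymplecticModuli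

end

open Set Topology
open scoped Manifold ContDiff UniformConvergence

noncomputable section

set_option linter.unusedSectionVars false

/-! The induced map is continuous, open and locally injective, and the projection from Ω(X) to its
quotient is open; together these make the induced map a local homeomorphism.

Local injectivity is Moser stability (`exists_nhds_equiv`). Being symplectic is a C^0-open
condition, and around each symplectic form a neighbourhood is found such that all segments between
its elements are symplectic. If η and η' lie in it and η' − η = dα, then the orbit of η + t dα is
locally constant in t, hence constant on [0,1]. For local constancy, a partition of unity writes α
as a sum of 1-forms supported in charts, and for small parameters the pieces are absorbed one at a
time. Each piece is treated by Moser's vector field in Euclidean space (`exists_moser_isotopy`), and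
the resulting isotopy is extended to X by the identity. Smoothness of the flow comes from the
implicit function theorem applied to the integral equation on the Banach space of paths.

Invariance of the class under Diff₀(X) is homotopy invariance of de Rham cohomology: the 1-form
obtained by integrating over the time fiber is a primitive of the difference
(`exists_isExtDeriv_of_homotopy`).

Openness is soft: Ω(X) is open among the closed forms, a quotient map of topological vector spaces
is open, and the canonical topology on H² is at least as fine as the quotient topology.

Continuity needs more, since exact forms must be controlled in the C^∞ topology. A Čech–de Rham
argument on a finite cover (`exists_finite_obstruction`) gives a continuous linear map from closed
forms to some ℝ^N whose kernel consists of exact forms. The class map therefore factors through ℝ^N,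
and every linear map out of ℝ^N is continuous. No separate proof that H² is finite-dimensional is
required.

The projection to the quotient is open because pullback by a diffeomorphism is continuous on forms.
-/

namespace SymplecticModuli

/-! ### Alternating forms on a finite-dimensional space: coordinates, smoothness, d in low degree -/

section AlternatingMaps

variable {V W : Type*} [NormedAddCommGroup V] [NormedSpace ℝ V] [FiniteDimensional ℝ V]
  [NormedAddCommGroup W] [NormedSpace ℝ W]

/-- The components of an alternating map with respect to the standard basis of `V`. -/
def altCoord (V : Type*) [NormedAddCommGroup V] [NormedSpace ℝ V] [FiniteDimensional ℝ V] (k : ℕ) :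
    (V [⋀^Fin k]→L[ℝ] ℝ) →L[ℝ] ((Fin k → Fin (Module.finrank ℝ V)) → ℝ) :=
  ContinuousLinearMap.pi fun i =>
    ContinuousAlternatingMap.apply ℝ V ℝ (fun j => Module.finBasis ℝ V (i j))

lemma altCoord_apply {k : ℕ} (f : V [⋀^Fin k]→L[ℝ] ℝ) (i : Fin k → Fin (Module.finrank ℝ V)) :
    altCoord V k f i = f (fun j => Module.finBasis ℝ V (i j)) := rfl

lemma alt_apply_eq_sum {k : ℕ} (f : V [⋀^Fin k]→L[ℝ] ℝ) (v : Fin k → V) :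
    f v = ∑ i : Fin k → Fin (Module.finrank ℝ V),
      (∏ j, (Module.finBasis ℝ V).equivFunL (v j) (i j)) * altCoord V k f i := by
  have h : v = fun j => ∑ i, (Module.finBasis ℝ V).equivFunL (v j) i • Module.finBasis ℝ V i := by
    funext j
    exact ((Module.finBasis ℝ V).sum_equivFun (v j)).symm
  conv_lhs => rw [h]
  rw [ContinuousAlternatingMap.map_sum]
  refine Finset.sum_congr rfl fun i _ => ?_
  rw [ContinuousAlternatingMap.map_smul_univ, altCoord_apply, smul_eq_mul]

lemma altCoord_injective (k : ℕ) : Function.Injective (altCoord V k) := by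
  intro f g h
  ext v
  rw [alt_apply_eq_sum, alt_apply_eq_sum, h]

instance finiteDimensional_alt (k : ℕ) : FiniteDimensional ℝ (V [⋀^Fin k]→L[ℝ] ℝ) :=
  Module.Finite.of_injective (altCoord V k).toLinearMap (altCoord_injective k)

/-- The coordinate map is linear and injective, so it has a linear left inverse; this recovers a
family of alternating maps from finitely many of its values. Smoothness can thus be tested on fixed
vectors. -/
lemma contDiffWithinAt_alt {k : ℕ} {n : ℕ∞ω} {f : W → V [⋀^Fin k]→L[ℝ] ℝ} {s : Set W} {x : W}
    (h : ∀ v, ContDiffWithinAt ℝ n (fun y => f y v) s x) : ContDiffWithinAt ℝ n f s x := by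
  obtain ⟨g, hg⟩ := (altCoord V k).toLinearMap.exists_leftInverse_of_injective
    (LinearMap.ker_eq_bot.2 (altCoord_injective k))
  have h1 : f = fun y => g.toContinuousLinearMap (altCoord V k (f y)) := by
    funext y
    exact (LinearMap.congr_fun hg (f y)).symm
  rw [h1]
  refine g.toContinuousLinearMap.contDiff.comp_contDiffWithinAt ?_
  rw [contDiffWithinAt_pi]
  exact fun i => h _

lemma contDiffAt_alt {k : ℕ} {n : ℕ∞ω} {f : W → V [⋀^Fin k]→L[ℝ] ℝ} {x : W}
    (h : ∀ v, ContDiffAt ℝ n (fun y => f y v) x) : ContDiffAt ℝ n f x :=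
  contDiffWithinAt_alt h

/-- By multilinear expansion in a basis, the value is a polynomial in the coordinates of the form
and of the vectors. -/
lemma contDiffWithinAt_alt_apply {k : ℕ} {n : ℕ∞ω} {f : W → V [⋀^Fin k]→L[ℝ] ℝ}
    {v : Fin k → W → V} {s : Set W} {x : W} (hf : ContDiffWithinAt ℝ n f s x)
    (hv : ∀ i, ContDiffWithinAt ℝ n (v i) s x) :
    ContDiffWithinAt ℝ n (fun y => f y (fun i => v i y)) s x := by
  simp_rw [alt_apply_eq_sum]
  refine ContDiffWithinAt.sum fun i _ => ContDiffWithinAt.mul ?_ ?_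
  · refine contDiffWithinAt_prod fun j _ => ?_
    have h1 := (Module.finBasis ℝ V).equivFunL.contDiff.comp_contDiffWithinAt (n := n) (hv j)
    rw [contDiffWithinAt_pi] at h1
    exact h1 (i j)
  · have h1 := (altCoord V k).contDiff.comp_contDiffWithinAt (n := n) hf
    rw [contDiffWithinAt_pi] at h1
    exact h1 i

lemma contDiffAt_alt_apply {k : ℕ} {n : ℕ∞ω} {f : W → V [⋀^Fin k]→L[ℝ] ℝ}
    {v : Fin k → W → V} {x : W} (hf : ContDiffAt ℝ n f x)
    (hv : ∀ i, ContDiffAt ℝ n (v i) x) :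
    ContDiffAt ℝ n (fun y => f y (fun i => v i y)) x :=
  contDiffWithinAt_alt_apply hf hv

lemma contDiffAt_alt_comp {U : Type*} [NormedAddCommGroup U] [NormedSpace ℝ U]
    [FiniteDimensional ℝ U] {k : ℕ} {n : ℕ∞ω} {f : W → V [⋀^Fin k]→L[ℝ] ℝ}
    {A : W → U →L[ℝ] V} {x : W} (hf : ContDiffAt ℝ n f x) (hA : ContDiffAt ℝ n A x) :
    ContDiffAt ℝ n (fun y => (f y).compContinuousLinearMap (A y)) x :=
  contDiffAt_alt fun v =>
    contDiffAt_alt_apply (v := fun i y => A y (v i)) hf fun _ => hA.clm_apply contDiffAt_const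

/-- The exterior derivative of a 1-form, evaluated. -/
lemma extDeriv_one_apply {α : V → V [⋀^Fin 1]→L[ℝ] ℝ} {x : V} (h : DifferentiableAt ℝ α x)
    (v : Fin 2 → V) :
    extDeriv α x v = fderiv ℝ (fun y => α y ![v 1]) x (v 0)
      - fderiv ℝ (fun y => α y ![v 0]) x (v 1) := by
  rw [extDeriv_apply h, Fin.sum_univ_two]
  have h0 : (0 : Fin 2).removeNth v = ![v 1] := by ext i; fin_cases i; rfl
  have h1 : (1 : Fin 2).removeNth v = ![v 0] := by ext i; fin_cases i; rfl
  rw [h0, h1]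
  simp [sub_eq_add_neg]

/-- The exterior derivative of a 2-form, evaluated. -/
lemma extDeriv_two_apply {w : V → V [⋀^Fin 2]→L[ℝ] ℝ} {x : V} (h : DifferentiableAt ℝ w x)
    (v : Fin 3 → V) :
    extDeriv w x v = fderiv ℝ (fun y => w y ![v 1, v 2]) x (v 0)
      - fderiv ℝ (fun y => w y ![v 0, v 2]) x (v 1)
      + fderiv ℝ (fun y => w y ![v 0, v 1]) x (v 2) := by
  rw [extDeriv_apply h, Fin.sum_univ_three]
  have h0 : (0 : Fin 3).removeNth v = ![v 1, v 2] := by ext i; fin_cases i <;> rfl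
  have h1 : (1 : Fin 3).removeNth v = ![v 0, v 2] := by ext i; fin_cases i <;> rfl
  have h2 : (2 : Fin 3).removeNth v = ![v 0, v 1] := by ext i; fin_cases i <;> rfl
  rw [h0, h1, h2]
  simp [sub_eq_add_neg]

end AlternatingMaps

/-! ### Smoothness and exterior derivative of forms on a manifold, tested in one chart -/

section LocalForms

variable {m : ℕ} {X : Type*} [TopologicalSpace X] [ChartedSpace (Model m) X]
variable {P : Type*} [NormedAddCommGroup P] [NormedSpace ℝ P]

/-- The pullback of a form on `X` by a map from a normed space. -/
def pullVec {k : ℕ} (G : P → X) (w : RawForm m X k) (p : P) : P [⋀^Fin k]→L[ℝ] ℝ :=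
  ContinuousAlternatingMap.compContinuousLinearMap (M := Model m) (w (G p))
    (mfderiv 𝓘(ℝ, P) (𝓡 m) G p : P →L[ℝ] Model m)

lemma localRep_eq_pullVec {k : ℕ} (e : OpenPartialHomeomorph X (Model m)) (w : RawForm m X k) :
    localRep e w = pullVec e.symm w := rfl

lemma mdifferentiableAt_chart_symm {e : OpenPartialHomeomorph X (Model m)}
    (he : e ∈ IsManifold.maximalAtlas (𝓡 m) ∞ X) {y : Model m} (hy : y ∈ e.target) :
    MDifferentiableAt (𝓡 m) (𝓡 m) e.symm y :=
  (contMDiffAt_symm_of_mem_maximalAtlas he hy).mdifferentiableAt (by simp)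

lemma mdifferentiableAt_chart {e : OpenPartialHomeomorph X (Model m)}
    (he : e ∈ IsManifold.maximalAtlas (𝓡 m) ∞ X) {x : X} (hx : x ∈ e.source) :
    MDifferentiableAt (𝓡 m) (𝓡 m) e x :=
  (contMDiffAt_of_mem_maximalAtlas he hx).mdifferentiableAt (by simp)

/-- The pullback of a form by a map into a chart domain, in terms of the local expression. -/
lemma pullVec_eq {k : ℕ} {e : OpenPartialHomeomorph X (Model m)}
    (he : e ∈ IsManifold.maximalAtlas (𝓡 m) ∞ X) {G : P → X} {p : P}
    (hG : MDifferentiableAt 𝓘(ℝ, P) (𝓡 m) G p) (hp : G p ∈ e.source) (w : RawForm m X k) :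
    pullVec G w p =
      (localRep e w (e (G p))).compContinuousLinearMap (fderiv ℝ (fun q => e (G q)) p) := by
  have h1 : G =ᶠ[𝓝 p] fun q => e.symm (e (G q)) := by
    filter_upwards [hG.continuousAt.preimage_mem_nhds (e.open_source.mem_nhds hp)] with q hq
    exact (e.left_inv hq).symm
  have h2 : MDifferentiableAt 𝓘(ℝ, P) (𝓡 m) (fun q => e (G q)) p :=
    (mdifferentiableAt_chart he hp).comp p hG
  have h3 : mfderiv 𝓘(ℝ, P) (𝓡 m) G p =
      (mfderiv (𝓡 m) (𝓡 m) e.symm (e (G p))).comp (mfderiv 𝓘(ℝ, P) (𝓡 m) (fun q => e (G q)) p) := by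
    rw [h1.mfderiv_eq]
    exact mfderiv_comp p (mdifferentiableAt_chart_symm he (e.map_source hp)) h2
  have h4 : mfderiv 𝓘(ℝ, P) (𝓡 m) (fun q => e (G q)) p = fderiv ℝ (fun q => e (G q)) p :=
    mfderiv_eq_fderiv
  have h5 : e.symm (e (G p)) = G p := e.left_inv hp
  ext v
  rw [h4] at h3
  unfold pullVec localRep
  rw [h5]
  simp only [ContinuousAlternatingMap.compContinuousLinearMap_apply]
  rw [h3]
  rfl

lemma two_le_infty : (2 : ℕ∞ω) ≤ ∞ := by exact WithTop.coe_le_coe.2 le_top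

lemma one_le_infty : (1 : ℕ∞ω) ≤ ∞ := by exact WithTop.coe_le_coe.2 le_top

lemma contDiffAt_fderiv {V W : Type*} [NormedAddCommGroup V] [NormedSpace ℝ V]
    [NormedAddCommGroup W] [NormedSpace ℝ W] {f : V → W} {x : V} (h : ContDiffAt ℝ ∞ f x) :
    ContDiffAt ℝ ∞ (fderiv ℝ f) x :=
  h.fderiv_right (by simp)

lemma contDiffAt_chart_comp {e : OpenPartialHomeomorph X (Model m)}
    (he : e ∈ IsManifold.maximalAtlas (𝓡 m) ∞ X) {G : P → X} {p : P}
    (hG : ContMDiffAt 𝓘(ℝ, P) (𝓡 m) ∞ G p) (hp : G p ∈ e.source) :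
    ContDiffAt ℝ ∞ (fun q => e (G q)) p :=
  ((contMDiffAt_of_mem_maximalAtlas he hp).comp p hG).contDiffAt

/-- The coordinate formula is needed on a neighbourhood, not just at a point, because both sides are
going to be differentiated. -/
lemma pullVec_eventuallyEq [IsManifold (𝓡 m) ∞ X] {k : ℕ} {e : OpenPartialHomeomorph X (Model m)}
    (he : e ∈ IsManifold.maximalAtlas (𝓡 m) ∞ X) {G : P → X} {p : P}
    (hG : ContMDiffAt 𝓘(ℝ, P) (𝓡 m) ∞ G p) (hp : G p ∈ e.source) (w : RawForm m X k) :
    pullVec G w =ᶠ[𝓝 p] fun q =>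
      (localRep e w (e (G q))).compContinuousLinearMap (fderiv ℝ (fun q => e (G q)) q) := by
  have : IsManifold (𝓡 m) 1 X := IsManifold.of_le one_le_infty
  have h1 : ∀ᶠ q in 𝓝 p, ContMDiffAt 𝓘(ℝ, P) (𝓡 m) 1 G q :=
    (contMDiffAt_iff_contMDiffAt_nhds (by simp)).1 (hG.of_le one_le_infty)
  filter_upwards [h1, hG.continuousAt.preimage_mem_nhds (e.open_source.mem_nhds hp)] with q hq hq'
  exact pullVec_eq he (hq.mdifferentiableAt (by simp)) hq' w

variable [IsManifold (𝓡 m) ∞ X]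

/-- Smoothness of a form at a point. -/
def SmoothFormAt {k : ℕ} (w : RawForm m X k) (x : X) : Prop :=
  ∀ e ∈ IsManifold.maximalAtlas (𝓡 m) ∞ X, x ∈ e.source → ContDiffAt ℝ ∞ (localRep e w) (e x)

lemma contDiffAt_pullVec_of_chart [FiniteDimensional ℝ P] {k : ℕ}
    {e : OpenPartialHomeomorph X (Model m)}
    (he : e ∈ IsManifold.maximalAtlas (𝓡 m) ∞ X) {G : P → X} {p : P}
    (hG : ContMDiffAt 𝓘(ℝ, P) (𝓡 m) ∞ G p) (hp : G p ∈ e.source) {w : RawForm m X k}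
    (hw : ContDiffAt ℝ ∞ (localRep e w) (e (G p))) : ContDiffAt ℝ ∞ (pullVec G w) p := by
  have h1 := contDiffAt_chart_comp he hG hp
  refine ContDiffAt.congr_of_eventuallyEq ?_ (pullVec_eventuallyEq he hG hp w)
  exact contDiffAt_alt_comp (ContDiffAt.comp (g := localRep e w) p hw h1) (contDiffAt_fderiv h1)

/-- The expression in another chart is the pullback of the expression in `e` by a smooth transition
map, so one chart suffices. -/
lemma smoothFormAt_of_chart {k : ℕ} {e : OpenPartialHomeomorph X (Model m)}
    (he : e ∈ IsManifold.maximalAtlas (𝓡 m) ∞ X) {x : X} (hx : x ∈ e.source) {w : RawForm m X k}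
    (hw : ContDiffAt ℝ ∞ (localRep e w) (e x)) : SmoothFormAt w x := by
  intro e' he' hx'
  have h : e'.symm (e' x) = x := e'.left_inv hx'
  rw [localRep_eq_pullVec]
  refine contDiffAt_pullVec_of_chart he
    (contMDiffAt_symm_of_mem_maximalAtlas he' (e'.map_source hx')) ?_ ?_
  · rwa [h]
  · rwa [h]

lemma mem_smoothForm_iff {k : ℕ} {w : RawForm m X k} :
    w ∈ SmoothForm m X k ↔ ∀ x, SmoothFormAt w x := by
  constructor
  · intro h x e he hx
    exact (h e he).contDiffAt (e.open_target.mem_nhds (e.map_source hx))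
  · intro h e he y hy
    have h1 := h (e.symm y) e he (e.map_target hy)
    rw [e.right_inv hy] at h1
    exact h1.contDiffWithinAt

/-- `β = dα` at the point `x`. -/
def IsExtDerivAt {k : ℕ} (α : RawForm m X k) (β : RawForm m X (k + 1)) (x : X) : Prop :=
  ∀ e ∈ IsManifold.maximalAtlas (𝓡 m) ∞ X, x ∈ e.source →
    localRep e β (e x) = extDeriv (localRep e α) (e x)

lemma isExtDeriv_iff {k : ℕ} {α : SmoothForm m X k} {β : SmoothForm m X (k + 1)} :
    IsExtDeriv α β ↔ ∀ x, IsExtDerivAt α.1 β.1 x := by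
  constructor
  · intro h x e he hx
    exact h e he _ (e.map_source hx)
  · intro h e he y hy
    have h1 := h (e.symm y) e he (e.map_target hy)
    rwa [e.right_inv hy] at h1

lemma extDeriv_pullVec_of_chart {k : ℕ} {e : OpenPartialHomeomorph X (Model m)}
    (he : e ∈ IsManifold.maximalAtlas (𝓡 m) ∞ X) {G : P → X} {p : P}
    (hG : ContMDiffAt 𝓘(ℝ, P) (𝓡 m) ∞ G p) (hp : G p ∈ e.source) {w : RawForm m X k}
    (hw : ContDiffAt ℝ ∞ (localRep e w) (e (G p))) :
    extDeriv (pullVec G w) p = (extDeriv (localRep e w) (e (G p))).compContinuousLinearMap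
      (fderiv ℝ (fun q => e (G q)) p) := by
  rw [(pullVec_eventuallyEq he hG hp w).extDeriv_eq]
  exact extDeriv_pullback (hw.differentiableAt (by simp)) (contDiffAt_chart_comp he hG hp)
    (by simpa using two_le_infty)

/-- The exterior derivative commutes with pullback to a normed space. -/
lemma extDeriv_pullVec {k : ℕ} {G : P → X} {p : P}
    (hG : ContMDiffAt 𝓘(ℝ, P) (𝓡 m) ∞ G p) {α : RawForm m X k} {β : RawForm m X (k + 1)}
    (hα : SmoothFormAt α (G p)) (hβ : IsExtDerivAt α β (G p)) :
    extDeriv (pullVec G α) p = pullVec G β p := by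
  have he := IsManifold.chart_mem_maximalAtlas (I := 𝓡 m) (n := ∞) (G p)
  have hp := mem_chart_source (Model m) (G p)
  rw [extDeriv_pullVec_of_chart he hG hp (hα _ he hp),
    pullVec_eq he (hG.mdifferentiableAt (by simp)) hp, hβ _ he hp]

lemma contDiffAt_pullVec [FiniteDimensional ℝ P] {k : ℕ} {G : P → X} {p : P}
    (hG : ContMDiffAt 𝓘(ℝ, P) (𝓡 m) ∞ G p) {w : RawForm m X k}
    (hw : SmoothFormAt w (G p)) : ContDiffAt ℝ ∞ (pullVec G w) p := by
  have he := IsManifold.chart_mem_maximalAtlas (I := 𝓡 m) (n := ∞) (G p)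
  have hp := mem_chart_source (Model m) (G p)
  exact contDiffAt_pullVec_of_chart he hG hp (hw _ he hp)

/-- Exterior derivative commutes with pullback along transition maps, so the identity propagates
from one chart to all charts. -/
lemma isExtDerivAt_of_chart {k : ℕ} {e : OpenPartialHomeomorph X (Model m)}
    (he : e ∈ IsManifold.maximalAtlas (𝓡 m) ∞ X) {x : X} (hx : x ∈ e.source)
    {α : RawForm m X k} {β : RawForm m X (k + 1)}
    (hα : ContDiffAt ℝ ∞ (localRep e α) (e x))
    (h : localRep e β (e x) = extDeriv (localRep e α) (e x)) : IsExtDerivAt α β x := by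
  intro e' he' hx'
  have hx2 : e'.symm (e' x) = x := e'.left_inv hx'
  have h1 := contMDiffAt_symm_of_mem_maximalAtlas he' (e'.map_source hx')
  have h2 := extDeriv_pullVec_of_chart (w := α) he h1 (by rwa [hx2]) (by rwa [hx2])
  rw [localRep_eq_pullVec, localRep_eq_pullVec, h2,
    pullVec_eq he (h1.mdifferentiableAt (by simp)) (by rwa [hx2]), hx2, h]

lemma mfderiv_symm_chart {e : OpenPartialHomeomorph X (Model m)}
    (he : e ∈ IsManifold.maximalAtlas (𝓡 m) ∞ X) {x : X} (hx : x ∈ e.source) (v : Model m) :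
    (mfderiv (𝓡 m) (𝓡 m) e.symm (e x) : Model m →L[ℝ] Model m)
      ((mfderiv (𝓡 m) (𝓡 m) e x : Model m →L[ℝ] Model m) v) = v := by
  have h1 : (fun y => e.symm (e y)) =ᶠ[𝓝 x] id := by
    filter_upwards [e.open_source.mem_nhds hx] with q hq
    exact e.left_inv hq
  have h2 := mfderiv_comp x (mdifferentiableAt_chart_symm he (e.map_source hx))
    (mdifferentiableAt_chart he hx)
  have h3 := h1.mfderiv_eq (I := 𝓡 m) (I' := 𝓡 m)
  rw [mfderiv_id] at h3
  exact (DFunLike.congr_fun h2 v).symm.trans (DFunLike.congr_fun h3 v)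

/-- A form is determined at a point by its local expression in a chart. -/
lemma form_eq_of_localRep_eq {k : ℕ} {e : OpenPartialHomeomorph X (Model m)}
    (he : e ∈ IsManifold.maximalAtlas (𝓡 m) ∞ X) {x : X} (hx : x ∈ e.source) {w η : RawForm m X k}
    (h : localRep e w (e x) = localRep e η (e x)) : w x = η x := by
  ext v
  have h1 := DFunLike.congr_fun h
    (fun i => (mfderiv (𝓡 m) (𝓡 m) e x : Model m →L[ℝ] Model m) (v i))
  simp only [localRep] at h1
  have h2 : (fun i => (mfderiv (𝓡 m) (𝓡 m) e.symm (e x) : Model m →L[ℝ] Model m)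
      ((mfderiv (𝓡 m) (𝓡 m) e x : Model m →L[ℝ] Model m) (v i))) = v :=
    funext fun i => mfderiv_symm_chart he hx (v i)
  have h3 : e.symm (e x) = x := e.left_inv hx
  rw [h3] at h1
  change (w x) (fun i => (mfderiv (𝓡 m) (𝓡 m) e.symm (e x) : Model m →L[ℝ] Model m)
      ((mfderiv (𝓡 m) (𝓡 m) e x : Model m →L[ℝ] Model m) (v i))) =
    (η x) (fun i => (mfderiv (𝓡 m) (𝓡 m) e.symm (e x) : Model m →L[ℝ] Model m)
      ((mfderiv (𝓡 m) (𝓡 m) e x : Model m →L[ℝ] Model m) (v i))) at h1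
  rw [h2] at h1
  exact h1

/-- The form on `X` given near `x` by the form `f` on the image of the chart `e`. -/
def chartForm {k : ℕ} (e : OpenPartialHomeomorph X (Model m))
    (f : Model m → Model m [⋀^Fin k]→L[ℝ] ℝ) : RawForm m X k := fun x =>
  ContinuousAlternatingMap.compContinuousLinearMap (M' := Model m) (f (e x))
    (mfderiv (𝓡 m) (𝓡 m) e x : Model m →L[ℝ] Model m)

lemma localRep_eq_comp_of_eq_chartForm {k : ℕ} {e e' : OpenPartialHomeomorph X (Model m)}
    (he : e ∈ IsManifold.maximalAtlas (𝓡 m) ∞ X) (he' : e' ∈ IsManifold.maximalAtlas (𝓡 m) ∞ X)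
    {x : X} (hx : x ∈ e.source) (hx' : x ∈ e'.source) {w : RawForm m X k}
    {f : Model m → Model m [⋀^Fin k]→L[ℝ] ℝ} (hw : w x = chartForm e f x) :
    localRep e' w (e' x) = (f (e x)).compContinuousLinearMap
      (fderiv ℝ (fun y => e (e'.symm y)) (e' x)) := by
  have h0 : e'.symm (e' x) = x := e'.left_inv hx'
  have h1 : mfderiv (𝓡 m) (𝓡 m) (fun y => e (e'.symm y)) (e' x) =
      (mfderiv (𝓡 m) (𝓡 m) e (e'.symm (e' x))).comp (mfderiv (𝓡 m) (𝓡 m) e'.symm (e' x)) :=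
    mfderiv_comp (e' x) (mdifferentiableAt_chart he (by rwa [h0]))
      (mdifferentiableAt_chart_symm he' (e'.map_source hx'))
  rw [h0] at h1
  have h2 : mfderiv (𝓡 m) (𝓡 m) (fun y => e (e'.symm y)) (e' x) =
    fderiv ℝ (fun y => e (e'.symm y)) (e' x) := mfderiv_eq_fderiv
  rw [← h2, h1]
  unfold localRep
  rw [h0, hw]
  rfl

lemma fderiv_chart_self {e : OpenPartialHomeomorph X (Model m)} {y : Model m}
    (hy : y ∈ e.target) :
    fderiv ℝ (fun y => e (e.symm y)) y = ContinuousLinearMap.id ℝ (Model m) := by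
  have h : (fun y => e (e.symm y)) =ᶠ[𝓝 y] id := by
    filter_upwards [e.open_target.mem_nhds hy] with z hz
    exact e.right_inv hz
  rw [h.fderiv_eq]
  exact fderiv_id

lemma localRep_of_eq_chartForm {k : ℕ} {e : OpenPartialHomeomorph X (Model m)}
    (he : e ∈ IsManifold.maximalAtlas (𝓡 m) ∞ X) {x : X} (hx : x ∈ e.source) {w : RawForm m X k}
    {f : Model m → Model m [⋀^Fin k]→L[ℝ] ℝ} (hw : w x = chartForm e f x) :
    localRep e w (e x) = f (e x) := by
  rw [localRep_eq_comp_of_eq_chartForm he he hx hx hw, fderiv_chart_self (e.map_source hx)]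
  rfl

/-- The exterior derivative of a form. -/
def rawD {k : ℕ} (w : RawForm m X k) : RawForm m X (k + 1) := fun x =>
  chartForm (chartAt (Model m) x) (extDeriv (localRep (chartAt (Model m) x) w)) x

lemma isExtDerivAt_rawD {k : ℕ} {w : RawForm m X k} {x : X} (hw : SmoothFormAt w x) :
    IsExtDerivAt w (rawD w) x := by
  have he := IsManifold.chart_mem_maximalAtlas (I := 𝓡 m) (n := ∞) x
  have hx := mem_chart_source (Model m) x
  exact isExtDerivAt_of_chart he hx (hw _ he hx) (localRep_of_eq_chartForm he hx rfl)

lemma contDiffAt_extDeriv {V : Type*} [NormedAddCommGroup V] [NormedSpace ℝ V] {k : ℕ}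
    {f : V → V [⋀^Fin k]→L[ℝ] ℝ} {x : V} (hf : ContDiffAt ℝ ∞ f x) :
    ContDiffAt ℝ ∞ (extDeriv f) x :=
  ContDiffAt.comp (g := ContinuousAlternatingMap.alternatizeUncurryFinCLM ℝ V ℝ) x
    (ContinuousLinearMap.contDiff _).contDiffAt (contDiffAt_fderiv hf)

/-- The exterior derivative of a smooth form. -/
def smoothD {k : ℕ} (w : SmoothForm m X k) : SmoothForm m X (k + 1) :=
  ⟨rawD w.1, by
    intro e he y hy
    have h1 : ContDiffAt ℝ ∞ (localRep e w.1) y :=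
      (w.2 e he).contDiffAt (e.open_target.mem_nhds hy)
    refine ContDiffAt.contDiffWithinAt ?_
    refine (contDiffAt_extDeriv h1).congr_of_eventuallyEq ?_
    filter_upwards [e.open_target.mem_nhds hy] with z hz
    have h2 := isExtDerivAt_rawD (mem_smoothForm_iff.1 w.2 (e.symm z)) e he (e.map_target hz)
    rwa [e.right_inv hz] at h2⟩

lemma isExtDeriv_d {k : ℕ} (w : SmoothForm m X k) : IsExtDeriv w (smoothD w) :=
  isExtDeriv_iff.2 fun x => isExtDerivAt_rawD (mem_smoothForm_iff.1 w.2 x)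

lemma IsExtDeriv.unique {k : ℕ} {w : SmoothForm m X k} {β γ : SmoothForm m X (k + 1)}
    (h : IsExtDeriv w β) (h' : IsExtDeriv w γ) : β = γ := by
  refine Subtype.ext (funext fun x => ?_)
  have he := IsManifold.chart_mem_maximalAtlas (I := 𝓡 m) (n := ∞) x
  have hx := mem_chart_source (Model m) x
  exact form_eq_of_localRep_eq he hx
    ((isExtDeriv_iff.1 h x _ he hx).trans (isExtDeriv_iff.1 h' x _ he hx).symm)

lemma isExtDeriv_d_zero {k : ℕ} (w : SmoothForm m X k) : IsExtDeriv (smoothD w) 0 := by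
  intro e he y hy
  have h0 : localRep e (0 : SmoothForm m X (k + 1 + 1)).1 = 0 := localRep_zero _
  have h1 : ContDiffAt ℝ ∞ (localRep e w.1) y :=
    (w.2 e he).contDiffAt (e.open_target.mem_nhds hy)
  have h2 : localRep e (smoothD w).1 =ᶠ[𝓝 y] extDeriv (localRep e w.1) := by
    filter_upwards [e.open_target.mem_nhds hy] with z hz
    exact isExtDeriv_d w e he z hz
  rw [h0, h2.extDeriv_eq, extDeriv_extDeriv_apply h1 (by simpa using two_le_infty)]
  rfl

end LocalForms

/-! ### The C^∞ topology makes forms a topological vector space -/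

section FormTopology

variable {m : ℕ} {X : Type*} [TopologicalSpace X] [ChartedSpace (Model m) X]

variable (m X) in
/-- The data of a seminorm of the `C^∞` topology: a chart, an order, and a compact set. -/
structure JetIndex where
  /-- the chart -/
  e : OpenPartialHomeomorph X (Model m)
  /-- the number of derivatives -/
  j : ℕ
  /-- the compact set -/
  K : Set (Model m)
  he : e ∈ IsManifold.maximalAtlas (𝓡 m) ∞ X
  hK : IsCompact K
  hKe : K ⊆ e.target

lemma smoothForm_contDiffAt {k : ℕ} (w : SmoothForm m X k)
    {e : OpenPartialHomeomorph X (Model m)} (he : e ∈ IsManifold.maximalAtlas (𝓡 m) ∞ X)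
    {y : Model m} (hy : y ∈ e.target) : ContDiffAt ℝ ∞ (localRep e w.1) y :=
  (w.2 e he).contDiffAt (e.open_target.mem_nhds hy)

lemma natCast_le_infty (j : ℕ) : (j : ℕ∞ω) ≤ ∞ := WithTop.coe_le_coe.2 le_top

/-- The `j`-jet of the local expression of a form, on a compact subset of the chart. -/
def jetOn (k : ℕ) (i : JetIndex m X) : SmoothForm m X k →ₗ[ℝ]
    (i.K → (Model m [×i.j]→L[ℝ] (Model m [⋀^Fin k]→L[ℝ] ℝ))) where
  toFun w y := iteratedFDeriv ℝ i.j (localRep i.e w.1) y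
  map_add' w η := by
    funext y
    have h : localRep i.e (w + η).1 = localRep i.e w.1 + localRep i.e η.1 := localRep_add _ _ _
    rw [h]
    exact iteratedFDeriv_add_apply
      ((smoothForm_contDiffAt w i.he (i.hKe y.2)).of_le (natCast_le_infty _))
      ((smoothForm_contDiffAt η i.he (i.hKe y.2)).of_le (natCast_le_infty _))
  map_smul' c w := by
    funext y
    have h : localRep i.e (c • w).1 = c • localRep i.e w.1 := localRep_smul _ _ _
    rw [h]
    exact iteratedFDeriv_const_smul_apply
      ((smoothForm_contDiffAt w i.he (i.hKe y.2)).of_le (natCast_le_infty _))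

/-- Unfolding the product and the uniform-on-compacts topologies presents the C^∞ topology as an
infimum of topologies induced by linear maps, so algebraic continuity can be checked one jet at a
time. -/
lemma smoothForm_topology_eq (k : ℕ) :
    (instTopologicalSpaceSubtypeRawFormMemSubmoduleRealSmoothForm k :
        TopologicalSpace (SmoothForm m X k)) =
      ⨅ i : JetIndex m X, TopologicalSpace.induced (fun w => UniformFun.ofFun (jetOn k i w))
        (UniformFun.topologicalSpace _ _) := by
  change TopologicalSpace.induced (fun w e j => localJet w e j) Pi.topologicalSpace = _
  simp only [Pi.topologicalSpace, induced_iInf, induced_compose, UniformOnFun.topologicalSpace_eq]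
  apply le_antisymm
  · refine le_iInf fun i => ?_
    exact (iInf_le _ (⟨i.e, i.he⟩ : IsManifold.maximalAtlas (𝓡 m) ∞ X)).trans
      ((iInf_le _ i.j).trans (iInf₂_le i.K ⟨i.hK, i.hKe⟩))
  · refine le_iInf fun e => le_iInf fun j => le_iInf₂ fun K hK => ?_
    exact iInf_le (fun i : JetIndex m X => TopologicalSpace.induced
      (fun w => UniformFun.ofFun (jetOn k i w)) (UniformFun.topologicalSpace _ _))
      ⟨e.1, j, K, e.2, hK.1, hK.2⟩

lemma jetOn_continuous {k : ℕ} (i : JetIndex m X) (w : SmoothForm m X k) :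
    Continuous (jetOn k i w) := by
  rw [continuous_iff_continuousAt]
  intro y
  have h := (smoothForm_contDiffAt w i.he (i.hKe y.2))
  have h1 : ContinuousAt (iteratedFDeriv ℝ i.j (localRep i.e w.1)) y :=
    (h.iteratedFDeriv_right (m := 0) (i := i.j) (by simpa using natCast_le_infty i.j)).continuousAt
  exact h1.comp continuous_subtype_val.continuousAt

instance (k : ℕ) : IsTopologicalAddGroup (SmoothForm m X k) := by
  rw [smoothForm_topology_eq k]
  refine topologicalAddGroup_iInf fun i => ?_
  let φ : SmoothForm m X k →+ (i.K →ᵤ (Model m [×i.j]→L[ℝ] (Model m [⋀^Fin k]→L[ℝ] ℝ))) :=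
    (jetOn k i).toAddMonoidHom
  exact topologicalAddGroup_induced φ

instance (k : ℕ) : ContinuousSMul ℝ (SmoothForm m X k) := by
  rw [smoothForm_topology_eq k]
  refine continuousSMul_iInf fun i => ?_
  let _ : TopologicalSpace (SmoothForm m X k) :=
    TopologicalSpace.induced (fun w => UniformFun.ofFun (jetOn k i w))
        (UniformFun.topologicalSpace _ _)
  -- Scalar multiplication is not continuous for uniform convergence of unbounded functions. Here
  -- each jet is continuous on the compact set `i.K`, hence bounded.
  refine UniformFun.continuousSMul_induced_of_range_bounded ℝ i.K _ (SmoothForm m X k) (jetOn k i)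
    ⟨rfl⟩ fun w => ?_
  have : CompactSpace i.K := isCompact_iff_compactSpace.1 i.hK
  exact (isCompact_range (jetOn_continuous i w)).isVonNBounded ℝ

lemma continuous_to_smoothForm {k : ℕ} {T : Type*} [TopologicalSpace T] {f : T → SmoothForm m X k}
    (h : ∀ i : JetIndex m X, Continuous fun t => UniformFun.ofFun (jetOn k i (f t))) :
    Continuous f := by
  rw [smoothForm_topology_eq k]
  exact continuous_iInf_rng.2 fun i => continuous_induced_rng.2 (h i)

lemma continuous_jetOn {k : ℕ} (i : JetIndex m X) :
    Continuous fun w => UniformFun.ofFun (jetOn k i w) := by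
  rw [smoothForm_topology_eq k]
  exact continuous_iInf_dom continuous_induced_dom

lemma uniformFun_ball_mem_nhds {α V : Type*} [PseudoMetricSpace V] (f : α → V) {ε : ℝ}
    (hε : 0 < ε) :
    {g : α →ᵤ V | ∀ x, dist (f x) (UniformFun.toFun g x) < ε} ∈ 𝓝 (UniformFun.ofFun f) :=
  (UniformFun.hasBasis_nhds_of_basis _ _ _ Metric.uniformity_basis_dist).mem_of_mem hε

/-- `C^0`-balls on compact subsets of charts are neighbourhoods. -/
lemma ball_mem_nhds_smoothForm {k : ℕ} (w : SmoothForm m X k)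
    {e : OpenPartialHomeomorph X (Model m)} (he : e ∈ IsManifold.maximalAtlas (𝓡 m) ∞ X)
    {K : Set (Model m)} (hK : IsCompact K) (hKe : K ⊆ e.target) {ε : ℝ} (hε : 0 < ε) :
    {η : SmoothForm m X k | ∀ y ∈ K, ‖localRep e η.1 y - localRep e w.1 y‖ < ε} ∈ 𝓝 w := by
  let i : JetIndex m X := ⟨e, 0, K, he, hK, hKe⟩
  have h1 := (continuous_jetOn (k := k) i).continuousAt (x := w)
  have h2 := h1.preimage_mem_nhds (uniformFun_ball_mem_nhds (jetOn k i w) hε)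
  refine Filter.mem_of_superset h2 fun η hη y hy => ?_
  have h3 : dist (iteratedFDeriv ℝ 0 (localRep e w.1) y)
    (iteratedFDeriv ℝ 0 (localRep e η.1) y) < ε := hη ⟨y, hy⟩
  rw [iteratedFDeriv_zero_eq_comp, iteratedFDeriv_zero_eq_comp] at h3
  simp only [Function.comp_apply, LinearIsometryEquiv.dist_map] at h3
  rwa [dist_comm, dist_eq_norm] at h3

instance (k : ℕ) : IsTopologicalAddGroup (ClosedForm m X k) :=
  inferInstanceAs (IsTopologicalAddGroup (ClosedForm m X k).toAddSubgroup)

instance (k : ℕ) : ContinuousSMul ℝ (ClosedForm m X k) := inferInstance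

end FormTopology

/-! ### Pullback by diffeomorphisms is continuous; the quotient projection is open -/

section Pullback

variable {n : ℕ} {X : Type*} [TopologicalSpace X] [ChartedSpace (Model (2 * n)) X]
  [IsManifold (𝓡 (2 * n)) ∞ X]

/-- The chart obtained by composing the inverse of a diffeomorphism with a chart. -/
def transChart (φ : X ≃ₘ⟮𝓡 (2 * n), 𝓡 (2 * n)⟯ X)
    (e : OpenPartialHomeomorph X (Model (2 * n))) : OpenPartialHomeomorph X (Model (2 * n)) :=
  φ.symm.toHomeomorph.transOpenPartialHomeomorph e

lemma transChart_mem (φ : X ≃ₘ⟮𝓡 (2 * n), 𝓡 (2 * n)⟯ X)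
    {e : OpenPartialHomeomorph X (Model (2 * n))}
    (he : e ∈ IsManifold.maximalAtlas (𝓡 (2 * n)) ∞ X) :
    transChart φ e ∈ IsManifold.maximalAtlas (𝓡 (2 * n)) ∞ X := by
  refine OpenPartialHomeomorph.mem_maximalAtlas_of_contMDiffOn _ ?_ ?_
  · exact (contMDiffOn_of_mem_maximalAtlas he).comp φ.symm.contMDiff.contMDiffOn fun x hx => hx
  · exact φ.contMDiff.comp_contMDiffOn (contMDiffOn_symm_of_mem_maximalAtlas he)

/-- Since the maximal atlas is stable under diffeomorphisms, pulling back a form amounts to reading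
the original form in a moved chart. Smoothness, exterior derivatives and continuity then transfer
without chain-rule estimates. -/
lemma localRep_pullback {k : ℕ} (φ : X ≃ₘ⟮𝓡 (2 * n), 𝓡 (2 * n)⟯ X)
    {e : OpenPartialHomeomorph X (Model (2 * n))}
    (he : e ∈ IsManifold.maximalAtlas (𝓡 (2 * n)) ∞ X) (w : RawForm (2 * n) X k)
    {y : Model (2 * n)} (hy : y ∈ e.target) :
    localRep e (pullback φ w) y = localRep (transChart φ e) w y := by
  have h := mfderiv_comp y (φ.mdifferentiable (by simp) (e.symm y))
    (mdifferentiableAt_chart_symm he hy)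
  have h2 : mfderiv (𝓡 (2 * n)) (𝓡 (2 * n)) (transChart φ e).symm y = _ := h
  ext v
  simp only [localRep, pullback, h2]
  rfl

lemma localRep_pullback_eventuallyEq {k : ℕ} (φ : X ≃ₘ⟮𝓡 (2 * n), 𝓡 (2 * n)⟯ X)
    {e : OpenPartialHomeomorph X (Model (2 * n))}
    (he : e ∈ IsManifold.maximalAtlas (𝓡 (2 * n)) ∞ X) (w : RawForm (2 * n) X k)
    {y : Model (2 * n)} (hy : y ∈ e.target) :
    localRep e (pullback φ w) =ᶠ[𝓝 y] localRep (transChart φ e) w := by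
  filter_upwards [e.open_target.mem_nhds hy] with z hz
  exact localRep_pullback φ he w hz

/-- The pullback of smooth forms. -/
def pullbackSmooth {k : ℕ} (φ : X ≃ₘ⟮𝓡 (2 * n), 𝓡 (2 * n)⟯ X) (w : SmoothForm (2 * n) X k) :
    SmoothForm (2 * n) X k :=
  ⟨pullback φ w.1, fun _ he => (w.2 _ (transChart_mem φ he)).congr
    fun _ hy => localRep_pullback φ he w.1 hy⟩

lemma IsExtDeriv.pullback {k : ℕ} (φ : X ≃ₘ⟮𝓡 (2 * n), 𝓡 (2 * n)⟯ X)
    {α : SmoothForm (2 * n) X k} {β : SmoothForm (2 * n) X (k + 1)} (h : IsExtDeriv α β) :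
    IsExtDeriv (pullbackSmooth φ α) (pullbackSmooth φ β) := by
  intro e he y hy
  exact (localRep_pullback φ he β.1 hy).trans ((h _ (transChart_mem φ he) y hy).trans
    (localRep_pullback_eventuallyEq φ he α.1 hy).symm.extDeriv_eq)

/-- The jet of the pullback with index (chart, order, compact set) is literally the jet of the
original form for the moved chart, with the same order and compact set. -/
lemma continuous_pullbackSmooth {k : ℕ} (φ : X ≃ₘ⟮𝓡 (2 * n), 𝓡 (2 * n)⟯ X) :
    Continuous (pullbackSmooth (k := k) φ) := by
  refine continuous_to_smoothForm fun i => ?_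
  have h := continuous_jetOn (k := k)
    (⟨transChart φ i.e, i.j, i.K, transChart_mem φ i.he, i.hK, i.hKe⟩ : JetIndex (2 * n) X)
  convert h using 3 with w
  funext y
  exact ((localRep_pullback_eventuallyEq φ i.he w.1 (i.hKe y.2)).iteratedFDeriv ℝ i.j).eq_of_nhds

/-- The pullback of closed forms. -/
def pullbackClosed {k : ℕ} (φ : X ≃ₘ⟮𝓡 (2 * n), 𝓡 (2 * n)⟯ X) (w : ClosedForm (2 * n) X k) :
    ClosedForm (2 * n) X k :=
  ⟨pullbackSmooth φ w.1, by
    have h : IsExtDeriv (pullbackSmooth φ w.1) (pullbackSmooth φ 0) := IsExtDeriv.pullback φ w.2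
    exact h⟩

lemma continuous_pullbackClosed {k : ℕ} (φ : X ≃ₘ⟮𝓡 (2 * n), 𝓡 (2 * n)⟯ X) :
    Continuous (pullbackClosed (k := k) φ) :=
  ((continuous_pullbackSmooth φ).comp continuous_subtype_val).subtype_mk _

/-- If `Ω(X)` is open in the space of closed forms, then the projection to the quotient by
`Diff₀(X)` is open. -/
lemma isOpenMap_quotient_mk (o : ManifoldOrientation n X)
    (ho : IsOpen {w : ClosedForm (2 * n) X 2 |
      IsNondegenerate w.1.1 ∧ IsOrientationCompatible o w.1.1}) :
    IsOpenMap (Quotient.mk (orbitSetoid o)) := by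
  intro U hU
  obtain ⟨V, hV, rfl⟩ : ∃ V : Set (ClosedForm (2 * n) X 2), IsOpen V ∧ Subtype.val ⁻¹' V = U :=
    isOpen_induced_iff.1 hU
  rw [isOpen_coinduced]
  rw [isOpen_iff_mem_nhds]
  rintro η ⟨ζ, hζ, hη⟩
  obtain ⟨φ, hφ, h⟩ := Quotient.exact hη.symm
  -- Every form near η is carried by the same φ into the open set around ζ. Openness of Ω(X)
  -- guarantees that the pulled-back closed form is again symplectic and compatible with the
  -- orientation.
  have h1 : pullbackClosed φ η.1 = ζ.1 := Subtype.ext (Subtype.ext h)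
  have h2 : Continuous fun ξ : SymplecticForm o => pullbackClosed φ ξ.1 :=
    (continuous_pullbackClosed φ).comp continuous_subtype_val
  have h4 : pullbackClosed φ η.1 ∈ V ∩ {w : ClosedForm (2 * n) X 2 |
      IsNondegenerate w.1.1 ∧ IsOrientationCompatible o w.1.1} := by
    rw [h1]
    exact ⟨hζ, ζ.2⟩
  have h3 := (h2.isOpen_preimage _ (hV.inter ho)).mem_nhds (x := η) h4
  refine Filter.mem_of_superset h3 fun ξ hξ => ?_
  refine ⟨⟨pullbackClosed φ ξ.1, hξ.2⟩, hξ.1, Quotient.sound (Setoid.symm ?_)⟩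
  exact ⟨φ, hφ, rfl⟩

end Pullback

/-! ### Smooth dependence of integrals over [0,1] on parameters -/

section ParametricIntegral

variable {V G : Type*} [NormedAddCommGroup V] [NormedSpace ℝ V] [FiniteDimensional ℝ V]
  [NormedAddCommGroup G] [NormedSpace ℝ G]

lemma contDiffAt_of_univ_prod {O : Set V} (hO : IsOpen O) {b : ℝ × V → G}
    {n : ℕ∞ω} (hb : ContDiffOn ℝ n b (univ ×ˢ O)) {y : V} (hy : y ∈ O) (t : ℝ) :
    ContDiffAt ℝ n b (t, y) :=
  hb.contDiffAt ((isOpen_univ.prod hO).mem_nhds ⟨mem_univ _, hy⟩)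

lemma continuous_slice {O : Set V} {b : ℝ × V → G} (hb : ContinuousOn b (univ ×ˢ O)) {y : V}
    (hy : y ∈ O) : Continuous fun t => b (t, y) :=
  hb.comp_continuous (by fun_prop) fun t => ⟨mem_univ t, hy⟩

/-- Differentiation under the integral sign. -/
lemma hasFDerivAt_integral_unit {O : Set V} (hO : IsOpen O) {b : ℝ × V → G}
    (hb : ContDiffOn ℝ 1 b (univ ×ˢ O)) {y : V} (hy : y ∈ O) :
    HasFDerivAt (fun y => ∫ t in (0 : ℝ)..1, b (t, y))
      (∫ t in (0 : ℝ)..1, (fderiv ℝ b (t, y)).comp (ContinuousLinearMap.inr ℝ ℝ V)) y := by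
  obtain ⟨r, hr, hrO⟩ := Metric.nhds_basis_closedBall.mem_iff.1 (hO.mem_nhds hy)
  have hD : ContinuousOn (fun p => (fderiv ℝ b p).comp (ContinuousLinearMap.inr ℝ ℝ V))
      (univ ×ˢ O) :=
    (hb.continuousOn_fderiv_of_isOpen (isOpen_univ.prod hO) le_rfl).clm_comp continuousOn_const
  have hK : IsCompact (Icc (0 : ℝ) 1 ×ˢ Metric.closedBall y r) :=
    isCompact_Icc.prod (isCompact_closedBall y r)
  obtain ⟨C, hC⟩ := hK.exists_bound_of_continuousOn (hD.mono (prod_mono (subset_univ _) hrO))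
  refine intervalIntegral.hasFDerivAt_integral_of_dominated_of_fderiv_le
    (F := fun y t => b (t, y))
    (F' := fun y t => (fderiv ℝ b (t, y)).comp (ContinuousLinearMap.inr ℝ ℝ V))
    (bound := fun _ => C) (s := Metric.closedBall y r)
    (Metric.closedBall_mem_nhds y hr) ?_ ?_ ?_ ?_ ?_ ?_
  · filter_upwards [hO.mem_nhds hy] with z hz
    exact (continuous_slice hb.continuousOn hz).aestronglyMeasurable
  · exact (continuous_slice hb.continuousOn hy).intervalIntegrable _ _
  · exact (continuous_slice hD hy).aestronglyMeasurable
  · refine Filter.Eventually.of_forall fun t ht z hz => hC (t, z) ⟨?_, hz⟩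
    rw [uIoc_of_le zero_le_one] at ht
    exact Ioc_subset_Icc_self ht
  · exact intervalIntegrable_const
  · refine Filter.Eventually.of_forall fun t _ z hz => ?_
    have h1 := ((contDiffAt_of_univ_prod hO hb (hrO hz) t).differentiableAt (by simp)).hasFDerivAt
    exact h1.comp z (hasFDerivAt_prodMk_right t z)

lemma fderiv_integral_unit_apply [CompleteSpace G] {O : Set V} (hO : IsOpen O) {b : ℝ × V → G}
    (hb : ContDiffOn ℝ 1 b (univ ×ˢ O)) {y : V} (hy : y ∈ O) (v : V) :
    fderiv ℝ (fun y => ∫ t in (0 : ℝ)..1, b (t, y)) y v =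
      ∫ t in (0 : ℝ)..1, fderiv ℝ b (t, y) (0, v) := by
  have hD : ContinuousOn (fun p => (fderiv ℝ b p).comp (ContinuousLinearMap.inr ℝ ℝ V))
      (univ ×ˢ O) :=
    (hb.continuousOn_fderiv_of_isOpen (isOpen_univ.prod hO) le_rfl).clm_comp continuousOn_const
  rw [(hasFDerivAt_integral_unit hO hb hy).fderiv, ContinuousLinearMap.intervalIntegral_apply]
  · simp
  · exact (continuous_slice hD hy).intervalIntegrable _ _

/-- A directional derivative of the integral is the integral of a directional derivative of the
family, so the induction on the order of smoothness runs over all smooth families at once. -/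
lemma contDiffOn_integral_unit_nat [CompleteSpace G] {O : Set V} (hO : IsOpen O) (n : ℕ) :
    ∀ {b : ℝ × V → G}, ContDiffOn ℝ ∞ b (univ ×ˢ O) →
      ContDiffOn ℝ n (fun y => ∫ t in (0 : ℝ)..1, b (t, y)) O := by
  induction n with
  | zero =>
    intro b hb
    exact contDiffOn_zero.2 fun y hy =>
      (hasFDerivAt_integral_unit hO (hb.of_le one_le_infty) hy).continuousAt.continuousWithinAt
  | succ n ih =>
    intro b hb
    have hb1 := hb.of_le one_le_infty
    refine contDiffOn_succ_of_fderiv_apply (fun y hy =>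
      (hasFDerivAt_integral_unit hO hb1 hy).differentiableAt.differentiableWithinAt)
      (fun h => absurd h (WithTop.natCast_ne_top n)) fun v => ?_
    have h1 : ContDiffOn ℝ ∞ (fun p => fderiv ℝ b p (0, v)) (univ ×ˢ O) :=
      (hb.fderiv_of_isOpen (isOpen_univ.prod hO) (by simp)).clm_apply contDiffOn_const
    refine (ih h1).congr fun y hy => ?_
    rw [fderivWithin_of_isOpen hO hy, fderiv_integral_unit_apply hO hb1 hy]

/-- The integral over `[0,1]` of a smooth family is smooth. -/
lemma contDiffOn_integral_unit [CompleteSpace G] {O : Set V} (hO : IsOpen O)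
    {b : ℝ × V → G} (hb : ContDiffOn ℝ ∞ b (univ ×ˢ O)) :
    ContDiffOn ℝ ∞ (fun y => ∫ t in (0 : ℝ)..1, b (t, y)) O :=
  contDiffOn_infty.2 fun n => contDiffOn_integral_unit_nat hO n hb

end ParametricIntegral

/-! ### Fiber integration and the homotopy formula for 2-forms -/

section FiberIntegration

variable {V : Type*} [NormedAddCommGroup V] [NormedSpace ℝ V] [FiniteDimensional ℝ V]

/-- The contraction of a 2-form on `ℝ × V` with `∂_t`, restricted to the slices. -/
def timeContract (Ω : ℝ × V → (ℝ × V) [⋀^Fin 2]→L[ℝ] ℝ) (p : ℝ × V) : V [⋀^Fin 1]→L[ℝ] ℝ :=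
  ((Ω p).curryLeft ((1 : ℝ), (0 : V))).compContinuousLinearMap (ContinuousLinearMap.inr ℝ ℝ V)

lemma timeContract_apply (Ω : ℝ × V → (ℝ × V) [⋀^Fin 2]→L[ℝ] ℝ) (p : ℝ × V) (v : Fin 1 → V) :
    timeContract Ω p v = Ω p ![(1, 0), (0, v 0)] := by
  simp only [timeContract, ContinuousAlternatingMap.compContinuousLinearMap_apply,
    ContinuousAlternatingMap.curryLeft_apply_apply]
  congr 1
  ext i <;> fin_cases i <;> simp

/-- The fiber integral of a 2-form on `ℝ × V` over `[0,1]`. -/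
def fiberIntegral (Ω : ℝ × V → (ℝ × V) [⋀^Fin 2]→L[ℝ] ℝ) (y : V) : V [⋀^Fin 1]→L[ℝ] ℝ :=
  ∫ t in (0 : ℝ)..1, timeContract Ω (t, y)

lemma contDiffOn_timeContract {S : Set (ℝ × V)} {Ω : ℝ × V → (ℝ × V) [⋀^Fin 2]→L[ℝ] ℝ}
    (hΩ : ContDiffOn ℝ ∞ Ω S) : ContDiffOn ℝ ∞ (timeContract Ω) S := by
  intro p hp
  refine contDiffWithinAt_alt fun v => ?_
  simp_rw [timeContract_apply]
  have h := contDiffWithinAt_alt_apply (v := fun i _ => (![(1, 0), (0, v 0)] : Fin 2 → ℝ × V) i)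
    (hΩ p hp) fun i => contDiffWithinAt_const
  exact h

lemma contDiffOn_fiberIntegral {O : Set V} (hO : IsOpen O)
    {Ω : ℝ × V → (ℝ × V) [⋀^Fin 2]→L[ℝ] ℝ} (hΩ : ContDiffOn ℝ ∞ Ω (univ ×ˢ O)) :
    ContDiffOn ℝ ∞ (fiberIntegral Ω) O :=
  contDiffOn_integral_unit hO (contDiffOn_timeContract hΩ)

lemma fiberIntegral_apply {O : Set V} {Ω : ℝ × V → (ℝ × V) [⋀^Fin 2]→L[ℝ] ℝ}
    (hΩ : ContDiffOn ℝ ∞ Ω (univ ×ˢ O)) {y : V} (hy : y ∈ O) (v : Fin 1 → V) :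
    fiberIntegral Ω y v = ∫ t in (0 : ℝ)..1, Ω (t, y) ![(1, 0), (0, v 0)] := by
  have h := (ContinuousAlternatingMap.apply ℝ V ℝ v).intervalIntegral_comp_comm
    ((continuous_slice (contDiffOn_timeContract hΩ).continuousOn hy).intervalIntegrable
      (μ := MeasureTheory.volume) 0 1)
  refine h.symm.trans ?_
  refine intervalIntegral.integral_congr fun t _ => ?_
  exact timeContract_apply Ω (t, y) v

/-- The homotopy formula for closed 2-forms on `ℝ × V`. -/
lemma extDeriv_fiberIntegral {O : Set V} (hO : IsOpen O)
    {Ω : ℝ × V → (ℝ × V) [⋀^Fin 2]→L[ℝ] ℝ} (hΩ : ContDiffOn ℝ ∞ Ω (univ ×ˢ O))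
    (hd : ∀ t, ∀ y ∈ O, extDeriv Ω (t, y) = 0) {y : V} (hy : y ∈ O) (v : Fin 2 → V) :
    extDeriv (fiberIntegral Ω) y v =
      Ω (1, y) ![(0, v 0), (0, v 1)] - Ω (0, y) ![(0, v 0), (0, v 1)] := by
  have hα := (contDiffOn_fiberIntegral hO hΩ).contDiffAt (hO.mem_nhds hy)
  have hconst : ∀ a : Fin 2 → ℝ × V, ContDiffOn ℝ ∞ (fun p => Ω p a) (univ ×ˢ O) := fun a p hp =>
    contDiffWithinAt_alt_apply (v := fun i _ => a i) (hΩ p hp) fun i => contDiffWithinAt_const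
  have h1 : ∀ u w : V, fderiv ℝ (fun z => fiberIntegral Ω z ![u]) y w =
      ∫ t in (0 : ℝ)..1, fderiv ℝ (fun p => Ω p ![(1, 0), (0, u)]) (t, y) (0, w) := by
    intro u w
    have h2 : (fun z => fiberIntegral Ω z ![u]) =ᶠ[𝓝 y]
        fun z => ∫ t in (0 : ℝ)..1, Ω (t, z) ![(1, 0), (0, u)] := by
      filter_upwards [hO.mem_nhds hy] with z hz
      exact fiberIntegral_apply hΩ hz _
    rw [h2.fderiv_eq]
    exact fderiv_integral_unit_apply hO ((hconst ![(1, 0), (0, u)]).of_le one_le_infty) hy w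
  have hint : ∀ (a : Fin 2 → ℝ × V) (w : ℝ × V),
      Continuous fun t : ℝ => fderiv ℝ (fun p => Ω p a) (t, y) w := by
    intro a w
    exact (continuous_slice ((hconst a).continuousOn_fderiv_of_isOpen (isOpen_univ.prod hO)
      one_le_infty) hy).clm_apply continuous_const
  rw [extDeriv_one_apply (hα.differentiableAt (by simp)), h1, h1,
    ← intervalIntegral.integral_sub ((hint _ _).intervalIntegrable _ _)
      ((hint _ _).intervalIntegrable _ _)]
  -- Closedness evaluated on (∂_t, v 0, v 1) says that the integrand is the time derivative of Ω
  -- restricted to slices; the fundamental theorem of calculus then leaves only the two ends.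
  have h3 : ∀ t : ℝ, HasDerivAt (fun s => Ω (s, y) ![(0, v 0), (0, v 1)])
      (fderiv ℝ (fun p => Ω p ![(1, 0), (0, v 1)]) (t, y) (0, v 0) -
        fderiv ℝ (fun p => Ω p ![(1, 0), (0, v 0)]) (t, y) (0, v 1)) t := by
    intro t
    have h4 := (contDiffAt_of_univ_prod hO hΩ hy t)
    have h5 := DFunLike.congr_fun (hd t y hy) ![(1, 0), (0, v 0), (0, v 1)]
    rw [extDeriv_two_apply (h4.differentiableAt (by simp))] at h5
    simp only [Matrix.cons_val_zero, Matrix.cons_val_one, Matrix.cons_val,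
      ContinuousAlternatingMap.coe_zero, Pi.zero_apply] at h5
    have h6 := ((contDiffAt_of_univ_prod hO (hconst ![(0, v 0), (0, v 1)]) hy t).differentiableAt
      (by simp)).hasFDerivAt.comp_hasDerivAt t ((hasDerivAt_id t).prodMk (hasDerivAt_const t y))
    rw [sub_add, sub_eq_zero] at h5
    rw [← h5]
    exact h6
  rw [intervalIntegral.integral_eq_sub_of_hasDerivAt (fun t _ => h3 t)]
  exact ((hint _ _).sub (hint _ _)).intervalIntegrable _ _

end FiberIntegration

/-! ### Homotopy invariance of the class of a closed 2-form -/

section Homotopy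

variable {m : ℕ} {X : Type*} [TopologicalSpace X] [ChartedSpace (Model m) X]
  {P Q : Type*} [NormedAddCommGroup P] [NormedSpace ℝ P] [NormedAddCommGroup Q] [NormedSpace ℝ Q]

lemma pullVec_comp {k : ℕ} {G : P → X} {f : Q → P} {q : Q}
    (hG : MDifferentiableAt 𝓘(ℝ, P) (𝓡 m) G (f q)) (hf : DifferentiableAt ℝ f q)
    (w : RawForm m X k) :
    pullVec (fun q => G (f q)) w q =
      (pullVec G w (f q)).compContinuousLinearMap (fderiv ℝ f q) := by
  have h1 : mfderiv 𝓘(ℝ, Q) (𝓡 m) (fun q => G (f q)) q =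
      (mfderiv 𝓘(ℝ, P) (𝓡 m) G (f q)).comp (mfderiv 𝓘(ℝ, Q) 𝓘(ℝ, P) f q) :=
    mfderiv_comp q hG hf.mdifferentiableAt
  have h2 : mfderiv 𝓘(ℝ, Q) 𝓘(ℝ, P) f q = fderiv ℝ f q := mfderiv_eq_fderiv
  rw [h2] at h1
  ext v
  simp only [pullVec, h1]
  rfl

lemma localRep_pullback_eq_pullVec {n : ℕ} {X : Type*} [TopologicalSpace X]
    [ChartedSpace (Model (2 * n)) X] {k : ℕ} {φ : X → X}
    (hφ : MDifferentiable (𝓡 (2 * n)) (𝓡 (2 * n)) φ)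
    {e : OpenPartialHomeomorph X (Model (2 * n))}
    (he : e ∈ IsManifold.maximalAtlas (𝓡 (2 * n)) ∞ X) (w : RawForm (2 * n) X k)
    {y : Model (2 * n)} (hy : y ∈ e.target) :
    localRep e (pullback φ w) y = pullVec (fun y => φ (e.symm y)) w y := by
  have h := mfderiv_comp y (hφ (e.symm y)) (mdifferentiableAt_chart_symm he hy)
  have h2 : mfderiv (𝓡 (2 * n)) (𝓡 (2 * n)) (fun y => φ (e.symm y)) y = _ := h
  ext v
  simp only [localRep, pullback, pullVec, h2]
  rfl

variable [IsManifold (𝓡 m) ∞ X]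

lemma pullVec_congr {k : ℕ} {G G' : P → X} {p : P} (h : G =ᶠ[𝓝 p] G') (w : RawForm m X k) :
    pullVec G w p = pullVec G' w p := by
  have h1 := h.mfderiv_eq (I := 𝓘(ℝ, P)) (I' := 𝓡 m)
  have h2 := h.eq_of_nhds
  unfold pullVec
  rw [h2] at h1 ⊢
  rw [h1]

/-- A homotopy, in a chart of the source. -/
def chartHomotopy (Ψ : ℝ × X → X) (e : OpenPartialHomeomorph X (Model m)) (p : ℝ × Model m) : X :=
  Ψ (p.1, e.symm p.2)

lemma contMDiffAt_chartHomotopy {Ψ : ℝ × X → X}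
    (hΨ : ContMDiff (𝓘(ℝ, ℝ).prod (𝓡 m)) (𝓡 m) ∞ Ψ) {e : OpenPartialHomeomorph X (Model m)}
    (he : e ∈ IsManifold.maximalAtlas (𝓡 m) ∞ X) {p : ℝ × Model m} (hp : p.2 ∈ e.target) :
    ContMDiffAt 𝓘(ℝ, ℝ × Model m) (𝓡 m) ∞ (chartHomotopy Ψ e) p := by
  have h1 : ContMDiffAt 𝓘(ℝ, ℝ × Model m) 𝓘(ℝ, ℝ) ∞ (fun q : ℝ × Model m => q.1) p :=
    contDiff_fst.contMDiff.contMDiffAt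
  have h2 : ContMDiffAt 𝓘(ℝ, ℝ × Model m) (𝓡 m) ∞ (fun q : ℝ × Model m => q.2) p :=
    contDiff_snd.contMDiff.contMDiffAt
  have h3 : ContMDiffAt 𝓘(ℝ, ℝ × Model m) (𝓡 m) ∞ (fun q : ℝ × Model m => e.symm q.2) p :=
    (contMDiffAt_symm_of_mem_maximalAtlas he hp).comp p h2
  exact hΨ.contMDiffAt.comp p (h1.prodMk h3)

lemma contDiffOn_pullVec_chartHomotopy {Ψ : ℝ × X → X}
    (hΨ : ContMDiff (𝓘(ℝ, ℝ).prod (𝓡 m)) (𝓡 m) ∞ Ψ) {e : OpenPartialHomeomorph X (Model m)}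
    (he : e ∈ IsManifold.maximalAtlas (𝓡 m) ∞ X) {k : ℕ} (w : SmoothForm m X k) :
    ContDiffOn ℝ ∞ (pullVec (chartHomotopy Ψ e) w.1) (univ ×ˢ e.target) := fun _ hp =>
  (contDiffAt_pullVec (contMDiffAt_chartHomotopy hΨ he hp.2)
    (mem_smoothForm_iff.1 w.2 _)).contDiffWithinAt

/-- The 1-form obtained from a homotopy and a 2-form by integration over the fiber. -/
def homotopyForm (Ψ : ℝ × X → X) (w : RawForm m X 2) : RawForm m X 1 := fun x =>
  chartForm (chartAt (Model m) x)
    (fiberIntegral (pullVec (chartHomotopy Ψ (chartAt (Model m) x)) w)) x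

/-- The 1-form is defined at each point by the preferred chart there. A change of chart acts on time
× space as the identity times a transition map, so it commutes with integration over time, and the
same formula holds in every chart. -/
lemma localRep_homotopyForm {Ψ : ℝ × X → X}
    (hΨ : ContMDiff (𝓘(ℝ, ℝ).prod (𝓡 m)) (𝓡 m) ∞ Ψ) {e : OpenPartialHomeomorph X (Model m)}
    (he : e ∈ IsManifold.maximalAtlas (𝓡 m) ∞ X) (w : SmoothForm m X 2) {y : Model m}
    (hy : y ∈ e.target) :
    localRep e (homotopyForm Ψ w.1) y = fiberIntegral (pullVec (chartHomotopy Ψ e) w.1) y := by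
  obtain ⟨x, hx, rfl⟩ : ∃ x ∈ e.source, e x = y := ⟨e.symm y, e.map_target hy, e.right_inv hy⟩
  set c := chartAt (Model m) x with hc
  have hcm := IsManifold.chart_mem_maximalAtlas (I := 𝓡 m) (n := ∞) x
  have hxc : x ∈ c.source := mem_chart_source (Model m) x
  rw [localRep_eq_comp_of_eq_chartForm hcm he hxc hx (w := homotopyForm Ψ w.1) rfl, ← hc]
  have hex : e.symm (e x) = x := e.left_inv hx
  have hτ : ContDiffAt ℝ ∞ (fun y => c (e.symm y)) (e x) :=
    contDiffAt_chart_comp hcm (contMDiffAt_symm_of_mem_maximalAtlas he hy) (by rwa [hex])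
  ext v
  rw [ContinuousAlternatingMap.compContinuousLinearMap_apply,
    fiberIntegral_apply (contDiffOn_pullVec_chartHomotopy hΨ hcm w) (c.map_source hxc),
    fiberIntegral_apply (contDiffOn_pullVec_chartHomotopy hΨ he w) hy]
  refine intervalIntegral.integral_congr fun t _ => ?_
  have h1 : chartHomotopy Ψ e =ᶠ[𝓝 (t, e x)]
      fun p => chartHomotopy Ψ c (p.1, c (e.symm p.2)) := by
    have h2 : ContinuousAt (fun p : ℝ × Model m => e.symm p.2) (t, e x) :=
      (e.continuousAt_symm hy).comp (x := (t, e x)) continuousAt_snd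
    have h3 : (fun p : ℝ × Model m => e.symm p.2) ⁻¹' c.source ∈ 𝓝 (t, e x) :=
      h2.preimage_mem_nhds (c.open_source.mem_nhds (by simpa [hex] using hxc))
    filter_upwards [h3] with p hp
    simp only [chartHomotopy]
    rw [c.left_inv hp]
  have hτd : HasFDerivAt (fun p : ℝ × Model m => (p.1, c (e.symm p.2)))
      ((ContinuousLinearMap.fst ℝ ℝ (Model m)).prod
        ((fderiv ℝ (fun y => c (e.symm y)) (e x)).comp (ContinuousLinearMap.snd ℝ ℝ (Model m))))
      (t, e x) :=
    hasFDerivAt_fst.prodMk (HasFDerivAt.comp (g := fun y => c (e.symm y)) (t, e x)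
      (hτ.differentiableAt (by simp)).hasFDerivAt hasFDerivAt_snd)
  have h4 : c (e.symm (e x)) = c x := by rw [hex]
  have h5 := pullVec_comp (G := chartHomotopy Ψ c)
    (f := fun p : ℝ × Model m => (p.1, c (e.symm p.2))) (q := (t, e x))
    ((contMDiffAt_chartHomotopy hΨ hcm (by rw [h4]; exact c.map_source hxc)).mdifferentiableAt
      (by simp)) hτd.differentiableAt w.1
  rw [pullVec_congr h1 w.1, h5, hτd.fderiv, h4]
  simp only [ContinuousAlternatingMap.compContinuousLinearMap_apply]
  congr 1
  ext i <;> fin_cases i <;> simp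

/-- Homotopy invariance: the difference of the pullbacks of a closed 2-form at the two ends of a
smooth homotopy is exact. -/
lemma exists_isExtDeriv_of_homotopy {Ψ : ℝ × X → X}
    (hΨ : ContMDiff (𝓘(ℝ, ℝ).prod (𝓡 m)) (𝓡 m) ∞ Ψ) (w : ClosedForm m X 2)
    (β : SmoothForm m X 2)
    (hβ : ∀ e ∈ IsManifold.maximalAtlas (𝓡 m) ∞ X, ∀ y ∈ e.target, localRep e β.1 y =
      pullVec (fun y => Ψ (1, e.symm y)) w.1.1 y - pullVec (fun y => Ψ (0, e.symm y)) w.1.1 y) :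
    ∃ α : SmoothForm m X 1, IsExtDeriv α β := by
  have hloc : ∀ e ∈ IsManifold.maximalAtlas (𝓡 m) ∞ X, ∀ y ∈ e.target,
      localRep e (homotopyForm Ψ w.1.1) y =
        fiberIntegral (pullVec (chartHomotopy Ψ e) w.1.1) y := fun e he y hy =>
    localRep_homotopyForm hΨ he w.1 hy
  refine ⟨⟨homotopyForm Ψ w.1.1, fun e he => ?_⟩, fun e he y hy => ?_⟩
  · exact (contDiffOn_fiberIntegral e.open_target
      (contDiffOn_pullVec_chartHomotopy hΨ he w.1)).congr (hloc e he)
  · have h1 : localRep e (homotopyForm Ψ w.1.1) =ᶠ[𝓝 y]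
        fiberIntegral (pullVec (chartHomotopy Ψ e) w.1.1) := by
      filter_upwards [e.open_target.mem_nhds hy] with z hz
      exact hloc e he z hz
    have hclosed : ∀ t, ∀ z ∈ e.target, extDeriv (pullVec (chartHomotopy Ψ e) w.1.1) (t, z) = 0 := by
      intro t z hz
      rw [extDeriv_pullVec (contMDiffAt_chartHomotopy hΨ he hz) (mem_smoothForm_iff.1 w.1.2 _)
        (isExtDeriv_iff.1 w.2 _)]
      ext v
      rfl
    have hend : ∀ s : ℝ, ∀ v : Fin 2 → Model m, pullVec (fun y => Ψ (s, e.symm y)) w.1.1 y v =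
        pullVec (chartHomotopy Ψ e) w.1.1 (s, y) ![(0, v 0), (0, v 1)] := by
      intro s v
      have h2 := pullVec_comp (G := chartHomotopy Ψ e) (f := fun y : Model m => (s, y)) (q := y)
        ((contMDiffAt_chartHomotopy hΨ he hy).mdifferentiableAt (by simp))
        (hasFDerivAt_prodMk_right s y).differentiableAt w.1.1
      have h3 := DFunLike.congr_fun h2 v
      rw [(hasFDerivAt_prodMk_right s y).fderiv] at h3
      refine h3.trans ?_
      rw [ContinuousAlternatingMap.compContinuousLinearMap_apply]
      congr 1
      ext i <;> fin_cases i <;> simp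
    rw [hβ e he y hy, h1.extDeriv_eq]
    ext v
    rw [extDeriv_fiberIntegral e.open_target (contDiffOn_pullVec_chartHomotopy hΨ he w.1) hclosed
      hy, ContinuousAlternatingMap.sub_apply, hend, hend]

end Homotopy

/-! ### Invariance of the cohomology class under Diff₀(X) -/

section Isotopy

variable {n : ℕ} {X : Type*} [TopologicalSpace X] [ChartedSpace (Model (2 * n)) X]
  [IsManifold (𝓡 (2 * n)) ∞ X]

/-- Diffeomorphisms isotopic to the identity preserve the cohomology class of closed 2-forms. -/
lemma cohomClass_pullback {φ : X ≃ₘ⟮𝓡 (2 * n), 𝓡 (2 * n)⟯ X} (hφ : IsIsotopicToId φ)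
    (w : ClosedForm (2 * n) X 2) : cohomClass (pullbackClosed φ w) = cohomClass w := by
  obtain ⟨ψ, hψ, hψ0, hψ1⟩ := hφ
  -- An isotopy is smooth only over [0,1]. Reparametrizing time by the smooth transition gives a
  -- homotopy that is smooth on all of ℝ × X with the same two ends.
  let Ψ : ℝ × X → X := fun p => ψ (Real.smoothTransition p.1) p.2
  have hΨ : ContMDiff (𝓘(ℝ, ℝ).prod (𝓡 (2 * n))) (𝓡 (2 * n)) ∞ Ψ := by
    have h1 : ContMDiff (𝓘(ℝ, ℝ).prod (𝓡 (2 * n))) 𝓘(ℝ, ℝ) ∞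
        (fun p : ℝ × X => Real.smoothTransition p.1) :=
      (Real.smoothTransition.contDiff (n := ⊤)).contMDiff.comp contMDiff_fst
    refine contMDiffOn_univ.1 (hψ.comp (h1.prodMk contMDiff_snd).contMDiffOn fun p _ => ?_)
    exact ⟨⟨Real.smoothTransition.nonneg _, Real.smoothTransition.le_one _⟩, mem_univ _⟩
  refine (Submodule.Quotient.eq (ExactTwoForm (2 * n) X)).2 ?_
  refine exists_isExtDeriv_of_homotopy hΨ w (pullbackClosed φ w - w).1 fun e he y hy => ?_
  have h1 : (fun y => Ψ (1, e.symm y)) = fun y => φ (e.symm y) := by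
    funext z
    simp only [Ψ, Real.smoothTransition.one, hψ1]
  have h0 : (fun y => Ψ (0, e.symm y)) = e.symm := by
    funext z
    simp only [Ψ, Real.smoothTransition.zero, hψ0]
    rfl
  rw [h1, h0, ← localRep_eq_pullVec,
    ← localRep_pullback_eq_pullVec (φ.mdifferentiable (by simp)) he w.1.1 hy]
  rfl

end Isotopy

/-! ### Superposition operators on the Banach space of paths -/

section Nemytskii

open unitInterval

variable {F G : Type*} [NormedAddCommGroup F] [NormedSpace ℝ F]
  [NormedAddCommGroup G] [NormedSpace ℝ G]

/-- Pointwise application of a path of operators to a path. -/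
def pathApply (F G : Type*) [NormedAddCommGroup F] [NormedSpace ℝ F]
    [NormedAddCommGroup G] [NormedSpace ℝ G] : C(I, F →L[ℝ] G) →L[ℝ] C(I, F) →L[ℝ] C(I, G) :=
  LinearMap.mkContinuous₂
    (LinearMap.mk₂ ℝ (fun (A : C(I, F →L[ℝ] G)) (u : C(I, F)) => (⟨fun t => A t (u t), by fun_prop⟩ : C(I, G)))
      (fun _ _ _ => by ext; simp) (fun _ _ _ => by ext; simp) (fun _ _ _ => by ext; simp)
      (fun _ _ _ => by ext; simp)) 1 fun A u => by
    rw [one_mul]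
    refine (ContinuousMap.norm_le _ (by positivity)).2 fun t => ?_
    exact (A t).le_of_opNorm_le_of_le (A.norm_coe_le_norm t) (u.norm_coe_le_norm t)

lemma norm_pathApply_le (A : C(I, F →L[ℝ] G)) {c : ℝ} (hc : 0 ≤ c) (hA : ∀ t, ‖A t‖ ≤ c) :
    ‖pathApply F G A‖ ≤ c := by
  refine ContinuousLinearMap.opNorm_le_bound _ hc fun u => ?_
  refine (ContinuousMap.norm_le _ (by positivity)).2 fun t => ?_
  exact (A t).le_of_opNorm_le_of_le (hA t) (u.norm_coe_le_norm t)

/-- Composition of a path with a continuous map. -/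
def pathComp (g : C(F, G)) (u : C(I, F)) : C(I, G) := g.comp u

/-- The path has compact image, so the derivative of `g` varies little near it, uniformly in time;
the mean value inequality then bounds the remainder in the sup norm. -/
lemma hasFDerivAt_pathComp {g : F → G} (hg : ContDiff ℝ 1 g) (u : C(I, F)) :
    HasFDerivAt (pathComp ⟨g, hg.continuous⟩)
      (pathApply F G (pathComp ⟨fderiv ℝ g, hg.continuous_fderiv one_ne_zero⟩ u)) u := by
  rw [hasFDerivAt_iff_isLittleO_nhds_zero, Asymptotics.isLittleO_iff]
  intro c hc
  have h1 := (isCompact_range u.continuous).uniformContinuousAt_of_continuousAt (fderiv ℝ g)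
    (fun a _ => (hg.continuous_fderiv one_ne_zero).continuousAt) (Metric.dist_mem_uniformity hc)
  obtain ⟨δ, hδ, h2⟩ := Metric.mem_uniformity_dist.1 h1
  filter_upwards [Metric.ball_mem_nhds (0 : C(I, F)) hδ] with h hh
  refine (ContinuousMap.norm_le _ (by positivity)).2 fun t => ?_
  have h3 : ∀ x ∈ Metric.ball (u t) δ, ‖fderiv ℝ g x - fderiv ℝ g (u t)‖ ≤ c := by
    intro x hx
    have h4 : dist (fderiv ℝ g (u t)) (fderiv ℝ g x) < c :=
      h2 (by rwa [dist_comm]) (mem_range_self t)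
    rw [← dist_eq_norm, dist_comm]
    exact h4.le
  have hht : ‖h t‖ < δ := (h.norm_coe_le_norm t).trans_lt (by simpa using hh)
  have h5 := (convex_ball (u t) δ).norm_image_sub_le_of_norm_fderiv_le' (𝕜 := ℝ) (f := g)
    (fun x _ => (hg.differentiable one_ne_zero) x) h3 (Metric.mem_ball_self hδ)
    (y := u t + h t) (by simpa using hht)
  simp only [add_sub_cancel_left] at h5
  exact h5.trans (mul_le_mul_of_nonneg_left (h.norm_coe_le_norm t) hc.le)

/-- The derivative is a continuous linear map applied to the superposition operator of `fderiv ℝ g`,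
which allows induction. The target space changes at each stage, so it is quantified inside the
induction. -/
lemma contDiff_pathComp.{u} {F : Type u} [NormedAddCommGroup F] [NormedSpace ℝ F] (n : ℕ) :
    ∀ {G : Type u} [NormedAddCommGroup G] [NormedSpace ℝ G] {g : F → G} (hg : ContDiff ℝ ∞ g),
      ContDiff ℝ n (pathComp ⟨g, hg.continuous⟩) := by
  induction n with
  | zero =>
    intro G _ _ g hg
    exact contDiff_zero.2 (continuous_iff_continuousAt.2 fun u =>
      (hasFDerivAt_pathComp (hg.of_le one_le_infty) u).continuousAt)
  | succ n ih =>
    intro G _ _ g hg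
    have h1 := hasFDerivAt_pathComp (hg.of_le one_le_infty)
    refine contDiff_succ_iff_fderiv.2 ⟨fun u => (h1 u).differentiableAt,
      fun h => absurd h (WithTop.natCast_ne_top n), ?_⟩
    have h2 : fderiv ℝ (pathComp ⟨g, hg.continuous⟩) = fun u => pathApply F G
        (pathComp ⟨fderiv ℝ g, (hg.of_le one_le_infty).continuous_fderiv one_ne_zero⟩ u) :=
      funext fun u => (h1 u).fderiv
    rw [h2]
    have h3 : ContDiff ℝ n (pathApply F G) :=
      ContinuousLinearMap.contDiff (E := C(I, F →L[ℝ] G)) (F := C(I, F) →L[ℝ] C(I, G)) _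
    exact h3.comp (ih (hg.fderiv_right (m := ∞) le_rfl))

end Nemytskii

/-! ### The indefinite integral as a bounded operator on paths -/

section PathIntegral

open unitInterval

variable {F : Type*} [NormedAddCommGroup F] [NormedSpace ℝ F]

lemma norm_unit_integral_le {f : ℝ → F} {c : ℝ} (hf : ∀ s, ‖f s‖ ≤ c) (t : I) :
    ‖∫ s in (0 : ℝ)..t, f s‖ ≤ c := by
  have hc : 0 ≤ c := (norm_nonneg _).trans (hf 0)
  have h := intervalIntegral.norm_integral_le_of_norm_le_const (a := (0 : ℝ)) (b := t)
    (fun s _ => hf s)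
  refine h.trans ?_
  rw [sub_zero, abs_of_nonneg t.2.1]
  exact mul_le_of_le_one_right hc t.2.2

/-- The extension of a path to the real line by constants. -/
def pathExtend (u : C(I, F)) (s : ℝ) : F := u (projIcc 0 1 zero_le_one s)

lemma continuous_pathExtend (u : C(I, F)) : Continuous (pathExtend u) :=
  u.continuous.comp continuous_projIcc

lemma pathExtend_of_mem (u : C(I, F)) (s : I) : pathExtend u s = u s := by
  simp [pathExtend]

/-- The indefinite integral of a path. -/
def pathIntegral (F : Type*) [NormedAddCommGroup F] [NormedSpace ℝ F] : C(I, F) →L[ℝ] C(I, F) :=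
  LinearMap.mkContinuous
    { toFun := fun u => ⟨fun t => ∫ s in (0 : ℝ)..t, pathExtend u s,
        (intervalIntegral.continuous_primitive
          (fun _ _ => (continuous_pathExtend u).intervalIntegrable _ _) 0).comp
          continuous_subtype_val⟩
      map_add' := fun u v => by
        ext t
        exact intervalIntegral.integral_add ((continuous_pathExtend u).intervalIntegrable _ _)
          ((continuous_pathExtend v).intervalIntegrable _ _)
      map_smul' := fun c u => by
        ext t
        exact intervalIntegral.integral_smul c _ } 1 fun u => by
    rw [one_mul]
    exact (ContinuousMap.norm_le _ (norm_nonneg _)).2 fun t =>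
      norm_unit_integral_le (fun s => u.norm_coe_le_norm _) t

lemma pathIntegral_apply (u : C(I, F)) (t : I) :
    pathIntegral F u t = ∫ s in (0 : ℝ)..t, pathExtend u s := rfl

lemma norm_pathIntegral_le : ‖pathIntegral F‖ ≤ 1 :=
  LinearMap.mkContinuous_norm_le _ zero_le_one _

end PathIntegral

/-! ### Global flows of bounded Lipschitz fields and their smoothness -/

section Flow

open unitInterval NNReal

variable {F : Type*} [NormedAddCommGroup F] [NormedSpace ℝ F] [CompleteSpace F]

/-- A bounded Lipschitz vector field has global integral curves. -/
lemma exists_global_integral_curve {W : F → F} {K L : ℝ≥0} (hK : LipschitzWith K W)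
    (hL : ∀ z, ‖W z‖ ≤ L) (z : F) :
    ∃ γ : ℝ → F, γ 0 = z ∧ ∀ t, HasDerivAt γ (W (γ t)) t := by
  have h1 : ∀ N : ℕ, ∃ γ : ℝ → F, γ 0 = z ∧
      ∀ t ∈ Ioo (-(N + 1 : ℝ)) (N + 1), HasDerivAt γ (W (γ t)) t := by
    intro N
    have h0 : (0 : ℝ) ∈ Icc (-(N + 1 : ℝ)) (N + 1) := by constructor <;> linarith [N.cast_nonneg (α := ℝ)]
    -- With speed at most L, a curve defined for time N + 1 stays in the ball of radius L(N + 1), so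
    -- Picard–Lindelöf applies on the whole interval.
    have hPL : IsPicardLindelof (fun _ => W) (⟨0, h0⟩ : Icc (-(N + 1 : ℝ)) (N + 1)) z
        (L * (N + 1)) 0 L K :=
      { lipschitzOnWith := fun _ _ => hK.lipschitzOnWith
        continuousOn := fun _ _ => continuousOn_const
        norm_le := fun _ _ x _ => hL x
        mul_max_le := by simp }
    obtain ⟨γ, hγ0, hγ⟩ := hPL.exists_eq_forall_mem_Icc_hasDerivWithinAt₀
    exact ⟨γ, hγ0, fun t ht => (hγ t (Ioo_subset_Icc_self ht)).hasDerivAt (Icc_mem_nhds ht.1 ht.2)⟩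
  choose γ hγ0 hγ using h1
  have h2 : ∀ M N : ℕ, M ≤ N → ∀ t ∈ Ioo (-(M + 1 : ℝ)) (M + 1), γ N t = γ M t := by
    intro M N hMN t ht
    have hM : (0 : ℝ) ≤ M := M.cast_nonneg
    have hMN' : (M : ℝ) ≤ N := by exact_mod_cast hMN
    refine ODE_solution_unique_of_mem_Ioo (v := fun _ => W) (s := fun _ => univ) (K := K)
      (t₀ := 0) (a := -(M + 1 : ℝ)) (b := M + 1) (fun _ _ => hK.lipschitzOnWith)
      ⟨by linarith, by linarith⟩ (fun s hs => ⟨hγ N s ⟨by linarith [hs.1], by linarith [hs.2]⟩,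
        mem_univ _⟩) (fun s hs => ⟨hγ M s hs, mem_univ _⟩) ?_ ht
    rw [hγ0, hγ0]
  have habs : ∀ t : ℝ, t ∈ Ioo (-(⌈|t|⌉₊ + 1 : ℝ)) (⌈|t|⌉₊ + 1) := fun t => by
    have := Nat.le_ceil |t|
    have := abs_le.1 this
    constructor <;> linarith
  -- The solutions on growing intervals agree by uniqueness, so at time t the one with index ⌈|t|⌉
  -- may be used; near t they all agree with the next one.
  refine ⟨fun t => γ ⌈|t|⌉₊ t, hγ0 _, fun t => ?_⟩
  have h3 : (fun t => γ ⌈|t|⌉₊ t) =ᶠ[𝓝 t] γ (⌈|t|⌉₊ + 1) := by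
    have h4 : ∀ᶠ s in 𝓝 t, |s| < |t| + 1 := continuous_abs.continuousAt.eventually_lt_const (by simp)
    filter_upwards [h4] with s hs
    refine (h2 _ _ ?_ s (habs s)).symm
    calc ⌈|s|⌉₊ ≤ ⌈|t| + 1⌉₊ := Nat.ceil_mono hs.le
      _ = ⌈|t|⌉₊ + 1 := Nat.ceil_add_one (abs_nonneg t)
  have h5 := habs t
  refine ((hγ (⌈|t|⌉₊ + 1) t ?_).congr_of_eventuallyEq h3).congr_deriv ?_
  · push_cast
    exact ⟨by linarith [h5.1], by linarith [h5.2]⟩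
  · exact congrArg W h3.eq_of_nhds.symm

/-- The defining properties of a global flow. -/
structure IsFlow (W : F → F) (Φ : ℝ → F → F) : Prop where
  zero : ∀ z, Φ 0 z = z
  hasDerivAt : ∀ z t, HasDerivAt (fun s => Φ s z) (W (Φ t z)) t

lemma exists_isFlow {W : F → F} {K L : ℝ≥0} (hK : LipschitzWith K W) (hL : ∀ z, ‖W z‖ ≤ L) :
    ∃ Φ, IsFlow W Φ := by
  choose γ h0 h1 using exists_global_integral_curve hK hL
  exact ⟨fun t z => γ z t, h0, h1⟩

lemma IsFlow.eq_of_hasDerivAt {W : F → F} {Φ : ℝ → F → F} (h : IsFlow W Φ) {K : ℝ≥0}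
    (hK : LipschitzWith K W) {γ : ℝ → F} (hγ : ∀ t, HasDerivAt γ (W (γ t)) t) (t : ℝ) :
    Φ t (γ 0) = γ t := by
  refine congrFun (ODE_solution_unique_univ (v := fun _ => W) (s := fun _ => univ) (t₀ := 0)
    (fun _ => hK.lipschitzOnWith) (fun t => ⟨h.hasDerivAt (γ 0) t, mem_univ _⟩)
    (fun t => ⟨hγ t, mem_univ _⟩) ?_) t
  exact h.zero _

lemma IsFlow.add {W : F → F} {Φ : ℝ → F → F} (h : IsFlow W Φ) {K : ℝ≥0}
    (hK : LipschitzWith K W) (s t : ℝ) (z : F) : Φ s (Φ t z) = Φ (s + t) z := by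
  have h1 := h.eq_of_hasDerivAt hK (γ := fun s => Φ (s + t) z)
    (fun r => (h.hasDerivAt z (r + t)).comp_add_const r t) s
  simpa using h1

lemma IsFlow.iterate {W : F → F} {Φ : ℝ → F → F} (h : IsFlow W Φ) {K : ℝ≥0}
    (hK : LipschitzWith K W) (s : ℝ) (n : ℕ) (z : F) : (Φ s)^[n] z = Φ (n * s) z := by
  induction n with
  | zero => simp [h.zero]
  | succ n ih =>
    rw [Function.iterate_succ_apply', ih, h.add hK]
    congr 1
    push_cast
    ring

/-- The integral equation for integral curves, on the time interval `[0,1]`, with the time scale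
as a parameter. -/
def flowEquation {W : F → F} (hW : Continuous W) (p : (ℝ × F) × C(I, F)) : C(I, F) :=
  p.2 - ContinuousMap.const I p.1.2 - p.1.1 • pathIntegral F (pathComp ⟨W, hW⟩ p.2)

lemma contDiff_flowEquation {W : F → F} (hW : ContDiff ℝ ∞ W) :
    ContDiff ℝ ∞ (flowEquation hW.continuous) := by
  have h1 : ContDiff ℝ ∞ (pathComp ⟨W, hW.continuous⟩) :=
    contDiff_infty.2 fun n => contDiff_pathComp n hW
  have h2 : ContDiff ℝ ∞ (fun p : (ℝ × F) × C(I, F) => (ContinuousMap.const I p.1.2 : C(I, F))) :=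
    (ContinuousLinearMap.const ℝ I : F →L[ℝ] C(I, F)).contDiff.comp
      (contDiff_snd.comp contDiff_fst)
  exact (contDiff_snd.sub h2).sub ((contDiff_fst.comp contDiff_fst).smul
    ((pathIntegral F).contDiff.comp (h1.comp contDiff_snd)))

/-- The partial derivative in the path is the identity minus τ times integration of DW along the
path. That correction has norm at most |τ|K < 1, so a Neumann series inverts it. -/
lemma isInvertible_fderiv_flowEquation {W : F → F} (hW : ContDiff ℝ ∞ W) {K : ℝ≥0}
    (hK : LipschitzWith K W) {p : (ℝ × F) × C(I, F)} (hp : |p.1.1| * K < 1) :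
    (fderiv ℝ (flowEquation hW.continuous) p ∘L .inr ℝ (ℝ × F) C(I, F)).IsInvertible := by
  have hW1 : ContDiff ℝ 1 W := hW.of_le one_le_infty
  set T : C(I, F) →L[ℝ] C(I, F) := p.1.1 • (pathIntegral F ∘L
    pathApply F F (pathComp ⟨fderiv ℝ W, hW1.continuous_fderiv one_ne_zero⟩ p.2)) with hT
  have h1 : fderiv ℝ (flowEquation hW.continuous) p ∘L .inr ℝ (ℝ × F) C(I, F) =
      ContinuousLinearMap.id ℝ _ - T := by
    have h2 : HasFDerivAt (fun u => flowEquation hW.continuous (p.1, u))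
        (fderiv ℝ (flowEquation hW.continuous) p ∘L .inr ℝ (ℝ × F) C(I, F)) p.2 :=
      HasFDerivAt.comp (g := flowEquation hW.continuous) p.2
        ((contDiff_flowEquation hW).differentiable (by simp) p).hasFDerivAt
        (hasFDerivAt_prodMk_right p.1 p.2)
    have h3 : HasFDerivAt (fun u => flowEquation hW.continuous (p.1, u))
        (ContinuousLinearMap.id ℝ _ - T) p.2 := by
      refine HasFDerivAt.sub (f := fun u : C(I, F) => u - ContinuousMap.const I p.1.2)
        ((hasFDerivAt_id _).sub_const _) ?_
      have h4 : HasFDerivAt (fun u : C(I, F) => pathIntegral F (pathComp ⟨W, hW.continuous⟩ u))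
          (pathIntegral F ∘L
            pathApply F F (pathComp ⟨fderiv ℝ W, hW1.continuous_fderiv one_ne_zero⟩ p.2)) p.2 :=
        HasFDerivAt.comp (g := ⇑(pathIntegral F)) p.2 (pathIntegral F).hasFDerivAt
          (hasFDerivAt_pathComp hW1 p.2)
      exact h4.const_smul p.1.1
    exact h2.unique h3
  have hn : ‖T‖ < 1 := by
    refine lt_of_le_of_lt (ContinuousLinearMap.opNorm_le_bound _ (by positivity) fun v => ?_) hp
    have hA := (pathApply F F (pathComp ⟨fderiv ℝ W, hW1.continuous_fderiv one_ne_zero⟩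
      p.2)).le_of_opNorm_le (norm_pathApply_le _ K.2 fun t => norm_fderiv_le_of_lipschitz ℝ hK) v
    have hP := (pathIntegral F).le_of_opNorm_le norm_pathIntegral_le (pathApply F F
      (pathComp ⟨fderiv ℝ W, hW1.continuous_fderiv one_ne_zero⟩ p.2) v)
    rw [one_mul] at hP
    have h4 : T v = p.1.1 • pathIntegral F (pathApply F F
      (pathComp ⟨fderiv ℝ W, hW1.continuous_fderiv one_ne_zero⟩ p.2) v) := rfl
    rw [h4, norm_smul, Real.norm_eq_abs, mul_assoc]
    exact mul_le_mul_of_nonneg_left (hP.trans hA) (abs_nonneg _)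
  rw [h1]
  exact ⟨ContinuousLinearEquiv.unitsEquiv ℝ _ (Units.oneSub T hn), rfl⟩

lemma flowEquation_flow {W : F → F} (hW : Continuous W) {Φ : ℝ → F → F} (h : IsFlow W Φ)
    (τ : ℝ) (z : F) {u : C(I, F)} (hu : ∀ s : I, u s = Φ (τ * s) z) :
    flowEquation hW ((τ, z), u) = 0 := by
  have hd : ∀ s, HasDerivAt (fun s => Φ (τ * s) z) (τ • W (Φ (τ * s) z)) s := fun s => by
    have h1 := HasDerivAt.scomp (g₁ := fun s => Φ s z) s (h.hasDerivAt z (τ * s))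
      ((hasDerivAt_id s).const_mul τ)
    rw [mul_one] at h1
    exact h1
  have hc : Continuous fun s => Φ (τ * s) z :=
    continuous_iff_continuousAt.2 fun s => (hd s).continuousAt
  ext t
  have h2 := intervalIntegral.integral_eq_sub_of_hasDerivAt (a := 0) (b := t) (fun s _ => hd s)
    ((hW.comp hc).const_smul τ |>.intervalIntegrable _ _)
  rw [intervalIntegral.integral_smul, mul_zero, h.zero] at h2
  have h3 : ∫ s in (0 : ℝ)..t, pathExtend (pathComp ⟨W, hW⟩ u) s =
      ∫ s in (0 : ℝ)..t, W (Φ (τ * s) z) := by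
    refine intervalIntegral.integral_congr fun s hs => ?_
    rw [uIcc_of_le t.2.1] at hs
    have h4 := pathExtend_of_mem (pathComp ⟨W, hW⟩ u) ⟨s, hs.1, hs.2.trans t.2.2⟩
    refine h4.trans ?_
    exact congrArg W (hu _)
  simp only [flowEquation, ContinuousMap.sub_apply, ContinuousMap.smul_apply, pathIntegral_apply,
    ContinuousMap.const_apply, ContinuousMap.zero_apply]
  rw [h3, h2, hu, sub_self]

/-- A path satisfying the integral equation agrees on [0,1] with a differentiable solution of the
time-scaled ODE, so ODE uniqueness identifies it with the flow. -/
lemma eq_flow_of_flowEquation {W : F → F} {K : ℝ≥0} (hK : LipschitzWith K W) {Φ : ℝ → F → F}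
    (h : IsFlow W Φ) {τ : ℝ} {z : F} {u : C(I, F)}
    (hu : flowEquation hK.continuous ((τ, z), u) = 0) : u 1 = Φ τ z := by
  have hWu : Continuous (pathExtend (pathComp ⟨W, hK.continuous⟩ u)) := continuous_pathExtend _
  set v : ℝ → F := fun t => z + τ • ∫ s in (0 : ℝ)..t, pathExtend (pathComp ⟨W, hK.continuous⟩ u) s
    with hv
  have h1 : ∀ t : I, u t = v t := by
    intro t
    have h2 := DFunLike.congr_fun hu t
    simp only [flowEquation, ContinuousMap.sub_apply, ContinuousMap.smul_apply,
      pathIntegral_apply, ContinuousMap.const_apply, ContinuousMap.zero_apply] at h2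
    rw [sub_sub, sub_eq_zero] at h2
    exact h2
  have hvd : ∀ t ∈ Icc (0 : ℝ) 1, HasDerivAt v (τ • W (v t)) t := by
    intro t ht
    have h3 := ((hWu.integral_hasStrictDerivAt 0 t).hasDerivAt.const_smul τ).const_add z
    have h4 : pathExtend (pathComp ⟨W, hK.continuous⟩ u) t = W (v t) := by
      have h5 := pathExtend_of_mem (pathComp ⟨W, hK.continuous⟩ u) ⟨t, ht⟩
      refine h5.trans ?_
      exact congrArg W (h1 ⟨t, ht⟩)
    rwa [h4] at h3
  have hd : ∀ s, HasDerivAt (fun s => Φ (τ * s) z) (τ • W (Φ (τ * s) z)) s := fun s => by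
    have h1 := HasDerivAt.scomp (g₁ := fun s => Φ s z) s (h.hasDerivAt z (τ * s))
      ((hasDerivAt_id s).const_mul τ)
    rw [mul_one] at h1
    exact h1
  have h6 := ODE_solution_unique (v := fun _ y => τ • W y) (K := ‖τ‖₊ * K) (a := 0) (b := 1)
    (f := v) (g := fun s => Φ (τ * s) z)
    (fun _ => (lipschitzWith_smul τ).comp hK)
    (fun t ht => (hvd t ht).continuousAt.continuousWithinAt)
    (fun t ht => (hvd t (Ico_subset_Icc_self ht)).hasDerivWithinAt)
    (fun t _ => (hd t).continuousAt.continuousWithinAt)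
    (fun t _ => (hd t).hasDerivWithinAt) (by simp [hv, h.zero])
  have h7 := h6 (right_mem_Icc.2 zero_le_one)
  simp only [mul_one] at h7
  exact (h1 1).trans h7

/-- The implicit function theorem, applied to the integral equation at the actual trajectory, yields
a solution path depending smoothly on the time scale and the initial point. Its endpoint is the
flow. -/
lemma IsFlow.contDiffAt_small {W : F → F} (hW : ContDiff ℝ ∞ W) {K : ℝ≥0}
    (hK : LipschitzWith K W) {Φ : ℝ → F → F} (h : IsFlow W Φ) {τ : ℝ} (hτ : |τ| * K < 1) (z : F) :
    ContDiffAt ℝ ∞ (fun p : ℝ × F => Φ p.1 p.2) (τ, z) := by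
  have hc : Continuous fun s => Φ s z :=
    continuous_iff_continuousAt.2 fun s => (h.hasDerivAt z s).continuousAt
  let u : C(I, F) := ⟨fun s => Φ (τ * s) z, by fun_prop⟩
  have h0 := flowEquation_flow hW.continuous h τ z (u := u) fun s => rfl
  have h1 : ContDiffAt ℝ ∞ (flowEquation hW.continuous) ((τ, z), u) :=
    (contDiff_flowEquation hW).contDiffAt
  have h2 := isInvertible_fderiv_flowEquation hW hK (p := ((τ, z), u)) hτ
  have h3 := h1.eventually_apply_implicitFunction (by simp) h2
  have h4 := h1.contDiffAt_implicitFunction (by simp) h2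
  have h5 : ContDiffAt ℝ ∞ (fun p => ContinuousMap.evalCLM ℝ (1 : I)
      (h1.implicitFunction (by simp) h2 p)) (τ, z) :=
    ContDiffAt.comp (g := ⇑(ContinuousMap.evalCLM ℝ (1 : I) : C(I, F) →L[ℝ] F)) (τ, z)
      (ContinuousMap.evalCLM ℝ (1 : I) : C(I, F) →L[ℝ] F).contDiff.contDiffAt h4
  refine h5.congr_of_eventuallyEq ?_
  filter_upwards [h3] with p hp
  rw [h0] at hp
  exact (eq_flow_of_flowEquation hK h hp).symm

/-- The flow of a smooth bounded Lipschitz vector field is smooth. -/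
lemma IsFlow.contDiff {W : F → F} (hW : ContDiff ℝ ∞ W) {K : ℝ≥0}
    (hK : LipschitzWith K W) {Φ : ℝ → F → F} (h : IsFlow W Φ) :
    ContDiff ℝ ∞ (fun p : ℝ × F => Φ p.1 p.2) := by
  -- Arbitrary times reduce to small ones: the flow at time τ is the n-th iterate of the flow at
  -- time τ/n, with n chosen larger than |τ|K.
  have h1 : ∀ (δ : ℝ) (n : ℕ) (τ : ℝ) (z : F), |τ * δ| * K < 1 →
      ContDiffAt ℝ ∞ (fun p : ℝ × F => (Φ (p.1 * δ))^[n] p.2) (τ, z) := by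
    intro δ n τ z hδ
    induction n with
    | zero => exact contDiffAt_snd
    | succ n ih =>
      simp only [Function.iterate_succ_apply']
      have h2 := h.contDiffAt_small hW hK hδ ((Φ (τ * δ))^[n] z)
      exact ContDiffAt.comp (f := fun p : ℝ × F => (p.1 * δ, (Φ (p.1 * δ))^[n] p.2)) (τ, z) h2
        ((contDiffAt_fst.mul contDiffAt_const).prodMk ih)
  rw [contDiff_iff_contDiffAt]
  rintro ⟨τ, z⟩
  obtain ⟨n, hn⟩ := exists_nat_gt (|τ| * K)
  have hn0 : (0 : ℝ) < n := lt_of_le_of_lt (by positivity) hn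
  have h3 := h1 (n : ℝ)⁻¹ n τ z (by
    rw [abs_mul, abs_of_pos (inv_pos.2 hn0), mul_right_comm, ← div_eq_mul_inv, div_lt_one hn0]
    exact hn)
  refine h3.congr_of_eventuallyEq (Filter.Eventually.of_forall fun p => ?_)
  simp only []
  rw [h.iterate hK]
  congr 1
  field_simp

end Flow

/-! ### Inverting the contraction with a nondegenerate 2-form -/

section Contraction

variable {V : Type*} [NormedAddCommGroup V] [NormedSpace ℝ V] [FiniteDimensional ℝ V]

lemma finrank_alt_one : Module.finrank ℝ V = Module.finrank ℝ (V [⋀^Fin 1]→L[ℝ] ℝ) := by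
  let e : (V →L[ℝ] ℝ) ≃ₗ[ℝ] (V [⋀^Fin 1]→L[ℝ] ℝ) :=
    (ContinuousAlternatingMap.ofSubsingleton ℝ V ℝ (0 : Fin 1)).toLinearEquiv
      { map_add := fun _ _ => rfl
        map_smul := fun _ _ => rfl }
  rw [← e.finrank_eq,
    ← (LinearMap.toContinuousLinearMap : (V →ₗ[ℝ] ℝ) ≃ₗ[ℝ] (V →L[ℝ] ℝ)).finrank_eq]
  exact (Subspace.dual_finrank_eq (K := ℝ) (V := V)).symm

/-- Nondegeneracy is injectivity of u ↦ w(u, ·), and a finite-dimensional space has the same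
dimension as its space of 1-forms. -/
lemma isInvertible_curryLeft {w : V [⋀^Fin 2]→L[ℝ] ℝ} (h : ∀ u, u ≠ 0 → ∃ v, w ![u, v] ≠ 0) :
    w.curryLeft.IsInvertible := by
  have hinj : Function.Injective w.curryLeft.toLinearMap := by
    rw [← LinearMap.ker_eq_bot, LinearMap.ker_eq_bot']
    intro u hu
    by_contra hne
    obtain ⟨v, hv⟩ := h u hne
    exact hv (DFunLike.congr_fun (show w.curryLeft u = 0 from hu) ![v])
  exact ⟨(LinearEquiv.ofInjectiveOfFinrankEq _ hinj finrank_alt_one).toContinuousLinearEquiv,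
    by ext; rfl⟩

lemma contDiff_curryLeft : ContDiff ℝ ∞ (fun w : V [⋀^Fin 2]→L[ℝ] ℝ => w.curryLeft) :=
  contDiff_clm_apply_iff.2 fun u => contDiff_iff_contDiffAt.2 fun _ => contDiffAt_alt fun v =>
    contDiffAt_alt_apply (v := fun i _ => (Matrix.vecCons u v : Fin 2 → V) i) contDiffAt_id
      fun _ => contDiffAt_const

lemma contDiffAt_curryLeft_inverse {P : Type*} [NormedAddCommGroup P] [NormedSpace ℝ P]
    {f : P → V [⋀^Fin 2]→L[ℝ] ℝ} {p : P} (hf : ContDiffAt ℝ ∞ f p)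
    (h : ∀ u, u ≠ 0 → ∃ v, f p ![u, v] ≠ 0) :
    ContDiffAt ℝ ∞ (fun q => (f q).curryLeft.inverse) p := by
  have := FiniteDimensional.complete ℝ V
  obtain ⟨e, he⟩ := isInvertible_curryLeft h
  have h1 : ContDiffAt ℝ ∞ (fun q => (f q).curryLeft) p :=
    contDiff_curryLeft.contDiffAt.comp p hf
  refine ContDiffAt.comp (g := ContinuousLinearMap.inverse) p ?_ h1
  rw [← he]
  exact contDiffAt_map_inverse e

lemma curryLeft_inverse_apply {w : V [⋀^Fin 2]→L[ℝ] ℝ} (h : ∀ u, u ≠ 0 → ∃ v, w ![u, v] ≠ 0)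
    (b : V [⋀^Fin 1]→L[ℝ] ℝ) (v : V) : w ![w.curryLeft.inverse b, v] = b ![v] := by
  obtain ⟨e, he⟩ := isInvertible_curryLeft h
  have h1 : w.curryLeft (w.curryLeft.inverse b) = b := by
    rw [← he, ContinuousLinearMap.inverse_equiv]
    exact e.apply_symm_apply b
  exact DFunLike.congr_fun h1 ![v]

end Contraction

/-! ### Isotopies generated by time-dependent vector fields -/

section TimeDependent

variable {V : Type*} [NormedAddCommGroup V] [NormedSpace ℝ V] [FiniteDimensional ℝ V]

/-- A smooth compactly supported time-dependent vector field generates a smooth isotopy. -/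
lemma exists_isotopy_of_vectorField {Y : ℝ × V → V} (hY : ContDiff ℝ ∞ Y)
    (hYc : HasCompactSupport Y) {K : Set V} (hK : ∀ t, ∀ y ∉ K, Y (t, y) = 0) :
    ∃ θ ξ : ℝ → V → V, ContDiff ℝ ∞ (fun p : ℝ × V => θ p.1 p.2) ∧
      ContDiff ℝ ∞ (fun p : ℝ × V => ξ p.1 p.2) ∧ (∀ t y, θ t (ξ t y) = y) ∧
      (∀ t y, ξ t (θ t y) = y) ∧ (∀ y, θ 0 y = y) ∧ (∀ t, ∀ y ∉ K, θ t y = y) ∧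
      ∀ y t, HasDerivAt (fun s => θ s y) (Y (t, θ t y)) t := by
  have := FiniteDimensional.complete ℝ V
  -- Suspension: the autonomous field ∂_t + Y on ℝ × V, to which the flow theory applies; it is
  -- bounded and Lipschitz because Y has compact support.
  let W : ℝ × V → ℝ × V := fun z => (1, Y z)
  have hW : ContDiff ℝ ∞ W := contDiff_const.prodMk hY
  obtain ⟨C, hC⟩ := ContDiff.lipschitzWith_of_hasCompactSupport hYc hY (by simp)
  obtain ⟨B, hB⟩ := hYc.exists_bound_of_continuous hY.continuous
  have hL : LipschitzWith (max 0 C) W := (LipschitzWith.const (1 : ℝ)).prodMk hC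
  have hWB : ∀ z, ‖W z‖ ≤ (max 1 B).toNNReal := fun z => by
    refine le_trans ?_ (Real.le_coe_toNNReal _)
    rw [Prod.norm_def]
    exact max_le_max (by simp [W]) (hB z)
  obtain ⟨Φ, hΦ⟩ := exists_isFlow hL hWB
  have hΦs := hΦ.contDiff hW hL
  have hfst : ∀ t s y, (Φ t (s, y)).1 = s + t := by
    intro t s y
    have h1 : ∀ r, HasDerivAt (fun r => (Φ r (s, y)).1 - r) 0 r := fun r => by
      have h2 : HasDerivAt (fun r => (Φ r (s, y)).1) 1 r := (hΦ.hasDerivAt (s, y) r).fst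
      exact (h2.sub (hasDerivAt_id r)).congr_deriv (sub_self _)
    have h3 := is_const_of_deriv_eq_zero (fun r => (h1 r).differentiableAt)
      (fun r => (h1 r).deriv) t 0
    simp only [hΦ.zero] at h3
    linarith
  have hfix : ∀ t s, ∀ y ∉ K, Φ t (s, y) = (s + t, y) := by
    intro t s y hy
    have h1 := hΦ.eq_of_hasDerivAt hL (γ := fun r => (s + r, y)) (fun r => by
      have h2 := ((hasDerivAt_id r).const_add s).prodMk (hasDerivAt_const r y)
      simpa [W, hK _ y hy] using h2) t
    simpa using h1
  have hθ : ∀ t y, Φ t (0, y) = (t, (Φ t (0, y)).2) := fun t y =>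
    Prod.ext (by simp [hfst]) rfl
  have hξ : ∀ t y, Φ (-t) (t, y) = (0, (Φ (-t) (t, y)).2) := fun t y =>
    Prod.ext (by simp [hfst]) rfl
  -- θ_t flows forward from the slice at time 0, and its inverse ξ_t flows back from the slice at
  -- time t.
  refine ⟨fun t y => (Φ t (0, y)).2, fun t y => (Φ (-t) (t, y)).2, ?_, ?_, ?_, ?_, ?_, ?_, ?_⟩
  · exact contDiff_snd.comp (hΦs.comp (contDiff_fst.prodMk (contDiff_const.prodMk contDiff_snd)))
  · exact contDiff_snd.comp (hΦs.comp (contDiff_fst.neg.prodMk (contDiff_fst.prodMk contDiff_snd)))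
  · intro t y
    simp only []
    rw [← hξ, hΦ.add hL, add_neg_cancel, hΦ.zero]
  · intro t y
    simp only []
    rw [← hθ, hΦ.add hL, neg_add_cancel, hΦ.zero]
  · intro y
    simp only [hΦ.zero]
  · intro t y hy
    simp only [hfix t 0 y hy]
  · intro y t
    have h1 := (hΦ.hasDerivAt (0, y) t).snd
    rw [hθ t y] at h1
    exact h1

/-- A closed 2-form on `ℝ × V` killed by `∂_t + Y` is preserved by the isotopy generated by `Y`. -/
lemma isotopy_pullback_eq {O : Set V} (hO : IsOpen O) {Y : ℝ × V → V} {θ : ℝ → V → V}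
    (hθ : ContDiff ℝ ∞ (fun p : ℝ × V => θ p.1 p.2)) (hθ0 : ∀ y, θ 0 y = y)
    (hθO : ∀ t, ∀ y ∈ O, θ t y ∈ O) (hθd : ∀ y t, HasDerivAt (fun s => θ s y) (Y (t, θ t y)) t)
    {Ω : ℝ × V → (ℝ × V) [⋀^Fin 2]→L[ℝ] ℝ} (hΩ : ContDiffOn ℝ ∞ Ω (univ ×ˢ O))
    (hd : ∀ t, ∀ y ∈ O, extDeriv Ω (t, y) = 0)
    (hY : ∀ t, ∀ y ∈ O, ∀ u, Ω (t, y) ![(1, Y (t, y)), u] = 0) {y : V} (hy : y ∈ O)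
    (v : Fin 2 → V) :
    Ω (1, θ 1 y) ![(0, fderiv ℝ (θ 1) y (v 0)), (0, fderiv ℝ (θ 1) y (v 1))] =
      Ω (0, y) ![(0, v 0), (0, v 1)] := by
  -- The map G sends ∂_t to ∂_t + Y, so the pullback of Ω by G is closed and is killed by ∂_t. Its
  -- fiber integral vanishes, and the homotopy formula equates the restrictions to the slices 0 and
  -- 1.
  let G : ℝ × V → ℝ × V := fun p => (p.1, θ p.1 p.2)
  have hG : ContDiff ℝ ∞ G := contDiff_fst.prodMk hθ
  let Ω' : ℝ × V → (ℝ × V) [⋀^Fin 2]→L[ℝ] ℝ := fun p =>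
    (Ω (G p)).compContinuousLinearMap (fderiv ℝ G p)
  have hΩG : ∀ t, ∀ z ∈ O, ContDiffAt ℝ ∞ Ω (G (t, z)) := fun t z hz =>
    contDiffAt_of_univ_prod hO hΩ (hθO t z hz) t
  have h1 : ContDiffOn ℝ ∞ Ω' (univ ×ˢ O) := by
    rintro ⟨t, z⟩ ⟨-, hz⟩
    exact (contDiffAt_alt_comp (ContDiffAt.comp (g := Ω) (t, z) (hΩG t z hz) hG.contDiffAt)
      (contDiffAt_fderiv hG.contDiffAt)).contDiffWithinAt
  have h2 : ∀ t, ∀ z ∈ O, extDeriv Ω' (t, z) = 0 := by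
    intro t z hz
    have h3 := extDeriv_pullback ((hΩG t z hz).differentiableAt (by simp))
      (hG.contDiffAt (x := (t, z))) (by simpa using two_le_infty)
    refine h3.trans ?_
    have h4 : extDeriv Ω (G (t, z)) = 0 := hd t _ (hθO t z hz)
    rw [h4]
    rfl
  have hGt : ∀ t z, fderiv ℝ G (t, z) (1, 0) = (1, Y (t, θ t z)) := by
    intro t z
    have h5 : HasDerivAt (fun s => G (s, z)) (fderiv ℝ G (t, z) (1, 0)) t :=
      ((hG.differentiable (by simp)) (t, z)).hasFDerivAt.comp_hasDerivAt t
        ((hasDerivAt_id t).prodMk (hasDerivAt_const t z))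
    exact h5.unique ((hasDerivAt_id t).prodMk (hθd z t))
  have hGy : ∀ t z u, fderiv ℝ G (t, z) (0, u) = (0, fderiv ℝ (θ t) z u) := by
    intro t z u
    have h5 : HasFDerivAt (fun z => G (t, z)) (fderiv ℝ G (t, z) ∘L .inr ℝ ℝ V) z :=
      HasFDerivAt.comp (g := G) z ((hG.differentiable (by simp)) (t, z)).hasFDerivAt
        (hasFDerivAt_prodMk_right t z)
    have h6 : Differentiable ℝ (θ t) :=
      (hθ.comp (contDiff_const.prodMk contDiff_id)).differentiable (by simp)
    have h7 := h5.unique ((hasFDerivAt_const t z).prodMk (h6 z).hasFDerivAt)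
    exact DFunLike.congr_fun h7 u
  have h3 : fiberIntegral Ω' =ᶠ[𝓝 y] 0 := by
    filter_upwards [hO.mem_nhds hy] with z hz
    ext u
    rw [fiberIntegral_apply h1 hz]
    have h4 : ∀ t : ℝ, Ω' (t, z) ![(1, 0), (0, u 0)] = 0 := by
      intro t
      have h5 := hY t (θ t z) (hθO t z hz) (fderiv ℝ G (t, z) (0, u 0))
      rw [← hGt t z] at h5
      refine Eq.trans ?_ h5
      simp only [Ω', ContinuousAlternatingMap.compContinuousLinearMap_apply]
      congr 1
      ext i <;> fin_cases i <;> rfl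
    simp [h4]
  have h4 := extDeriv_fiberIntegral hO h1 h2 hy v
  have h5 : extDeriv (fiberIntegral Ω') y = 0 := by
    rw [h3.extDeriv_eq]
    have := extDeriv_smul (x := y) (0 : ℝ) (0 : V → V [⋀^Fin 1]→L[ℝ] ℝ)
    simpa using this
  rw [h5] at h4
  have h6 : ∀ t, Ω' (t, y) ![(0, v 0), (0, v 1)] =
      Ω (t, θ t y) ![(0, fderiv ℝ (θ t) y (v 0)), (0, fderiv ℝ (θ t) y (v 1))] := by
    intro t
    rw [← hGy, ← hGy]
    simp only [Ω', ContinuousAlternatingMap.compContinuousLinearMap_apply]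
    congr 1
    ext i <;> fin_cases i <;> rfl
  have h7 : θ 0 = id := funext hθ0
  rw [h6, h6, h7, fderiv_id] at h4
  exact (sub_eq_zero.1 h4.symm)

end TimeDependent

/-! ### Moser's argument on an open subset of Euclidean space -/

section LocalMoser

variable {V : Type*} [NormedAddCommGroup V] [NormedSpace ℝ V] [FiniteDimensional ℝ V]

lemma contDiff_smoothTransition : ContDiff ℝ ∞ Real.smoothTransition :=
  Real.smoothTransition.contDiff (n := ⊤)

lemma deriv_smoothTransition_of_notMem {t : ℝ} (ht : t ∉ Icc (0 : ℝ) 1) :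
    deriv Real.smoothTransition t = 0 := by
  rw [mem_Icc, not_and_or, not_le, not_le] at ht
  rcases ht with ht | ht
  · have h : Real.smoothTransition =ᶠ[𝓝 t] fun _ => 0 := by
      filter_upwards [Iio_mem_nhds ht] with s hs
      exact Real.smoothTransition.zero_of_nonpos (le_of_lt hs)
    rw [h.deriv_eq, deriv_const]
  · have h : Real.smoothTransition =ᶠ[𝓝 t] fun _ => 1 := by
      filter_upwards [Ioi_mem_nhds ht] with s hs
      exact Real.smoothTransition.one_of_one_le (le_of_lt hs)
    rw [h.deriv_eq, deriv_const]

lemma contDiff_deriv_smoothTransition : ContDiff ℝ ∞ (deriv Real.smoothTransition) :=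
  (contDiff_infty_iff_deriv.1 contDiff_smoothTransition).2

/-- The time-dependent vector field of Moser's argument. -/
def moserField (η : V → V [⋀^Fin 2]→L[ℝ] ℝ) (b : V → V [⋀^Fin 1]→L[ℝ] ℝ) (p : ℝ × V) : V :=
  -deriv Real.smoothTransition p.1 •
    (η p.2 + Real.smoothTransition p.1 • extDeriv b p.2).curryLeft.inverse (b p.2)

/-- The closed 2-form on `ℝ × V` interpolating between `η` and `η + db`. -/
def moserForm (η : V → V [⋀^Fin 2]→L[ℝ] ℝ) (b : V → V [⋀^Fin 1]→L[ℝ] ℝ) (p : ℝ × V) :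
    (ℝ × V) [⋀^Fin 2]→L[ℝ] ℝ :=
  (η p.2).compContinuousLinearMap (.snd ℝ ℝ V) + extDeriv (fun q : ℝ × V =>
    Real.smoothTransition q.1 • (b q.2).compContinuousLinearMap (.snd ℝ ℝ V)) p

variable {O K : Set V} {η : V → V [⋀^Fin 2]→L[ℝ] ℝ} {b : V → V [⋀^Fin 1]→L[ℝ] ℝ}

lemma contDiff_moserPotential (hb : ContDiff ℝ ∞ b) : ContDiff ℝ ∞ (fun q : ℝ × V =>
    Real.smoothTransition q.1 • (b q.2).compContinuousLinearMap (.snd ℝ ℝ V)) :=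
  contDiff_iff_contDiffAt.2 fun _ =>
    ((contDiff_smoothTransition.comp contDiff_fst).contDiffAt).smul
      (contDiffAt_alt_comp (hb.comp contDiff_snd).contDiffAt contDiffAt_const)

/-- With χ the smooth transition, d(χb) = χ' dt ∧ b + χ db. The slices interpolate from η to η + db,
while the dt-term is exactly what Moser's field must cancel. -/
lemma moserForm_apply (hb : ContDiff ℝ ∞ b) (t : ℝ) (y : V) (u v : ℝ × V) :
    moserForm η b (t, y) ![u, v] =
      (η y + Real.smoothTransition t • extDeriv b y) ![u.2, v.2] +
        deriv Real.smoothTransition t * (u.1 * b y ![v.2] - v.1 * b y ![u.2]) := by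
  have h1 : ∀ u v : ℝ × V, fderiv ℝ (fun q : ℝ × V => (Real.smoothTransition q.1 •
      (b q.2).compContinuousLinearMap (.snd ℝ ℝ V)) ![u]) (t, y) v =
      deriv Real.smoothTransition t * v.1 * b y ![u.2] +
        Real.smoothTransition t * fderiv ℝ (fun z => b z ![u.2]) y v.2 := by
    intro u v
    have h2 : HasFDerivAt (fun q : ℝ × V => Real.smoothTransition q.1)
        (deriv Real.smoothTransition t • ContinuousLinearMap.fst ℝ ℝ V) (t, y) :=
      HasDerivAt.comp_hasFDerivAt (h₂ := Real.smoothTransition) (t, y)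
        ((contDiff_smoothTransition.differentiable (by simp) t).hasDerivAt) hasFDerivAt_fst
    have hbu : ContDiff ℝ ∞ fun z => b z ![u.2] := contDiff_iff_contDiffAt.2 fun z =>
      contDiffAt_alt_apply (v := fun i _ => (![u.2] : Fin 1 → V) i) hb.contDiffAt
        fun _ => contDiffAt_const
    have h3 : HasFDerivAt (fun q : ℝ × V => b q.2 ![u.2])
        (fderiv ℝ (fun z => b z ![u.2]) y ∘L .snd ℝ ℝ V) (t, y) :=
      HasFDerivAt.comp (g := fun z => b z ![u.2]) (t, y)
        (hbu.differentiable (by simp) y).hasFDerivAt hasFDerivAt_snd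
    have h4 : (fun q : ℝ × V => (Real.smoothTransition q.1 •
        (b q.2).compContinuousLinearMap (.snd ℝ ℝ V)) ![u]) =
        fun q => Real.smoothTransition q.1 * b q.2 ![u.2] := by
      funext q
      simp only [ContinuousAlternatingMap.smul_apply, smul_eq_mul,
        ContinuousAlternatingMap.compContinuousLinearMap_apply]
      congr 2
      ext i; fin_cases i; rfl
    rw [h4]
    refine (DFunLike.congr_fun (h2.mul h3).fderiv v).trans ?_
    simp
    ring
  have h5 : ((η y).compContinuousLinearMap (.snd ℝ ℝ V)) ![u, v] = η y ![u.2, v.2] := by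
    rw [ContinuousAlternatingMap.compContinuousLinearMap_apply]
    congr 1
    ext i; fin_cases i <;> rfl
  rw [moserForm, ContinuousAlternatingMap.add_apply, h5, extDeriv_one_apply
    ((contDiff_moserPotential hb).differentiable (by simp) _), h1, h1,
    ContinuousAlternatingMap.add_apply, ContinuousAlternatingMap.smul_apply,
    extDeriv_one_apply (hb.differentiable (by simp) _)]
  simp only [Matrix.cons_val_zero, Matrix.cons_val_one, smul_eq_mul]
  ring

lemma contDiffOn_moserForm (hη : ContDiffOn ℝ ∞ η O) (hO : IsOpen O) (hb : ContDiff ℝ ∞ b) :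
    ContDiffOn ℝ ∞ (moserForm η b) (univ ×ˢ O) := fun p hp =>
  ((contDiffAt_alt_comp (ContDiffAt.comp (g := η) p (hη.contDiffAt (hO.mem_nhds hp.2))
    contDiffAt_snd) contDiffAt_const).add
    (contDiffAt_extDeriv (contDiff_moserPotential hb).contDiffAt)).contDiffWithinAt

lemma extDeriv_moserForm (hη : ContDiffOn ℝ ∞ η O) (hO : IsOpen O)
    (hdη : ∀ y ∈ O, extDeriv η y = 0) (hb : ContDiff ℝ ∞ b) (t : ℝ) {y : V} (hy : y ∈ O) :
    extDeriv (moserForm η b) (t, y) = 0 := by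
  have hηy := hη.contDiffAt (hO.mem_nhds hy)
  have h1 : DifferentiableAt ℝ
      (fun p : ℝ × V => (η p.2).compContinuousLinearMap (.snd ℝ ℝ V)) (t, y) :=
    (contDiffAt_alt_comp (ContDiffAt.comp (g := η) (t, y) hηy
      contDiffAt_snd) contDiffAt_const).differentiableAt (by simp)
  have h2 := extDeriv_add h1 ((contDiffAt_extDeriv
    (contDiff_moserPotential hb).contDiffAt).differentiableAt (by simp) (x := (t, y)))
  have h3 := extDeriv_pullback (f := (Prod.snd : ℝ × V → V)) (x := (t, y))
    (hηy.differentiableAt (by simp)) (contDiff_snd (n := ∞)).contDiffAt (by simpa using two_le_infty)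
  rw [hdη y hy] at h3
  simp only [fderiv_snd] at h3
  refine h2.trans ?_
  rw [extDeriv_extDeriv_apply (contDiff_moserPotential hb).contDiffAt
    (by simpa using two_le_infty), add_zero]
  exact h3

lemma smoothTransition_mem_Icc (t : ℝ) : Real.smoothTransition t ∈ Icc (0 : ℝ) 1 :=
  ⟨Real.smoothTransition.nonneg _, Real.smoothTransition.le_one _⟩

/-- On O the contraction can be inverted smoothly; on the complement of K the field is zero. Since K
is contained in O, these two open sets cover V. -/
lemma contDiff_moserField (hO : IsOpen O) (hK : IsClosed K) (hKO : K ⊆ O)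
    (hη : ContDiffOn ℝ ∞ η O) (hb : ContDiff ℝ ∞ b) (hbK : ∀ y ∉ K, b y = 0)
    (hnd : ∀ y ∈ O, ∀ s ∈ Icc (0 : ℝ) 1, ∀ u, u ≠ 0 → ∃ v, (η y + s • extDeriv b y) ![u, v] ≠ 0) :
    ContDiff ℝ ∞ (moserField η b) := by
  rw [contDiff_iff_contDiffAt]
  rintro ⟨t, y⟩
  by_cases hy : y ∈ O
  · have h1 : ContDiffAt ℝ ∞ (fun p : ℝ × V =>
        η p.2 + Real.smoothTransition p.1 • extDeriv b p.2) (t, y) :=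
      (ContDiffAt.comp (g := η) (t, y) (hη.contDiffAt (hO.mem_nhds hy)) contDiffAt_snd).add
        ((contDiff_smoothTransition.comp contDiff_fst).contDiffAt.smul
          (ContDiffAt.comp (g := extDeriv b) (t, y) (contDiffAt_extDeriv hb.contDiffAt)
            contDiffAt_snd))
    have h2 := contDiffAt_curryLeft_inverse h1 (hnd y hy _ (smoothTransition_mem_Icc t))
    exact ((contDiff_deriv_smoothTransition.comp contDiff_fst).neg.contDiffAt).smul
      (h2.clm_apply (hb.comp contDiff_snd).contDiffAt)
  · have h1 : moserField η b =ᶠ[𝓝 (t, y)] fun _ => 0 := by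
      filter_upwards [(hK.isOpen_compl.preimage continuous_snd).mem_nhds
        (show y ∈ Kᶜ from fun h => hy (hKO h))] with p hp
      simp [moserField, hbK p.2 hp]
    exact contDiffAt_const.congr_of_eventuallyEq h1

/-- Moser's theorem for a compactly supported change of a closed nondegenerate 2-form. -/
lemma exists_moser_isotopy (hO : IsOpen O) (hK : IsCompact K) (hKO : K ⊆ O)
    (hη : ContDiffOn ℝ ∞ η O) (hdη : ∀ y ∈ O, extDeriv η y = 0) (hb : ContDiff ℝ ∞ b)
    (hbK : ∀ y ∉ K, b y = 0)
    (hnd : ∀ y ∈ O, ∀ s ∈ Icc (0 : ℝ) 1, ∀ u, u ≠ 0 → ∃ v, (η y + s • extDeriv b y) ![u, v] ≠ 0) :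
    ∃ θ ξ : ℝ → V → V, ContDiff ℝ ∞ (fun p : ℝ × V => θ p.1 p.2) ∧
      ContDiff ℝ ∞ (fun p : ℝ × V => ξ p.1 p.2) ∧ (∀ t y, θ t (ξ t y) = y) ∧
      (∀ t y, ξ t (θ t y) = y) ∧ (∀ y, θ 0 y = y) ∧ (∀ t, ∀ y ∉ K, θ t y = y) ∧
      ∀ y ∈ O, (η (θ 1 y) + extDeriv b (θ 1 y)).compContinuousLinearMap (fderiv ℝ (θ 1) y) =
        η y := by
  have hYK : ∀ t, ∀ y ∉ K, moserField η b (t, y) = 0 := fun t y hy => by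
    simp [moserField, hbK y hy]
  -- Compactness of the support in time comes from the factor χ', which vanishes outside [0,1]; in
  -- space it comes from b.
  have hYc : HasCompactSupport (moserField η b) := by
    refine HasCompactSupport.intro (isCompact_Icc.prod hK) (K := Icc (0 : ℝ) 1 ×ˢ K) ?_
    rintro ⟨t, y⟩ hty
    by_cases hy : y ∈ K
    · have ht : t ∉ Icc (0 : ℝ) 1 := fun ht => hty ⟨ht, hy⟩
      simp [moserField, deriv_smoothTransition_of_notMem ht]
    · exact hYK t y hy
  obtain ⟨θ, ξ, h1, h2, h3, h4, h5, h6, h7⟩ := exists_isotopy_of_vectorField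
    (contDiff_moserField hO hK.isClosed hKO hη hb hbK hnd) hYc hYK
  refine ⟨θ, ξ, h1, h2, h3, h4, h5, h6, fun y hy => ?_⟩
  -- A point leaving O would land outside K, where θ_t is the identity; injectivity of θ_t then
  -- forces it to have been outside O already.
  have hθO : ∀ t, ∀ y ∈ O, θ t y ∈ O := by
    intro t y hy
    by_contra hne
    have h8 : θ t y ∉ K := fun h => hne (hKO h)
    have h9 : ξ t (θ t y) = ξ t (θ t (θ t y)) := by rw [h6 t _ h8]
    rw [h4, h4] at h9
    exact hne (h9 ▸ hy)
  ext v
  have h8 := isotopy_pullback_eq hO h1 h5 hθO h7 (contDiffOn_moserForm hη hO hb)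
    (fun t y hy => extDeriv_moserForm hη hO hdη hb t hy) (fun t y hy u => ?_) hy v
  · rw [moserForm_apply hb, moserForm_apply hb] at h8
    simp only [Real.smoothTransition.one, Real.smoothTransition.zero, one_smul, zero_smul, zero_mul,
      sub_zero, mul_zero, add_zero] at h8
    rw [ContinuousAlternatingMap.compContinuousLinearMap_apply]
    convert h8 using 2 <;> ext i <;> fin_cases i <;> rfl
  · rw [moserForm_apply hb]
    have hw := curryLeft_inverse_apply (hnd y hy _ (smoothTransition_mem_Icc t)) (b y)
    set w := η y + Real.smoothTransition t • extDeriv b y with hwdef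
    have hs : ∀ (c : ℝ) (x u : V), w ![c • x, u] = c * w ![x, u] := by
      exact fun c x u => DFunLike.congr_fun (w.curryLeft.map_smul c x) ![u]
    have hY : moserField η b (t, y) = -deriv Real.smoothTransition t • w.curryLeft.inverse (b y) :=
      rfl
    have hbs : b y ![moserField η b (t, y)] =
        -deriv Real.smoothTransition t * b y ![w.curryLeft.inverse (b y)] := by
      rw [hY]
      exact DFunLike.congr_fun ((b y).curryLeft.map_smul _ _) ![]
    -- With w the interpolated form, the field is Y = −χ' Z where w(Z, ·) = b. Hence b(Z) = w(Z, Z)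
    -- = 0, and the remaining terms −χ' b and χ' b cancel.
    have h0 : b y ![w.curryLeft.inverse (b y)] = 0 := by
      rw [← hw]
      exact w.map_eq_zero_of_eq _ (i := 0) (j := 1) rfl (by simp)
    rw [hbs, h0, hY, hs, hw]
    ring

end LocalMoser

/-! ### Extending compactly supported maps of a chart by the identity -/

section ChartExtend

variable {m : ℕ} {X : Type*} [TopologicalSpace X] [ChartedSpace (Model m) X]

open Classical in
/-- The self-map of `X` that is `f` in the chart `e` and the identity off the chart. -/
def chartExtend (e : OpenPartialHomeomorph X (Model m)) (f : Model m → Model m) (x : X) : X :=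
  if x ∈ e.source then e.symm (f (e x)) else x

lemma chartExtend_of_mem {e : OpenPartialHomeomorph X (Model m)} (f : Model m → Model m) {x : X}
    (hx : x ∈ e.source) : chartExtend e f x = e.symm (f (e x)) := if_pos hx

lemma chartExtend_of_notMem {e : OpenPartialHomeomorph X (Model m)} (f : Model m → Model m) {x : X}
    (hx : x ∉ e.source) : chartExtend e f x = x := if_neg hx

lemma chartExtend_eq_self {e : OpenPartialHomeomorph X (Model m)} {f : Model m → Model m}
    {K : Set X} (hf : ∀ y ∉ e '' K, f y = y) (hK : K ⊆ e.source) {x : X} (hx : x ∉ K) :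
    chartExtend e f x = x := by
  by_cases h : x ∈ e.source
  · rw [chartExtend_of_mem f h, hf, e.left_inv h]
    rintro ⟨z, hz, hze⟩
    exact hx (e.injOn (hK hz) h hze ▸ hz)
  · exact chartExtend_of_notMem f h

lemma chartExtend_chartExtend {e : OpenPartialHomeomorph X (Model m)} {f g : Model m → Model m}
    (hg : ∀ y ∈ e.target, g y ∈ e.target) (hfg : ∀ y, f (g y) = y) (x : X) :
    chartExtend e f (chartExtend e g x) = x := by
  by_cases h : x ∈ e.source
  · have h1 := hg _ (e.map_source h)
    rw [chartExtend_of_mem g h, chartExtend_of_mem f (e.map_target h1), e.right_inv h1, hfg,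
      e.left_inv h]
  · rw [chartExtend_of_notMem g h, chartExtend_of_notMem f h]

/-- X is covered by the chart domain, where the map has its coordinate expression, and the
complement of K, where it is the identity. The latter is open because X is Hausdorff. -/
lemma contMDiff_chartExtend [T2Space X] {e : OpenPartialHomeomorph X (Model m)}
    (he : e ∈ IsManifold.maximalAtlas (𝓡 m) ∞ X) {K : Set X} (hK : IsCompact K)
    (hKe : K ⊆ e.source) {θ : ℝ → Model m → Model m}
    (hθ : ContDiff ℝ ∞ (fun p : ℝ × Model m => θ p.1 p.2))
    (hθe : ∀ t, ∀ y ∈ e.target, θ t y ∈ e.target) (hθK : ∀ t, ∀ y ∉ e '' K, θ t y = y) :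
    ContMDiff (𝓘(ℝ, ℝ).prod (𝓡 m)) (𝓡 m) ∞ (fun p : ℝ × X => chartExtend e (θ p.1) p.2) := by
  rintro ⟨t, x⟩
  by_cases hx : x ∈ e.source
  · have h1 : (fun p : ℝ × X => chartExtend e (θ p.1) p.2) =ᶠ[𝓝 (t, x)]
        fun p => e.symm (θ p.1 (e p.2)) := by
      filter_upwards [(e.open_source.preimage continuous_snd).mem_nhds hx] with p hp
      exact chartExtend_of_mem _ hp
    refine ContMDiffAt.congr_of_eventuallyEq ?_ h1
    have h2 : ContMDiffAt (𝓘(ℝ, ℝ).prod (𝓡 m)) (𝓡 m) ∞ (fun p : ℝ × X => e p.2) (t, x) :=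
      (contMDiffAt_of_mem_maximalAtlas he hx).comp (t, x) contMDiffAt_snd
    have h3 : ContMDiffAt (𝓘(ℝ, ℝ).prod (𝓡 m)) 𝓘(ℝ, ℝ × Model m) ∞
        (fun p : ℝ × X => (p.1, e p.2)) (t, x) := contMDiffAt_fst.prodMk_space h2
    have h4 : ContMDiffAt (𝓘(ℝ, ℝ).prod (𝓡 m)) (𝓡 m) ∞
        (fun p : ℝ × X => θ p.1 (e p.2)) (t, x) :=
      hθ.contMDiff.contMDiffAt.comp (t, x) h3
    exact (contMDiffAt_symm_of_mem_maximalAtlas he (hθe t _ (e.map_source hx))).comp (t, x) h4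
  · have h1 : (fun p : ℝ × X => chartExtend e (θ p.1) p.2) =ᶠ[𝓝 (t, x)] fun p => p.2 := by
      filter_upwards [(hK.isClosed.isOpen_compl.preimage continuous_snd).mem_nhds
        (show x ∈ Kᶜ from fun h => hx (hKe h))] with p hp
      exact chartExtend_eq_self (hθK p.1) hKe hp
    exact contMDiffAt_snd.congr_of_eventuallyEq h1

end ChartExtend

/-! ### Locality of the exterior derivative -/

section SmoothD

variable {m : ℕ} {X : Type*} [TopologicalSpace X] [ChartedSpace (Model m) X]
  [IsManifold (𝓡 m) ∞ X]

lemma localRep_eventuallyEq {k : ℕ} {w η : RawForm m X k} {x : X} (h : ∀ᶠ z in 𝓝 x, w z = η z)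
    {e : OpenPartialHomeomorph X (Model m)} (hx : x ∈ e.source) :
    localRep e w =ᶠ[𝓝 (e x)] localRep e η := by
  have h1 := e.continuousAt_symm (e.map_source hx)
  rw [ContinuousAt, e.left_inv hx] at h1
  filter_upwards [h1.eventually h] with y hy
  simp only [localRep, hy]

lemma rawD_congr {k : ℕ} {w η : RawForm m X k} {x : X} (h : ∀ᶠ z in 𝓝 x, w z = η z) :
    rawD w x = rawD η x := by
  simp only [rawD, chartForm,
    (localRep_eventuallyEq h (mem_chart_source (Model m) x)).extDeriv_eq]
  rfl

lemma extDeriv_zero_form {V : Type*} [NormedAddCommGroup V] [NormedSpace ℝ V] {k : ℕ} (y : V) :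
    extDeriv (0 : V → V [⋀^Fin k]→L[ℝ] ℝ) y = 0 := by
  simpa using extDeriv_smul (x := y) (0 : ℝ) (0 : V → V [⋀^Fin k]→L[ℝ] ℝ)

lemma rawD_eq_zero {k : ℕ} {w : RawForm m X k} {x : X} (h : ∀ᶠ z in 𝓝 x, w z = 0) :
    rawD w x = 0 := by
  have h1 : ∀ᶠ z in 𝓝 x, w z = (0 : RawForm m X k) z := h
  rw [rawD_congr h1]
  simp only [rawD, chartForm, localRep_zero, extDeriv_zero_form]
  rfl

lemma bijective_mfderiv_symm_chart {e : OpenPartialHomeomorph X (Model m)}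
    (he : e ∈ IsManifold.maximalAtlas (𝓡 m) ∞ X) {x : X} (hx : x ∈ e.source) :
    Function.Bijective (mfderiv (𝓡 m) (𝓡 m) e.symm (e x) : Model m →L[ℝ] Model m) := by
  let D : Model m →L[ℝ] Model m := mfderiv (𝓡 m) (𝓡 m) e.symm (e x)
  have h1 : Function.Surjective D.toLinearMap := fun v => ⟨_, mfderiv_symm_chart he hx v⟩
  have h2 : Function.Injective D.toLinearMap := LinearMap.injective_iff_surjective.2 h1
  exact ⟨h2, h1⟩

end SmoothD

/-! ### Moser's theorem on X for perturbations supported in a chart -/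

section Moser

variable {n : ℕ} {X : Type*} [TopologicalSpace X] [ChartedSpace (Model (2 * n)) X]
  [IsManifold (𝓡 (2 * n)) ∞ X]

lemma IsNondegenerate.localRep {w : RawForm (2 * n) X 2} (hw : IsNondegenerate w)
    {e : OpenPartialHomeomorph X (Model (2 * n))}
    (he : e ∈ IsManifold.maximalAtlas (𝓡 (2 * n)) ∞ X) {y : Model (2 * n)} (hy : y ∈ e.target)
    (u : Model (2 * n)) (hu : u ≠ 0) : ∃ v, localRep e w y ![u, v] ≠ 0 := by
  obtain ⟨x, hx, rfl⟩ : ∃ x ∈ e.source, e x = y := ⟨e.symm y, e.map_target hy, e.right_inv hy⟩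
  have hb := bijective_mfderiv_symm_chart he hx
  obtain ⟨v', hv'⟩ := hw (e.symm (e x))
    ((mfderiv (𝓡 (2 * n)) (𝓡 (2 * n)) e.symm (e x) : Model (2 * n) →L[ℝ] Model (2 * n)) u)
    (fun h => hu (hb.1 (h.trans (map_zero _).symm)))
  obtain ⟨v, rfl⟩ := hb.2 v'
  refine ⟨v, fun h => hv' (Eq.trans ?_ h)⟩
  refine congrArg (w (e.symm (e x))) (funext fun i => ?_)
  fin_cases i <;> rfl

lemma pullback_eq_self_of_eventuallyEq {k : ℕ} {φ : X → X} {x : X} (h : φ =ᶠ[𝓝 x] id)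
    (w : RawForm (2 * n) X k) : pullback φ w x = w x := by
  have h3 : pullback φ w x = pullback id w x := by
    have h1 := h.mfderiv_eq (I := 𝓡 (2 * n)) (I' := 𝓡 (2 * n))
    have h2 := h.eq_of_nhds
    unfold pullback
    rw [h2] at h1 ⊢
    rw [h1]
  rw [h3, pullback_id]

/-- Moser's theorem for a change of a symplectic form by the differential of a 1-form supported
in a chart. -/
lemma exists_isotopic_pullback_eq [T2Space X] {e : OpenPartialHomeomorph X (Model (2 * n))}
    (he : e ∈ IsManifold.maximalAtlas (𝓡 (2 * n)) ∞ X) {K : Set X} (hK : IsCompact K)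
    (hKe : K ⊆ e.source) (w : ClosedForm (2 * n) X 2) (β : SmoothForm (2 * n) X 1)
    (hβ : ∀ x ∉ K, β.1 x = 0)
    (hnd : ∀ s ∈ Icc (0 : ℝ) 1, IsNondegenerate (w.1.1 + s • (smoothD β).1)) :
    ∃ φ : X ≃ₘ⟮𝓡 (2 * n), 𝓡 (2 * n)⟯ X, IsIsotopicToId φ ∧
      pullback φ (w.1.1 + (smoothD β).1) = w.1.1 := by
  classical
  -- The local expression is extended by zero off the image of the chart; this is smooth because it
  -- already vanishes outside the compact set e(K).
  let b : Model (2 * n) → Model (2 * n) [⋀^Fin 1]→L[ℝ] ℝ := fun y =>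
    if y ∈ e.target then localRep e β.1 y else 0
  have hK' : IsCompact (e '' K) := hK.image_of_continuousOn (e.continuousOn.mono hKe)
  have hKt : e '' K ⊆ e.target := by
    rintro _ ⟨x, hx, rfl⟩
    exact e.map_source (hKe hx)
  have hbe : ∀ y ∈ e.target, b =ᶠ[𝓝 y] localRep e β.1 := fun y hy => by
    filter_upwards [e.open_target.mem_nhds hy] with z hz
    exact if_pos hz
  have hbK : ∀ y ∉ e '' K, b y = 0 := by
    intro y hy
    by_cases hyt : y ∈ e.target
    · rw [(hbe y hyt).eq_of_nhds, localRep, hβ]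
      · rfl
      · exact fun h => hy ⟨_, h, e.right_inv hyt⟩
    · exact if_neg hyt
  have hb : ContDiff ℝ ∞ b := by
    rw [contDiff_iff_contDiffAt]
    intro y
    by_cases hyt : y ∈ e.target
    · exact ((β.2 e he).contDiffAt (e.open_target.mem_nhds hyt)).congr_of_eventuallyEq (hbe y hyt)
    · have h1 : b =ᶠ[𝓝 y] fun _ => 0 := by
        filter_upwards [hK'.isClosed.isOpen_compl.mem_nhds
          (show y ∈ (e '' K)ᶜ from fun h => hyt (hKt h))] with z hz
        exact hbK z hz
      exact contDiffAt_const.congr_of_eventuallyEq h1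
  have hdb : ∀ y ∈ e.target, extDeriv b y = localRep e (smoothD β).1 y := fun y hy => by
    rw [(hbe y hy).extDeriv_eq, isExtDeriv_d β e he y hy]
  obtain ⟨θ, ξ, h1, h2, h3, h4, h5, h6, h7⟩ := exists_moser_isotopy e.open_target hK' hKt
    (w.1.2 e he) (fun y hy => (w.2 e he y hy).symm.trans (congrFun (localRep_zero e) y)) hb hbK
    (fun y hy s hs u hu => by
      rw [hdb y hy]
      exact (hnd s hs).localRep he hy u hu)
  have h6' : ∀ t, ∀ y ∉ e '' K, ξ t y = y := fun t y hy => by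
    have := h4 t y
    rwa [h6 t y hy] at this
  have hmaps : ∀ f g : ℝ → Model (2 * n) → Model (2 * n), (∀ t y, g t (f t y) = y) →
      (∀ t, ∀ y ∉ e '' K, f t y = y) → ∀ t, ∀ y ∈ e.target, f t y ∈ e.target := by
    intro f g hgf hf t y hy
    by_contra hne
    have h8 : f t y ∉ e '' K := fun h => hne (hKt h)
    have h9 : g t (f t y) = g t (f t (f t y)) := by rw [hf t _ h8]
    rw [hgf, hgf] at h9
    exact hne (h9 ▸ hy)
  have hθe := hmaps θ ξ h4 h6
  have hξe := hmaps ξ θ h3 h6'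
  have hθs := contMDiff_chartExtend he hK hKe h1 hθe h6
  have hξs := contMDiff_chartExtend he hK hKe h2 hξe h6'
  have hslice : ∀ t : ℝ, ContMDiff (𝓡 (2 * n)) (𝓘(ℝ, ℝ).prod (𝓡 (2 * n))) ∞
      (fun x : X => (t, x)) := fun t => contMDiff_const.prodMk contMDiff_id
  let ψ : ℝ → (X ≃ₘ⟮𝓡 (2 * n), 𝓡 (2 * n)⟯ X) := fun t =>
    { toFun := chartExtend e (θ t)
      invFun := chartExtend e (ξ t)
      left_inv := chartExtend_chartExtend (hθe t) (h4 t)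
      right_inv := chartExtend_chartExtend (hξe t) (h3 t)
      contMDiff_toFun := hθs.comp (hslice t)
      contMDiff_invFun := hξs.comp (hslice t) }
  have hψ : ∀ t x, ψ t x = chartExtend e (θ t) x := fun _ _ => rfl
  refine ⟨ψ 1, ⟨ψ, hθs.contMDiffOn, ?_, rfl⟩, ?_⟩
  · ext x
    rw [hψ]
    by_cases hx : x ∈ e.source
    · rw [chartExtend_of_mem _ hx, h5, e.left_inv hx]
      rfl
    · exact chartExtend_of_notMem _ hx
  -- In the chart domain this is the Euclidean statement. Any other point has a neighbourhood
  -- missing K, on which the diffeomorphism is the identity and dβ vanishes.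
  funext x
  by_cases hx : x ∈ e.source
  · refine form_eq_of_localRep_eq he hx ?_
    have hy := e.map_source hx
    have hinv : e.symm (e x) = x := e.left_inv hx
    have hφ : MDifferentiable (𝓡 (2 * n)) (𝓡 (2 * n)) (ψ 1) := (ψ 1).mdifferentiable (by simp)
    have hG : ∀ y ∈ e.target, ψ 1 (e.symm y) = e.symm (θ 1 y) := fun y hy => by
      rw [hψ, chartExtend_of_mem _ (e.map_target hy), e.right_inv hy]
    have hG' : (fun y => e (ψ 1 (e.symm y))) =ᶠ[𝓝 (e x)] θ 1 := by
      filter_upwards [e.open_target.mem_nhds hy] with y hy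
      rw [hG y hy, e.right_inv (hθe 1 y hy)]
    rw [localRep_pullback_eq_pullVec hφ he _ hy, pullVec_eq he (G := fun y => ψ 1 (e.symm y)) ?_ ?_,
      hG'.fderiv_eq, hG'.eq_of_nhds, localRep_add, Pi.add_apply, ← hdb _ (hθe 1 _ hy)]
    · exact h7 _ hy
    · exact (hφ (e.symm (e x))).comp (e x) (mdifferentiableAt_chart_symm he hy)
    · rw [hG _ hy]
      exact e.map_target (hθe 1 _ hy)
  · have hxK : ∀ᶠ z in 𝓝 x, z ∉ K := hK.isClosed.isOpen_compl.mem_nhds fun h => hx (hKe h)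
    rw [pullback_eq_self_of_eventuallyEq]
    · have h8 : (smoothD β).1 x = 0 := rawD_eq_zero (hxK.mono hβ)
      have h9 : (w.1.1 + (smoothD β).1) x = w.1.1 x + (smoothD β).1 x := rfl
      rw [h9, h8, add_zero]
    · filter_upwards [hxK] with z hz
      exact chartExtend_eq_self (h6 1) hKe hz

end Moser

/-! ### The top power as a multiple of the determinant -/

section TopPower

variable {n : ℕ} {V : Type*} [AddCommGroup V] [Module ℝ V] [TopologicalSpace V]

/-- The multilinear map `v ↦ w(v₀, v₁) w(v₂, v₃) ⋯`. -/
def pairProduct (n : ℕ) (w : V [⋀^Fin 2]→L[ℝ] ℝ) :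
    MultilinearMap ℝ (fun _ : Fin (2 * n) => V) ℝ :=
  -- The j-th vector occurs only in the factor with index j/2, in its first or second slot according
  -- to the parity of j; the other factors form a constant coefficient.
  have key : ∀ [DecidableEq (Fin (2 * n))] (v : Fin (2 * n) → V) (j : Fin (2 * n)),
      ∃ L : V →ₗ[ℝ] ℝ, ∀ x, ∏ i : Fin n, w ![Function.update v j x ⟨2 * i.1, by omega⟩,
        Function.update v j x ⟨2 * i.1 + 1, by omega⟩] = L x := by
    intro _ v j
    have hj := j.2
    let i₀ : Fin n := ⟨j.1 / 2, by omega⟩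
    have hL : ∃ L : V →ₗ[ℝ] ℝ, ∀ x, w ![Function.update v j x ⟨2 * i₀.1, by omega⟩,
        Function.update v j x ⟨2 * i₀.1 + 1, by omega⟩] = L x := by
      rcases Nat.even_or_odd' j.1 with ⟨c, hc | hc⟩
      · refine ⟨w.toMultilinearMap.toLinearMap ![0, v ⟨2 * i₀.1 + 1, by omega⟩] 0, fun x => ?_⟩
        have h0 : (⟨2 * i₀.1, by omega⟩ : Fin (2 * n)) = j := Fin.ext (by simp only [i₀]; omega)
        have h1 : (⟨2 * i₀.1 + 1, by omega⟩ : Fin (2 * n)) ≠ j := fun h => by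
          have := congrArg Fin.val h
          simp only [i₀] at this
          omega
        rw [Function.update_of_ne h1, h0, Function.update_self]
        refine congrArg w (funext fun k => ?_)
        fin_cases k <;> rfl
      · refine ⟨w.toMultilinearMap.toLinearMap ![v ⟨2 * i₀.1, by omega⟩, 0] 1, fun x => ?_⟩
        have h0 : (⟨2 * i₀.1 + 1, by omega⟩ : Fin (2 * n)) = j :=
          Fin.ext (by simp only [i₀]; omega)
        have h1 : (⟨2 * i₀.1, by omega⟩ : Fin (2 * n)) ≠ j := fun h => by
          have := congrArg Fin.val h
          simp only [i₀] at this
          omega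
        rw [Function.update_of_ne h1, h0, Function.update_self]
        refine congrArg w (funext fun k => ?_)
        fin_cases k <;> rfl
    obtain ⟨L, hL⟩ := hL
    refine ⟨(∏ i ∈ Finset.univ.erase i₀, w ![v ⟨2 * i.1, by omega⟩, v ⟨2 * i.1 + 1, by omega⟩]) • L,
      fun x => ?_⟩
    rw [← Finset.mul_prod_erase _ _ (Finset.mem_univ i₀), hL, mul_comm]
    refine congrArg (· * L x) (Finset.prod_congr rfl fun i hi => ?_)
    have hne : i.1 ≠ j.1 / 2 := fun h => (Finset.ne_of_mem_erase hi) (Fin.ext h)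
    rw [Function.update_of_ne fun h => hne (by have := congrArg Fin.val h; simp only at this; omega),
      Function.update_of_ne fun h => hne (by have := congrArg Fin.val h; simp only at this; omega)]
  { toFun := fun v => ∏ i : Fin n, w ![v ⟨2 * i.1, by omega⟩, v ⟨2 * i.1 + 1, by omega⟩]
    map_update_add' := by
      intro _ v j x y
      obtain ⟨L, hL⟩ := key v j
      simp only [hL, map_add]
    map_update_smul' := by
      intro _ v j c x
      obtain ⟨L, hL⟩ := key v j
      simp only [hL, map_smul] }

lemma topPower_eq (w : V [⋀^Fin 2]→L[ℝ] ℝ) (v : Fin (2 * n) → V) :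
    topPower w v = (2 ^ n : ℝ)⁻¹ * MultilinearMap.alternatization (pairProduct n w) v := by
  rw [topPower, MultilinearMap.alternatization_apply]
  congr 1
  refine Finset.sum_congr rfl fun σ _ => ?_
  rw [Units.smul_def, zsmul_eq_mul]
  rfl

/-- Alternating forms of top degree form a line, so the value on a single basis determines the top
power. -/
lemma topPower_basis (w : V [⋀^Fin 2]→L[ℝ] ℝ) (b : Module.Basis (Fin (2 * n)) ℝ V)
    (v : Fin (2 * n) → V) : topPower w v = topPower w b * b.det v := by
  rw [topPower_eq, topPower_eq]
  have h := DFunLike.congr_fun (AlternatingMap.eq_smul_basis_det b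
    (MultilinearMap.alternatization (pairProduct n w))) v
  rw [h, AlternatingMap.smul_apply, smul_eq_mul, mul_assoc]

lemma topPower_pos_iff_of_mul_pos {w η : V [⋀^Fin 2]→L[ℝ] ℝ}
    {b : Module.Basis (Fin (2 * n)) ℝ V} (h : 0 < topPower w b * topPower η b)
    (v : Fin (2 * n) → V) : 0 < topPower w v ↔ 0 < topPower η v := by
  rw [topPower_basis w b v, topPower_basis η b v]
  rcases pos_and_pos_or_neg_and_neg_of_mul_pos h with ⟨h1, h2⟩ | ⟨h1, h2⟩
  · rw [mul_pos_iff_of_pos_left h1, mul_pos_iff_of_pos_left h2]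
  · rw [← neg_mul_neg, mul_pos_iff_of_pos_left (neg_pos.2 h1), ← neg_mul_neg (topPower η b),
      mul_pos_iff_of_pos_left (neg_pos.2 h2)]

/-- If the top power vanished on one basis, it would vanish on all families of vectors,
contradicting positivity on a positively oriented basis. -/
lemma topPower_ne_zero {w : V [⋀^Fin 2]→L[ℝ] ℝ} {o : Orientation ℝ V (Fin (2 * n))}
    (h : ∀ b : Module.Basis (Fin (2 * n)) ℝ V, 0 < topPower w b ↔ b.orientation = o)
    (b : Module.Basis (Fin (2 * n)) ℝ V) : topPower w b ≠ 0 := by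
  -- For n = 0 the index set is empty, so a basis cannot be adjusted to an orientation, but the
  -- empty product makes the top power equal to 1.
  rcases Nat.eq_zero_or_pos n with rfl | hn
  · have : Subsingleton (Equiv.Perm (Fin (2 * 0))) :=
      ⟨fun σ τ => Equiv.ext fun i => absurd i.2 (by simp)⟩
    rw [topPower, Fintype.sum_subsingleton _ (1 : Equiv.Perm (Fin (2 * 0)))]
    simp
  · have : Nonempty (Fin (2 * n)) := ⟨⟨0, by omega⟩⟩
    intro h0
    have h1 := (h (b.adjustToOrientation o)).2 (b.orientation_adjustToOrientation o)
    rw [topPower_basis w b, h0, zero_mul] at h1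
    exact lt_irrefl _ h1

end TopPower

/-! ### Openness of nondegeneracy in linear algebra -/

section OpenConditions

variable {V : Type*} [NormedAddCommGroup V] [NormedSpace ℝ V] [FiniteDimensional ℝ V]

/-- Invertible operators form an open set, and nondegeneracy is invertibility of the contraction,
which depends continuously on the form. -/
lemma isOpen_nondegenerate :
    IsOpen {w : V [⋀^Fin 2]→L[ℝ] ℝ | ∀ u, u ≠ 0 → ∃ v, w ![u, v] ≠ 0} := by
  have := FiniteDimensional.complete ℝ V
  have h1 : {w : V [⋀^Fin 2]→L[ℝ] ℝ | ∀ u, u ≠ 0 → ∃ v, w ![u, v] ≠ 0} =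
      (fun w => w.curryLeft) ⁻¹' range (ContinuousLinearEquiv.toContinuousLinearMap
        (M₁ := V) (M₂ := V [⋀^Fin 1]→L[ℝ] ℝ)) := by
    ext w
    refine ⟨isInvertible_curryLeft, ?_⟩
    rintro ⟨e, he⟩ u hu
    by_contra! hne
    refine hu (e.injective ?_)
    rw [map_zero]
    ext v
    have h2 : e u = w.curryLeft u := DFunLike.congr_fun he u
    rw [h2]
    refine Eq.trans ?_ (hne (v 0))
    refine congrArg w (funext fun i => ?_)
    fin_cases i <;> rfl
  rw [h1]
  exact ContinuousLinearEquiv.isOpen.preimage contDiff_curryLeft.continuous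

lemma continuous_topPower {n : ℕ} (v : Fin (2 * n) → V) :
    Continuous fun w : V [⋀^Fin 2]→L[ℝ] ℝ => topPower w v := by
  unfold topPower
  refine continuous_const.mul (continuous_finsetSum _ fun σ _ => continuous_const.mul
    (continuous_finsetProd _ fun i _ => ?_))
  exact (ContinuousAlternatingMap.apply ℝ V ℝ _).continuous

end OpenConditions

/-! ### Symplectic forms are open and locally segment-stable -/

section OpenSymplectic

variable {n : ℕ} {X : Type*} [TopologicalSpace X] [ChartedSpace (Model (2 * n)) X]
  [IsManifold (𝓡 (2 * n)) ∞ X]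

/-- The condition is C^0-open and uniform over a compact part of a chart. A radius ε is produced,
rather than just a neighbourhood, so that convexity of balls can be used later. -/
lemma exists_forms_near_symplectic {o : ManifoldOrientation n X}
    (w : SymplecticForm o) {e : OpenPartialHomeomorph X (Model (2 * n))}
    (he : e ∈ IsManifold.maximalAtlas (𝓡 (2 * n)) ∞ X) {K : Set (Model (2 * n))} (hK : IsCompact K)
    (hKe : K ⊆ e.target) : ∃ ε > 0, ∀ η : RawForm (2 * n) X 2,
      (∀ y ∈ K, ‖localRep e η y - localRep e w.1.1.1 y‖ < ε) → ∀ y ∈ K,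
      (∀ u : TangentSpace (𝓡 (2 * n)) (e.symm y), u ≠ 0 → ∃ v, η (e.symm y) ![u, v] ≠ 0) ∧
      ∀ b : Module.Basis (Fin (2 * n)) ℝ (TangentSpace (𝓡 (2 * n)) (e.symm y)),
        0 < topPower (η (e.symm y)) b ↔ b.orientation = o.at_point (e.symm y) := by
  let c : Module.Basis (Fin (2 * n)) ℝ (Model (2 * n)) :=
    (EuclideanSpace.basisFun (Fin (2 * n)) ℝ).toBasis
  have hbij : ∀ y ∈ e.target, Function.Bijective
      (mfderiv (𝓡 (2 * n)) (𝓡 (2 * n)) e.symm y : Model (2 * n) →L[ℝ] Model (2 * n)) := by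
    intro y hy
    have := bijective_mfderiv_symm_chart he (e.map_target hy)
    rwa [e.right_inv hy] at this
  have hbasis : ∀ y ∈ e.target, ∃ b : Module.Basis (Fin (2 * n)) ℝ
      (TangentSpace (𝓡 (2 * n)) (e.symm y)), ∀ η : RawForm (2 * n) X 2,
        topPower (localRep e η y) c = topPower (η (e.symm y)) b := by
    intro y hy
    refine ⟨c.map (LinearEquiv.ofBijective
      (mfderiv (𝓡 (2 * n)) (𝓡 (2 * n)) e.symm y).toLinearMap (hbij y hy)), fun η => ?_⟩
    simp only [topPower]
    congr 1
    refine Finset.sum_congr rfl fun σ _ => congrArg _ (Finset.prod_congr rfl fun i _ => ?_)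
    refine congrArg (η (e.symm y)) (funext fun k => ?_)
    fin_cases k <;> simp <;> rfl
  -- Compatibility with the orientation is replaced by having a top power of the same sign as `w` on
  -- one fixed basis. This is an open condition on pairs that no longer mentions the orientation.
  let S : Set ((Model (2 * n) [⋀^Fin 2]→L[ℝ] ℝ) × (Model (2 * n) [⋀^Fin 2]→L[ℝ] ℝ)) :=
    {p | (∀ u, u ≠ 0 → ∃ v, p.2 ![u, v] ≠ 0) ∧ 0 < topPower p.2 c * topPower p.1 c}
  have hS : IsOpen S := (isOpen_nondegenerate.preimage continuous_snd).inter
    (isOpen_lt continuous_const (((continuous_topPower c).comp continuous_snd).mul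
      ((continuous_topPower c).comp continuous_fst)))
  have hcont : ContinuousOn (localRep e w.1.1.1) K := (w.1.1.2 e he).continuousOn.mono hKe
  have hD : IsCompact ((fun y => (localRep e w.1.1.1 y, localRep e w.1.1.1 y)) '' K) :=
    hK.image_of_continuousOn (hcont.prodMk hcont)
  have hDS : (fun y => (localRep e w.1.1.1 y, localRep e w.1.1.1 y)) '' K ⊆ S := by
    rintro _ ⟨y, hy, rfl⟩
    refine ⟨w.2.1.localRep he (hKe hy), ?_⟩
    obtain ⟨b, hb⟩ := hbasis y (hKe hy)
    have h1 := topPower_ne_zero (w.2.2 (e.symm y)) b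
    simp only [hb]
    exact mul_self_pos.2 h1
  obtain ⟨ε, hε, hεS⟩ := hD.exists_thickening_subset_open hS hDS
  refine ⟨ε, hε, fun η hη y hy => ?_⟩
  have h1 : (localRep e w.1.1.1 y, localRep e η y) ∈ S := by
    refine hεS (Metric.mem_thickening_iff.2 ⟨_, ⟨y, hy, rfl⟩, ?_⟩)
    rw [Prod.dist_eq, dist_self, dist_eq_norm]
    exact max_lt hε (hη y hy)
  refine ⟨fun u hu => ?_, fun b' => ?_⟩
  · obtain ⟨u', rfl⟩ := (hbij y (hKe hy)).2 u
    obtain ⟨v, hv⟩ := h1.1 u' fun h => hu (by rw [h]; exact map_zero _)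
    refine ⟨(mfderiv (𝓡 (2 * n)) (𝓡 (2 * n)) e.symm y : Model (2 * n) →L[ℝ] Model (2 * n)) v,
      fun h => hv (Eq.trans ?_ h)⟩
    refine congrArg (η (e.symm y)) (funext fun i => ?_)
    fin_cases i <;> rfl
  · obtain ⟨b, hb⟩ := hbasis y (hKe hy)
    have h2 := h1.2
    simp only [hb] at h2
    rw [topPower_pos_iff_of_mul_pos h2 b']
    exact w.2.2 (e.symm y) b'

/-- A compact manifold is covered by finitely many compact subsets of charts. -/
lemma exists_finite_chart_cover {m : ℕ} (X : Type*) [TopologicalSpace X]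
    [ChartedSpace (Model m) X] [CompactSpace X] : ∃ (t : Finset X) (K : X → Set (Model m)),
      (∀ x, IsCompact (K x) ∧ K x ⊆ (chartAt (Model m) x).target) ∧
      ∀ z : X, ∃ x ∈ t, ∃ y ∈ K x, (chartAt (Model m) x).symm y = z := by
  have h1 : ∀ x : X, ∃ r > 0, Metric.closedBall (chartAt (Model m) x x) r ⊆
      (chartAt (Model m) x).target := fun x =>
    Metric.nhds_basis_closedBall.mem_iff.1
      ((chartAt (Model m) x).open_target.mem_nhds (mem_chart_target (Model m) x))
  choose r hr hrt using h1
  let U : X → Set X := fun x => (chartAt (Model m) x).source ∩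
    chartAt (Model m) x ⁻¹' Metric.closedBall (chartAt (Model m) x x) (r x)
  have hU : ∀ x ∈ (univ : Set X), U x ∈ 𝓝 x := fun x _ =>
    Filter.inter_mem ((chartAt (Model m) x).open_source.mem_nhds (mem_chart_source _ x))
      (((chartAt (Model m) x).continuousAt (mem_chart_source _ x)).preimage_mem_nhds
        (Metric.closedBall_mem_nhds _ (hr x)))
  obtain ⟨t, -, ht⟩ := isCompact_univ.elim_nhds_subcover U hU
  refine ⟨t, fun x => Metric.closedBall (chartAt (Model m) x x) (r x),
    fun x => ⟨isCompact_closedBall _ _, hrt x⟩, fun z => ?_⟩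
  obtain ⟨x, hx, hz⟩ := mem_iUnion₂.1 (ht (mem_univ z))
  exact ⟨x, hx, _, hz.2, (chartAt (Model m) x).left_inv hz.1⟩

/-- Around every symplectic form there is a neighbourhood such that all forms on the segments
between its elements are symplectic. -/
lemma exists_nhds_segment_symplectic [CompactSpace X] {o : ManifoldOrientation n X}
    (w : SymplecticForm o) : ∃ U ∈ 𝓝 w.1, ∀ η ∈ U, ∀ η' ∈ U, ∀ t ∈ Icc (0 : ℝ) 1,
      IsNondegenerate (η + t • (η' - η)).1.1 ∧
        IsOrientationCompatible o (η + t • (η' - η)).1.1 := by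
  obtain ⟨s, K, hK, hs⟩ := exists_finite_chart_cover (m := 2 * n) X
  have hat : ∀ x : X, chartAt (Model (2 * n)) x ∈ IsManifold.maximalAtlas (𝓡 (2 * n)) ∞ X :=
    fun x => IsManifold.chart_mem_maximalAtlas x
  choose ε hε h using fun x : X => exists_forms_near_symplectic w (hat x) (hK x).1 (hK x).2
  let B : X → Set (ClosedForm (2 * n) X 2) := fun x => {η | ∀ y ∈ K x,
    ‖localRep (chartAt (Model (2 * n)) x) η.1.1 y -
      localRep (chartAt (Model (2 * n)) x) w.1.1.1 y‖ < ε x}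
  refine ⟨⋂ x ∈ s, B x, ?_, ?_⟩
  · refine (Filter.biInter_finset_mem s).2 fun x _ => ?_
    exact continuous_subtype_val.continuousAt.preimage_mem_nhds
      (ball_mem_nhds_smoothForm w.1.1 (hat x) (hK x).1 (hK x).2 (hε x))
  · intro η hη η' hη' t ht
    have key : ∀ z : X, (∀ u : TangentSpace (𝓡 (2 * n)) z, u ≠ 0 →
        ∃ v, (η + t • (η' - η)).1.1 z ![u, v] ≠ 0) ∧
        ∀ b : Module.Basis (Fin (2 * n)) ℝ (TangentSpace (𝓡 (2 * n)) z),
          0 < topPower ((η + t • (η' - η)).1.1 z) b ↔ b.orientation = o.at_point z := by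
      intro z
      obtain ⟨x, hx, y, hy, rfl⟩ := hs z
      refine h x _ (fun y hy => ?_) y hy
      have h1 := mem_iInter₂.1 hη x hx y hy
      have h2 := mem_iInter₂.1 hη' x hx y hy
      rw [← mem_ball_iff_norm] at h1 h2 ⊢
      -- Symplecticity itself is not convex; what makes the segment symplectic is that its local
      -- expressions stay in the same ball around those of `w`.
      exact (convex_ball _ _).add_smul_sub_mem h1 h2 ht
    exact ⟨fun z => (key z).1, fun z => (key z).2⟩

/-- The symplectic forms form an open subset of the space of closed 2-forms. -/
lemma isOpen_symplectic [CompactSpace X] (o : ManifoldOrientation n X) :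
    IsOpen {w : ClosedForm (2 * n) X 2 |
      IsNondegenerate w.1.1 ∧ IsOrientationCompatible o w.1.1} := by
  rw [isOpen_iff_mem_nhds]
  intro w hw
  obtain ⟨U, hU, h⟩ := exists_nhds_segment_symplectic (⟨w, hw⟩ : SymplecticForm o)
  refine Filter.mem_of_superset hU fun η hη => ?_
  have h1 := h η hη η hη 0 (by simp)
  rwa [zero_smul, add_zero] at h1

end OpenSymplectic

lemma add_smul_eq_add_smul_add_sub_smul {M : Type*} [AddCommGroup M] [Module ℝ M] (a b : M)
    (r s : ℝ) : a + r • b = a + s • b + (r - s) • b := by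
  rw [sub_smul]
  abel

/-! ### Multiplication of forms by functions; d as a linear map -/

section MulForm

variable {m : ℕ} {X : Type*} [TopologicalSpace X] [ChartedSpace (Model m) X]

/-- Evaluation of forms at a point. -/
def evalForm {k : ℕ} (x : X) : RawForm m X k →ₗ[ℝ] (TangentSpace (𝓡 m) x [⋀^Fin k]→L[ℝ] ℝ) where
  toFun w := w x
  map_add' _ _ := rfl
  map_smul' _ _ := rfl

/-- The product of a function and a form. -/
def mulForm {k : ℕ} (f : X → ℝ) (w : RawForm m X k) : RawForm m X k := fun x => f x • w x

variable [IsManifold (𝓡 m) ∞ X]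

lemma contDiffAt_comp_chart_symm {f : X → ℝ} {x : X} (hf : ContMDiffAt (𝓡 m) 𝓘(ℝ, ℝ) ∞ f x)
    {e : OpenPartialHomeomorph X (Model m)} (he : e ∈ IsManifold.maximalAtlas (𝓡 m) ∞ X)
    (hx : x ∈ e.source) : ContDiffAt ℝ ∞ (fun y => f (e.symm y)) (e x) := by
  have h1 : ContMDiffAt (𝓡 m) 𝓘(ℝ, ℝ) ∞ f (e.symm (e x)) := by rwa [e.left_inv hx]
  exact (h1.comp (e x) (contMDiffAt_symm_of_mem_maximalAtlas he (e.map_source hx))).contDiffAt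

lemma SmoothFormAt.mulForm {k : ℕ} {f : X → ℝ} {w : RawForm m X k} {x : X}
    (hw : SmoothFormAt w x) (hf : ContMDiffAt (𝓡 m) 𝓘(ℝ, ℝ) ∞ f x) :
    SmoothFormAt (mulForm f w) x := fun e he hx =>
  (contDiffAt_comp_chart_symm hf he hx).smul (hw e he hx)

/-- The product of a smooth function and a smooth form. -/
def mulSmooth {k : ℕ} {f : X → ℝ} (hf : ContMDiff (𝓡 m) 𝓘(ℝ, ℝ) ∞ f) (w : SmoothForm m X k) :
    SmoothForm m X k :=
  ⟨mulForm f w.1, mem_smoothForm_iff.2 fun x =>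
    (mem_smoothForm_iff.1 w.2 x).mulForm (hf x)⟩

variable (m X) in
/-- The exterior derivative as a linear map. -/
def smoothDLinear (k : ℕ) : SmoothForm m X k →ₗ[ℝ] SmoothForm m X (k + 1) where
  toFun := smoothD
  map_add' α β := (isExtDeriv_d _).unique ((isExtDeriv_d α).add (isExtDeriv_d β))
  map_smul' c α := (isExtDeriv_d _).unique ((isExtDeriv_d α).smul c)

end MulForm

/-! ### Moser stability: from chart-supported pieces to whole segments -/

section MoserPath

variable {n : ℕ} {X : Type*} [TopologicalSpace X] [ChartedSpace (Model (2 * n)) X]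
  [IsManifold (𝓡 (2 * n)) ∞ X]

/-- The differential of a 1-form, as a closed 2-form. -/
def closedD (β : SmoothForm (2 * n) X 1) : ClosedForm (2 * n) X 2 :=
  ⟨smoothD β, isExtDeriv_d_zero β⟩

lemma closedD_add (α β : SmoothForm (2 * n) X 1) : closedD (α + β) = closedD α + closedD β :=
  Subtype.ext ((smoothDLinear (2 * n) X 1).map_add α β)

lemma closedD_smul (c : ℝ) (β : SmoothForm (2 * n) X 1) : closedD (c • β) = c • closedD β :=
  Subtype.ext ((smoothDLinear (2 * n) X 1).map_smul c β)

/-- Every 1-form on a compact manifold is a finite sum of 1-forms supported in charts. -/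
lemma exists_sum_chart_supported [CompactSpace X] [T2Space X] (α : SmoothForm (2 * n) X 1) :
    ∃ (t : Finset X) (K : t → Set X) (β : t → SmoothForm (2 * n) X 1),
      (∀ i, IsCompact (K i) ∧ K i ⊆ (chartAt (Model (2 * n)) i.1).source) ∧
      (∀ i, ∀ x ∉ K i, (β i).1 x = 0) ∧ ∑ i, β i = α := by
  obtain ⟨t, K, hK, ht⟩ := exists_finite_chart_cover (m := 2 * n) X
  obtain ⟨ρ, hρ⟩ := SmoothPartitionOfUnity.exists_isSubordinate (𝓡 (2 * n)) isClosed_univ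
    (fun i : t => (chartAt (Model (2 * n)) i.1).source) (fun i => (chartAt _ i.1).open_source)
    (fun z _ => by
      obtain ⟨x, hx, y, hy, rfl⟩ := ht z
      exact mem_iUnion.2 ⟨⟨x, hx⟩, (chartAt _ x).map_target ((hK x).2 hy)⟩)
  refine ⟨t, fun i => tsupport (ρ i), fun i => mulSmooth (ρ i).contMDiff α,
    fun i => ⟨(isClosed_tsupport _).isCompact, hρ i⟩, fun i x hx => ?_, ?_⟩
  · have h1 : ρ i x = 0 := image_eq_zero_of_notMem_tsupport hx
    have h2 : (mulSmooth (ρ i).contMDiff α).1 x = ρ i x • α.1 x := rfl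
    rw [h2, h1, zero_smul]
  · refine Subtype.ext (funext fun x => ?_)
    have h1 := ρ.sum_eq_one (mem_univ x)
    rw [finsum_eq_sum_of_fintype] at h1
    have h2 : (∑ i, mulSmooth (ρ i).contMDiff α).1 x = ∑ i, ρ i x • α.1 x := by
      exact map_sum ((evalForm x).comp (SmoothForm (2 * n) X 1).subtype) _ _
    rw [h2, ← Finset.sum_smul, h1, one_smul]

/-- Equivalence of closed 2-forms under diffeomorphisms isotopic to the identity. -/
def isotopySetoid : Setoid (ClosedForm (2 * n) X 2) where
  r w η := ∃ φ : X ≃ₘ⟮𝓡 (2 * n), 𝓡 (2 * n)⟯ X, IsIsotopicToId φ ∧ pullback φ w.1.1 = η.1.1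
  iseqv :=
    { refl := fun w => ⟨Diffeomorph.refl _ _ _, isIsotopicToId_refl, pullback_id _⟩
      symm := by
        rintro w η ⟨φ, hφ, h⟩
        refine ⟨φ.symm, hφ.symm, ?_⟩
        rw [← h, ← pullback_comp]
        have : (φ ∘ φ.symm : X → X) = id := funext fun x => φ.apply_symm_apply x
        rw [this, pullback_id]
      trans := by
        rintro w η θ ⟨φ, hφ, h⟩ ⟨ψ, hψ, h'⟩
        refine ⟨ψ.trans φ, hψ.trans hφ, ?_⟩
        rw [← h', ← h, ← pullback_comp]
        rfl }

/-- Small exact perturbations of a symplectic form in the direction of a fixed exact form are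
equivalent to it. -/
lemma eventually_isotopySetoid [CompactSpace X] [T2Space X] {o : ManifoldOrientation n X}
    (w : SymplecticForm o) (α : SmoothForm (2 * n) X 1) :
    ∀ᶠ s in 𝓝 (0 : ℝ), isotopySetoid w.1 (w.1 + s • closedD α) := by
  classical
  obtain ⟨t, K, β, hK, hβ, rfl⟩ := exists_sum_chart_supported α
  -- The pieces of the 1-form are added one after another. For small s, nondegeneracy must hold at
  -- every partial sum and along the segment to the next one; there are only finitely many such
  -- conditions.
  have h1 : ∀ᶠ s in 𝓝 (0 : ℝ), ∀ p : Finset t × t, ∀ r ∈ Icc (0 : ℝ) 1,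
      IsNondegenerate (w.1 + s • closedD (∑ j ∈ p.1, β j) +
        (r * s) • closedD (β p.2)).1.1 := by
    rw [Filter.eventually_all]
    rintro ⟨S, i⟩
    have hc : Continuous fun q : ℝ × ℝ => w.1 + q.1 • closedD (∑ j ∈ S, β j) +
        q.2 • closedD (β i) :=
      (continuous_const.add (continuous_fst.smul continuous_const)).add
        (continuous_snd.smul continuous_const)
    have h2 : ∀ᶠ q in 𝓝 ((0, 0) : ℝ × ℝ), w.1 + q.1 • closedD (∑ j ∈ S, β j) +
        q.2 • closedD (β i) ∈ {w : ClosedForm (2 * n) X 2 |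
          IsNondegenerate w.1.1 ∧ IsOrientationCompatible o w.1.1} := by
      refine hc.continuousAt.preimage_mem_nhds ((isOpen_symplectic o).mem_nhds ?_)
      simpa using w.2
    obtain ⟨δ, hδ, h3⟩ := Metric.eventually_nhds_iff_ball.1 h2
    filter_upwards [Metric.ball_mem_nhds (0 : ℝ) hδ] with s hs r hr
    refine (h3 (s, r * s) ?_).1
    rw [mem_ball_zero_iff] at hs
    rw [← Prod.zero_eq_mk, mem_ball_zero_iff, Prod.norm_def]
    refine max_lt hs ((norm_mul_le _ _).trans_lt (lt_of_le_of_lt ?_ hs))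
    rw [Real.norm_eq_abs r, abs_of_nonneg hr.1]
    exact mul_le_of_le_one_left (norm_nonneg _) hr.2
  filter_upwards [h1] with s hs
  have key : ∀ S : Finset t, isotopySetoid w.1 (w.1 + s • closedD (∑ j ∈ S, β j)) := by
    intro S
    induction S using Finset.induction_on with
    | empty =>
      have h2 := closedD_smul 0 (0 : SmoothForm (2 * n) X 1)
      rw [zero_smul, zero_smul] at h2
      rw [Finset.sum_empty, h2, smul_zero, add_zero]
    | insert i S hi ih =>
      refine isotopySetoid.trans ih (isotopySetoid.symm ?_)
      obtain ⟨φ, hφ, h3⟩ := exists_isotopic_pullback_eq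
        (IsManifold.chart_mem_maximalAtlas (I := 𝓡 (2 * n)) (n := ∞) i.1) (hK i).1 (hK i).2
        (w.1 + s • closedD (∑ j ∈ S, β j)) (s • β i) (fun x hx => by
          have h4 : (s • β i).1 x = s • (β i).1 x := rfl
          rw [h4, hβ i x hx, smul_zero]) (fun r hr => by
          have h4 := hs (S, i) r hr
          simp only [mul_smul] at h4
          rw [← closedD_smul s (β i)] at h4
          exact h4)
      refine ⟨φ, hφ, ?_⟩
      rw [← h3]
      congr 1
      have h5 : w.1 + s • closedD (∑ j ∈ insert i S, β j) =
          w.1 + s • closedD (∑ j ∈ S, β j) + closedD (s • β i) := by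
        rw [Finset.sum_insert hi, closedD_add, smul_add, closedD_smul]
        abel
      rw [h5]
      rfl
  exact key Finset.univ

/-- Moser stability: nearby cohomologous symplectic forms lie in the same orbit. -/
lemma exists_nhds_equiv [CompactSpace X] [T2Space X] {o : ManifoldOrientation n X}
    (w : SymplecticForm o) : ∃ U ∈ 𝓝 w, ∀ η ∈ U, ∀ η' ∈ U,
      cohomClass η.1 = cohomClass η'.1 → (orbitSetoid o) η η' := by
  obtain ⟨U, hU, h⟩ := exists_nhds_segment_symplectic w
  refine ⟨Subtype.val ⁻¹' U, continuous_subtype_val.continuousAt.preimage_mem_nhds hU,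
    fun η hη η' hη' hc => ?_⟩
  obtain ⟨α, hα⟩ := (Submodule.Quotient.eq (ExactTwoForm (2 * n) X)).1 hc.symm
  have hα' : closedD α = η'.1 - η.1 := Subtype.ext ((isExtDeriv_d α).unique hα)
  -- The path of equivalence classes of η + t dα is locally constant, by applying the infinitesimal
  -- version at each point of the segment, and [0,1] is connected.
  let f : unitInterval → Quotient (isotopySetoid (n := n) (X := X)) := fun t =>
    Quotient.mk _ (η.1 + t.1 • closedD α)
  have hf : IsLocallyConstant f := by
    rw [IsLocallyConstant.iff_eventually_eq]
    intro t
    have h1 := h η.1 hη η'.1 hη' t.1 t.2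
    rw [← hα'] at h1
    have h2 := eventually_isotopySetoid (o := o) ⟨η.1 + t.1 • closedD α, h1⟩ α
    have h3 : Filter.Tendsto (fun s : unitInterval => s.1 - t.1) (𝓝 t) (𝓝 0) := by
      have h4 : Continuous fun s : unitInterval => s.1 - t.1 := by fun_prop
      simpa using h4.tendsto t
    filter_upwards [h3.eventually h2] with s hs
    refine Quotient.sound (isotopySetoid.symm ?_)
    rw [add_smul_eq_add_smul_add_sub_smul η.1 (closedD α) s.1 t.1]
    exact hs
  have h6 : isotopySetoid _ _ := Quotient.exact (hf.apply_eq_of_preconnectedSpace 0 1)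
  have h7 : η.1 + (0 : unitInterval).1 • closedD α = η.1 := by simp
  have h8 : η.1 + (1 : unitInterval).1 • closedD α = η'.1 := by simp [hα']
  rw [h7, h8] at h6
  exact h6

end MoserPath

/-! ### Poincaré lemmas for 2-forms and 1-forms on convex open sets -/

section ConvexPoincare

variable {V : Type*} [NormedAddCommGroup V] [NormedSpace ℝ V] [FiniteDimensional ℝ V]

/-- The smooth contraction of `V` to the point `q`. -/
def coneMap (q : V) (p : ℝ × V) : V := q + Real.smoothTransition p.1 • (p.2 - q)

lemma contDiff_coneMap (q : V) : ContDiff ℝ ∞ (coneMap q) :=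
  contDiff_const.add ((contDiff_smoothTransition.comp contDiff_fst).smul
    (contDiff_snd.sub contDiff_const))

lemma coneMap_mem {O : Set V} (hO : Convex ℝ O) {q : V} (hq : q ∈ O) (t : ℝ) {y : V} (hy : y ∈ O) :
    coneMap q (t, y) ∈ O :=
  hO.add_smul_sub_mem hq hy (smoothTransition_mem_Icc t)

lemma fderiv_coneMap_inr (q : V) (t : ℝ) (y u : V) :
    fderiv ℝ (coneMap q) (t, y) (0, u) = Real.smoothTransition t • u := by
  have h1 : HasFDerivAt (fun z => coneMap q (t, z)) (fderiv ℝ (coneMap q) (t, y) ∘L .inr ℝ ℝ V) y :=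
    HasFDerivAt.comp (g := coneMap q) y
      ((contDiff_coneMap q).differentiable (by simp) (t, y)).hasFDerivAt
      (hasFDerivAt_prodMk_right t y)
  have h2 : HasFDerivAt (fun z => coneMap q (t, z))
      (Real.smoothTransition t • ContinuousLinearMap.id ℝ V) y := by
    have h3 : HasFDerivAt (fun z => Real.smoothTransition t • (z - q))
        (Real.smoothTransition t • ContinuousLinearMap.id ℝ V) y :=
      ((hasFDerivAt_id y).sub_const q).const_smul _
    exact h3.const_add q
  exact DFunLike.congr_fun (h1.unique h2) u

/-- The pullback of a 2-form by the contraction. -/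
def coneForm (q : V) (w : V → V [⋀^Fin 2]→L[ℝ] ℝ) (p : ℝ × V) : (ℝ × V) [⋀^Fin 2]→L[ℝ] ℝ :=
  (w (coneMap q p)).compContinuousLinearMap (fderiv ℝ (coneMap q) p)

lemma contDiffOn_coneForm {O : Set V} (hO : IsOpen O) (hOc : Convex ℝ O) {q : V} (hq : q ∈ O)
    {w : V → V [⋀^Fin 2]→L[ℝ] ℝ} (hw : ContDiffOn ℝ ∞ w O) :
    ContDiffOn ℝ ∞ (coneForm q w) (univ ×ˢ O) := by
  rintro ⟨t, y⟩ ⟨-, hy⟩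
  exact (contDiffAt_alt_comp (ContDiffAt.comp (g := w) (t, y)
    (hw.contDiffAt (hO.mem_nhds (coneMap_mem hOc hq t hy))) (contDiff_coneMap q).contDiffAt)
    (contDiffAt_fderiv (contDiff_coneMap q).contDiffAt)).contDiffWithinAt

/-- The Poincaré lemma for 2-forms on a convex open set. -/
lemma extDeriv_fiberIntegral_coneForm {O : Set V} (hO : IsOpen O) (hOc : Convex ℝ O) {q : V}
    (hq : q ∈ O) {w : V → V [⋀^Fin 2]→L[ℝ] ℝ} (hw : ContDiffOn ℝ ∞ w O)
    (hd : ∀ y ∈ O, extDeriv w y = 0) {y : V} (hy : y ∈ O) :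
    extDeriv (fiberIntegral (coneForm q w)) y = w y := by
  ext v
  rw [extDeriv_fiberIntegral hO (contDiffOn_coneForm hO hOc hq hw) (fun t z hz => ?_) hy v]
  -- Of the two ends of the homotopy formula, time 1 gives w because the contraction is then the
  -- identity, and time 0 gives zero because it is then constant.
  · have h1 : ∀ t, coneForm q w (t, y) ![(0, v 0), (0, v 1)] =
        w (coneMap q (t, y)) ![Real.smoothTransition t • v 0, Real.smoothTransition t • v 1] := by
      intro t
      rw [← fderiv_coneMap_inr q t y, ← fderiv_coneMap_inr q t y]
      refine congrArg (w (coneMap q (t, y))) (funext fun i => ?_)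
      fin_cases i <;> rfl
    rw [h1, h1]
    have h2 : coneMap q (1, y) = y := by simp [coneMap]
    have h3 : w (coneMap q (0, y)) ![(0 : V), 0] = 0 :=
      (w (coneMap q (0, y))).map_eq_zero_of_eq _ (i := 0) (j := 1) rfl (by simp)
    have h4 : ![v 0, v 1] = v := by ext i; fin_cases i <;> rfl
    simp only [Real.smoothTransition.one, Real.smoothTransition.zero, one_smul, zero_smul, h2, h3,
      h4, sub_zero]
  · have hz' := coneMap_mem hOc hq t hz
    have h1 := extDeriv_pullback (((hw.contDiffAt (hO.mem_nhds hz'))).differentiableAt (by simp))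
      ((contDiff_coneMap q).contDiffAt (x := (t, z))) (by simpa using two_le_infty)
    refine h1.trans ?_
    rw [hd _ hz']
    rfl

lemma extDeriv_zero_apply {f : V → V [⋀^Fin 0]→L[ℝ] ℝ} {x : V} (h : DifferentiableAt ℝ f x)
    (v : Fin 1 → V) : extDeriv f x v = fderiv ℝ (fun y => f y ![]) x (v 0) := by
  rw [extDeriv_apply h, Fin.sum_univ_one]
  have h0 : (0 : Fin 1).removeNth v = ![] := Subsingleton.elim _ _
  rw [h0]
  simp

/-- The potential of a 1-form obtained by integration along segments from `q`. -/
def segmentIntegral (q : V) (a : V → V [⋀^Fin 1]→L[ℝ] ℝ) (y : V) : ℝ :=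
  ∫ t in (0 : ℝ)..1, a (AffineMap.lineMap q y t) ![y - q]

lemma lineMap_mem_of_mem {O : Set V} (hOc : Convex ℝ O) {q y : V} (hq : q ∈ O) (hy : y ∈ O) {t : ℝ}
    (ht : t ∈ Icc (0 : ℝ) 1) : (AffineMap.lineMap q y t : V) ∈ O := by
  rw [AffineMap.lineMap_apply_module']
  rw [add_comm]
  exact hOc.add_smul_sub_mem hq hy ht

/-- The Poincaré lemma for 1-forms on a convex open set. -/
lemma hasFDerivAt_segmentIntegral {O : Set V} (hO : IsOpen O) (hOc : Convex ℝ O) {q : V}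
    (hq : q ∈ O) {a : V → V [⋀^Fin 1]→L[ℝ] ℝ} (ha : ContDiffOn ℝ ∞ a O)
    (hd : ∀ y ∈ O, extDeriv a y = 0) {y : V} (hy : y ∈ O) :
    HasFDerivAt (segmentIntegral q a)
      ((ContinuousAlternatingMap.ofSubsingleton ℝ V ℝ (0 : Fin 1)).symm (a y)) y := by
  let A : V → V →L[ℝ] ℝ := fun z =>
    (ContinuousAlternatingMap.ofSubsingleton ℝ V ℝ (0 : Fin 1)).symm (a z)
  have hA : ∀ z u, A z u = a z ![u] := fun z u =>
    congrArg (a z) (funext fun i => by fin_cases i; rfl)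
  have hA1 : ∀ z ∈ O, ∀ u, ContDiffAt ℝ ∞ (fun z => a z ![u]) z := fun z hz u =>
    contDiffAt_alt_apply (v := fun i _ => (![u] : Fin 1 → V) i) (ha.contDiffAt (hO.mem_nhds hz))
      fun _ => contDiffAt_const
  have hAd : DifferentiableOn ℝ A O := by
    have h1 : ContDiffOn ℝ 1 A O := contDiffOn_clm_apply.2 fun u z hz => by
      simp only [hA]
      exact ((hA1 z hz u).of_le one_le_infty).contDiffWithinAt
    exact h1.differentiableOn one_ne_zero
  have hAf : ∀ z ∈ O, HasFDerivAt A (fderiv ℝ A z) z := fun z hz =>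
    ((hAd z hz).differentiableAt (hO.mem_nhds hz)).hasFDerivAt
  have h1 := hOc.hasFDerivWithinAt_curveIntegral_segment_of_hasFDerivWithinAt_symmetric (𝕜 := ℝ)
    (dω := fderiv ℝ A) (fun z hz => (hAf z hz).hasFDerivWithinAt) ?_ hq hy
  · have h2 : (fun x => curveIntegral A (Path.segment q x)) = segmentIntegral q a := by
      funext x
      exact (curveIntegral_segment A q x).trans
        (intervalIntegral.integral_congr fun t _ => hA _ _)
    rw [h2] at h1
    exact h1.hasFDerivAt (hO.mem_nhds hy)
  · intro z hz u _ v _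
    -- Closedness of a 1-form is symmetry of its derivative, the hypothesis under which integration
    -- along segments gives a potential.
    have h3 : ∀ u v, fderiv ℝ A z u v = fderiv ℝ (fun z => a z ![v]) z u := by
      intro u v
      have h4 := (hAf z hz).clm_apply (hasFDerivAt_const v z)
      simp only [hA] at h4
      rw [h4.fderiv]
      simp
    have h5 := DFunLike.congr_fun (hd z hz) ![u, v]
    rw [extDeriv_one_apply ((ha.contDiffAt (hO.mem_nhds hz)).differentiableAt (by simp))] at h5
    rw [h3, h3]
    exact sub_eq_zero.1 h5

/-- The derivative of the potential is the given smooth form, so smoothness follows without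
differentiating under the integral again. -/
lemma contDiffOn_segmentIntegral {O : Set V} (hO : IsOpen O) (hOc : Convex ℝ O) {q : V}
    (hq : q ∈ O) {a : V → V [⋀^Fin 1]→L[ℝ] ℝ} (ha : ContDiffOn ℝ ∞ a O)
    (hd : ∀ y ∈ O, extDeriv a y = 0) : ContDiffOn ℝ ∞ (segmentIntegral q a) O := by
  have h := fun y hy => hasFDerivAt_segmentIntegral hO hOc hq ha hd (y := y) hy
  rw [contDiffOn_infty_iff_fderiv_of_isOpen hO]
  refine ⟨fun y hy => (h y hy).differentiableAt.differentiableWithinAt,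
    contDiffOn_clm_apply.2 fun u y hy => ?_⟩
  have h1 : ContDiffAt ℝ ∞ (fun z => a z (fun _ => u)) y :=
    contDiffAt_alt_apply (v := fun _ _ => u) (ha.contDiffAt (hO.mem_nhds hy))
      fun _ => contDiffAt_const
  refine (h1.congr_of_eventuallyEq ?_).contDiffWithinAt
  filter_upwards [hO.mem_nhds hy] with z hz
  rw [(h z hz).fderiv]
  rfl

end ConvexPoincare

/-! ### Pointwise calculus for forms defined only locally -/

section LocalCalculus

variable {m : ℕ} {X : Type*} [TopologicalSpace X] [ChartedSpace (Model m) X]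
  [IsManifold (𝓡 m) ∞ X] {k : ℕ} {x : X}

lemma SmoothFormAt.differentiableAt {w : RawForm m X k} (hw : SmoothFormAt w x)
    {e : OpenPartialHomeomorph X (Model m)} (he : e ∈ IsManifold.maximalAtlas (𝓡 m) ∞ X)
    (hx : x ∈ e.source) : DifferentiableAt ℝ (localRep e w) (e x) :=
  (hw e he hx).differentiableAt (by simp)

lemma SmoothFormAt.add {w η : RawForm m X k} (hw : SmoothFormAt w x) (hη : SmoothFormAt η x) :
    SmoothFormAt (w + η) x := fun e he hx => by
  rw [localRep_add]
  exact (hw e he hx).add (hη e he hx)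

lemma SmoothFormAt.smul {w : RawForm m X k} (c : ℝ) (hw : SmoothFormAt w x) :
    SmoothFormAt (c • w) x := fun e he hx => by
  rw [localRep_smul]
  exact contDiffAt_const.smul (hw e he hx)

lemma SmoothFormAt.zero : SmoothFormAt (0 : RawForm m X k) x := fun e _ _ => by
  rw [localRep_zero]
  exact contDiffAt_const

lemma SmoothFormAt.sub {w η : RawForm m X k} (hw : SmoothFormAt w x) (hη : SmoothFormAt η x) :
    SmoothFormAt (w - η) x := by
  have h := hw.add (hη.smul (-1))
  rwa [neg_one_smul, ← sub_eq_add_neg] at h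

lemma SmoothFormAt.sum {ι : Type*} (s : Finset ι) {w : ι → RawForm m X k}
    (hw : ∀ i ∈ s, SmoothFormAt (w i) x) : SmoothFormAt (∑ i ∈ s, w i) x := by
  classical
  induction s using Finset.induction_on with
  | empty => exact SmoothFormAt.zero
  | insert i s hi ih =>
    rw [Finset.sum_insert hi]
    exact (hw i (Finset.mem_insert_self i s)).add
      (ih fun j hj => hw j (Finset.mem_insert_of_mem hj))

lemma SmoothFormAt.congr {w η : RawForm m X k} (hw : SmoothFormAt w x)
    (h : ∀ᶠ z in 𝓝 x, η z = w z) : SmoothFormAt η x := fun e he hx =>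
  (hw e he hx).congr_of_eventuallyEq (localRep_eventuallyEq h hx)

lemma IsExtDerivAt.congr {α α' : RawForm m X k} {β : RawForm m X (k + 1)}
    (h : IsExtDerivAt α β x) (hα : ∀ᶠ z in 𝓝 x, α' z = α z) : IsExtDerivAt α' β x :=
  fun e he hx => by rw [(localRep_eventuallyEq hα hx).extDeriv_eq, h e he hx]

lemma IsExtDerivAt.add {α α' : RawForm m X k} {β β' : RawForm m X (k + 1)}
    (h : IsExtDerivAt α β x) (h' : IsExtDerivAt α' β' x) (hα : SmoothFormAt α x)
    (hα' : SmoothFormAt α' x) : IsExtDerivAt (α + α') (β + β') x := fun e he hx => by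
  rw [localRep_add, localRep_add, extDeriv_add (hα.differentiableAt he hx)
    (hα'.differentiableAt he hx), Pi.add_apply, h e he hx, h' e he hx]

lemma IsExtDerivAt.smul (c : ℝ) {α : RawForm m X k} {β : RawForm m X (k + 1)}
    (h : IsExtDerivAt α β x) : IsExtDerivAt (c • α) (c • β) x := fun e he hx => by
  rw [localRep_smul, localRep_smul, extDeriv_smul, Pi.smul_apply, h e he hx]

lemma IsExtDerivAt.sub {α α' : RawForm m X k} {β β' : RawForm m X (k + 1)}
    (h : IsExtDerivAt α β x) (h' : IsExtDerivAt α' β' x) (hα : SmoothFormAt α x)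
    (hα' : SmoothFormAt α' x) : IsExtDerivAt (α - α') (β - β') x := by
  have h1 := h.add (h'.smul (-1)) hα (hα'.smul (-1))
  rwa [neg_one_smul, neg_one_smul, ← sub_eq_add_neg, ← sub_eq_add_neg] at h1

lemma IsExtDerivAt.unique {α : RawForm m X k} {β β' : RawForm m X (k + 1)}
    (h : IsExtDerivAt α β x) (h' : IsExtDerivAt α β' x) : β x = β' x := by
  have he := IsManifold.chart_mem_maximalAtlas (I := 𝓡 m) (n := ∞) x
  have hx := mem_chart_source (Model m) x
  exact form_eq_of_localRep_eq he hx ((h _ he hx).trans (h' _ he hx).symm)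

lemma localRep_rawD_eventuallyEq {w : RawForm m X k} (hw : ∀ᶠ z in 𝓝 x, SmoothFormAt w z)
    {e : OpenPartialHomeomorph X (Model m)} (he : e ∈ IsManifold.maximalAtlas (𝓡 m) ∞ X)
    (hx : x ∈ e.source) : localRep e (rawD w) =ᶠ[𝓝 (e x)] extDeriv (localRep e w) := by
  have h1 := e.continuousAt_symm (e.map_source hx)
  rw [ContinuousAt, e.left_inv hx] at h1
  filter_upwards [h1.eventually hw, e.open_target.mem_nhds (e.map_source hx)] with y hy hyt
  have h2 := isExtDerivAt_rawD hy e he (e.map_target hyt)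
  rwa [e.right_inv hyt] at h2

lemma SmoothFormAt.rawD {w : RawForm m X k} (hw : ∀ᶠ z in 𝓝 x, SmoothFormAt w z) :
    SmoothFormAt (rawD w) x := fun e he hx =>
  (contDiffAt_extDeriv (hw.self_of_nhds e he hx)).congr_of_eventuallyEq
    (localRep_rawD_eventuallyEq hw he hx)

lemma isExtDerivAt_rawD_zero {w : RawForm m X k} (hw : ∀ᶠ z in 𝓝 x, SmoothFormAt w z) :
    IsExtDerivAt (rawD w) 0 x := fun e he hx => by
  rw [(localRep_rawD_eventuallyEq hw he hx).extDeriv_eq,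
    extDeriv_extDeriv_apply (hw.self_of_nhds e he hx) (by simpa using two_le_infty), localRep_zero]
  rfl

end LocalCalculus

/-! ### Joint continuity of families of forms in parameter and point -/

section JointContinuity

variable {V U : Type*} [NormedAddCommGroup V] [NormedSpace ℝ V] [FiniteDimensional ℝ V]
  [NormedAddCommGroup U] [NormedSpace ℝ U] [FiniteDimensional ℝ U]

lemma continuous_alt_comp (k : ℕ) : Continuous fun q : (V [⋀^Fin k]→L[ℝ] ℝ) × (U →L[ℝ] V) =>
    q.1.compContinuousLinearMap q.2 :=
  ContDiff.continuous (𝕜 := ℝ) (n := ∞) (contDiff_iff_contDiffAt.2 fun _ =>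
    contDiffAt_alt_comp contDiffAt_fst contDiffAt_snd)

lemma continuous_timeContract_comp :
    Continuous fun q : (V [⋀^Fin 2]→L[ℝ] ℝ) × ((ℝ × V) →L[ℝ] V) =>
      timeContract (fun _ => q.1.compContinuousLinearMap q.2) 0 := by
  refine ContDiff.continuous (𝕜 := ℝ) (n := ∞) (contDiff_iff_contDiffAt.2 fun p =>
    contDiffAt_alt fun v => ?_)
  simp_rw [timeContract_apply]
  exact contDiffAt_alt_apply
    (f := fun q : (V [⋀^Fin 2]→L[ℝ] ℝ) × ((ℝ × V) →L[ℝ] V) => q.1.compContinuousLinearMap q.2)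
    (v := fun i _ => (![(1, 0), (0, v 0)] : Fin 2 → ℝ × V) i)
    (contDiffAt_alt_comp contDiffAt_fst contDiffAt_snd) fun _ => contDiffAt_const

variable {m : ℕ} {X : Type*} [TopologicalSpace X] [ChartedSpace (Model m) X]
  [IsManifold (𝓡 m) ∞ X] {T : Type*} [TopologicalSpace T] {k : ℕ} {x : X}

/-- Joint continuity of a family of forms in the parameter and the point, at a point of `X`. -/
def JointContAt (A : T → RawForm m X k) (x : X) : Prop :=
  ∀ e ∈ IsManifold.maximalAtlas (𝓡 m) ∞ X, x ∈ e.source → ∀ w : T,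
    ContinuousAt (fun p : T × Model m => localRep e (A p.1) p.2) (w, e x)

lemma JointContAt.of_chart {A : T → RawForm m X k} {e : OpenPartialHomeomorph X (Model m)}
    (he : e ∈ IsManifold.maximalAtlas (𝓡 m) ∞ X) (hx : x ∈ e.source)
    (h : ∀ w : T, ContinuousAt (fun p : T × Model m => localRep e (A p.1) p.2) (w, e x)) :
    JointContAt A x := by
  intro e' he' hx' w
  have hinv : e'.symm (e' x) = x := e'.left_inv hx'
  have hy' := e'.map_source hx'
  have hG : ContDiffAt ℝ ∞ (fun y => e (e'.symm y)) (e' x) :=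
    contDiffAt_chart_comp he (contMDiffAt_symm_of_mem_maximalAtlas he' hy') (by rwa [hinv])
  have h1 : (fun p : T × Model m => localRep e' (A p.1) p.2) =ᶠ[𝓝 (w, e' x)] fun p =>
      (localRep e (A p.1) (e (e'.symm p.2))).compContinuousLinearMap
        (fderiv ℝ (fun y => e (e'.symm y)) p.2) := by
    have h2 : ∀ᶠ y in 𝓝 (e' x), y ∈ e'.target ∧ e'.symm y ∈ e.source :=
      Filter.inter_mem (e'.open_target.mem_nhds hy') ((e'.continuousAt_symm hy').preimage_mem_nhds
        (e.open_source.mem_nhds (by rwa [hinv])))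
    filter_upwards [continuousAt_snd.eventually h2] with p hp
    exact pullVec_eq he (mdifferentiableAt_chart_symm he' hp.1) hp.2 _
  refine ContinuousAt.congr ?_ h1.symm
  have h3 : ContinuousAt (fun p : T × Model m => (p.1, e (e'.symm p.2))) (w, e' x) :=
    continuousAt_fst.prodMk (ContinuousAt.comp (f := Prod.snd) (g := fun y => e (e'.symm y))
      (x := (w, e' x)) hG.continuousAt continuousAt_snd)
  have h4 : ContinuousAt (fun p : T × Model m => localRep e (A p.1) (e (e'.symm p.2)))
      (w, e' x) := by
    refine ContinuousAt.comp (f := fun p : T × Model m => (p.1, e (e'.symm p.2)))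
      (g := fun p : T × Model m => localRep e (A p.1) p.2) ?_ h3
    simp only [hinv]
    exact h w
  have h5 : ContinuousAt (fun p : T × Model m => fderiv ℝ (fun y => e (e'.symm y)) p.2)
      (w, e' x) :=
    ContinuousAt.comp (f := Prod.snd) (x := (w, e' x)) (contDiffAt_fderiv hG).continuousAt
      continuousAt_snd
  exact (continuous_alt_comp k).continuousAt.comp (h4.prodMk h5)

lemma JointContAt.sub {A B : T → RawForm m X k} (hA : JointContAt A x) (hB : JointContAt B x) :
    JointContAt (fun w => A w - B w) x := fun e he hx w => by
  have h1 : ∀ p : T × Model m, localRep e (A p.1 - B p.1) p.2 =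
      localRep e (A p.1) p.2 - localRep e (B p.1) p.2 := fun p => rfl
  simp only [h1]
  exact (hA e he hx w).sub (hB e he hx w)

/-- Only the C^0 part of the topology is used: nearby forms are uniformly close on a compact
neighbourhood of the point, and the fixed form is continuous there. -/
lemma jointContAt_closedForm (x : X) :
    JointContAt (fun w : ClosedForm m X k => w.1.1) x := by
  intro e he hx w
  have hy := e.map_source hx
  have hw : ContinuousAt (localRep e w.1.1) (e x) :=
    ((w.1.2 e he).contDiffAt (e.open_target.mem_nhds hy)).continuousAt
  obtain ⟨K, hKn, hKt, hK⟩ := local_compact_nhds (e.open_target.mem_nhds hy)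
  rw [Metric.continuousAt_iff'] at hw ⊢
  intro ε hε
  have h1 : ∀ᶠ η : ClosedForm m X k in 𝓝 w, ∀ y ∈ K,
      ‖localRep e η.1.1 y - localRep e w.1.1 y‖ < ε / 2 :=
    continuous_subtype_val.continuousAt.eventually
      (ball_mem_nhds_smoothForm w.1 he hK hKt (half_pos hε))
  have h2 := hw (ε / 2) (half_pos hε)
  rw [nhds_prod_eq]
  filter_upwards [h1.prod_mk (h2.and hKn)] with p hp
  calc dist (localRep e p.1.1.1 p.2) (localRep e w.1.1 (e x))
      ≤ dist (localRep e p.1.1.1 p.2) (localRep e w.1.1 p.2) +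
        dist (localRep e w.1.1 p.2) (localRep e w.1.1 (e x)) := dist_triangle _ _ _
    _ < ε / 2 + ε / 2 := add_lt_add (by rw [dist_eq_norm]; exact hp.1 _ hp.2.2) hp.2.1
    _ = ε := add_halves ε

end JointContinuity

/-! ### Linearity and parameter continuity of the Poincaré operators -/

section Linearity

variable {V : Type*} [NormedAddCommGroup V] [NormedSpace ℝ V] [FiniteDimensional ℝ V]

lemma fiberIntegral_add {O : Set V} {Ω Ω' : ℝ × V → (ℝ × V) [⋀^Fin 2]→L[ℝ] ℝ}
    (hΩ : ContDiffOn ℝ ∞ Ω (univ ×ˢ O)) (hΩ' : ContDiffOn ℝ ∞ Ω' (univ ×ˢ O)) {y : V}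
    (hy : y ∈ O) :
    fiberIntegral (Ω + Ω') y = fiberIntegral Ω y + fiberIntegral Ω' y := by
  have h : ∀ p, timeContract (Ω + Ω') p = timeContract Ω p + timeContract Ω' p := fun p => by
    ext v
    simp [timeContract_apply]
  simp only [fiberIntegral, h]
  exact intervalIntegral.integral_add
    ((continuous_slice (contDiffOn_timeContract hΩ).continuousOn hy).intervalIntegrable _ _)
    ((continuous_slice (contDiffOn_timeContract hΩ').continuousOn hy).intervalIntegrable _ _)

lemma coneForm_add (q : V) (w w' : V → V [⋀^Fin 2]→L[ℝ] ℝ) :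
    coneForm q (w + w') = coneForm q w + coneForm q w' := rfl

lemma coneForm_smul (q : V) (c : ℝ) (w : V → V [⋀^Fin 2]→L[ℝ] ℝ) :
    coneForm q (c • w) = c • coneForm q w := rfl

lemma fiberIntegral_smul (c : ℝ) (Ω : ℝ × V → (ℝ × V) [⋀^Fin 2]→L[ℝ] ℝ) (y : V) :
    fiberIntegral (c • Ω) y = c • fiberIntegral Ω y := by
  have h : ∀ p, timeContract (c • Ω) p = c • timeContract Ω p := fun p => by
    ext v
    simp [timeContract_apply]
  simp only [fiberIntegral, h]
  exact intervalIntegral.integral_smul c _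

lemma segmentIntegral_add {O : Set V} (hOc : Convex ℝ O) {q : V} (hq : q ∈ O)
    {a b : V → V [⋀^Fin 1]→L[ℝ] ℝ} (ha : ContDiffOn ℝ ∞ a O) (hb : ContDiffOn ℝ ∞ b O) {y : V}
    (hy : y ∈ O) :
    segmentIntegral q (a + b) y = segmentIntegral q a y + segmentIntegral q b y := by
  have h : ∀ a : V → V [⋀^Fin 1]→L[ℝ] ℝ, ContDiffOn ℝ ∞ a O →
      IntervalIntegrable (fun t : ℝ => a (AffineMap.lineMap q y t) ![y - q])
        MeasureTheory.volume 0 1 := fun a ha => by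
    refine ContinuousOn.intervalIntegrable ?_
    rw [uIcc_of_le zero_le_one]
    have h1 : ContinuousOn (fun t : ℝ => a (AffineMap.lineMap q y t)) (Icc 0 1) :=
      ha.continuousOn.comp (AffineMap.lineMap_continuous.continuousOn)
        fun t ht => lineMap_mem_of_mem hOc hq hy ht
    exact (ContinuousAlternatingMap.apply ℝ V ℝ ![y - q]).continuous.comp_continuousOn h1
  exact intervalIntegral.integral_add (h a ha) (h b hb)

lemma segmentIntegral_smul (c : ℝ) (q : V) (a : V → V [⋀^Fin 1]→L[ℝ] ℝ) (y : V) :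
    segmentIntegral q (c • a) y = c • segmentIntegral q a y :=
  intervalIntegral.integral_smul c _

/-- Convexity keeps the contracted points in O, so the integrand is jointly continuous in the
parameter, the point and time. -/
lemma continuousOn_fiberIntegral_coneForm {T : Type*} [TopologicalSpace T] {O : Set V}
    (hOc : Convex ℝ O) {q : V} (hq : q ∈ O) {w : T → V → V [⋀^Fin 2]→L[ℝ] ℝ}
    (hw : ∀ τ, ∀ y ∈ O, ContinuousAt (fun p : T × V => w p.1 p.2) (τ, y)) :
    ContinuousOn (fun p : T × V => fiberIntegral (coneForm q (w p.1)) p.2)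
      {p : T × V | p.2 ∈ O} := by
  rw [continuousOn_iff_continuous_domRestrict]
  refine intervalIntegral.continuous_parametric_intervalIntegral_of_continuous'
    (f := fun (s : {p : T × V | p.2 ∈ O}) t => timeContract (coneForm q (w s.1.1)) (t, s.1.2))
    ?_ 0 1
  have h4 : Continuous fun r : {p : T × V | p.2 ∈ O} × ℝ => w r.1.1.1 (coneMap q (r.2, r.1.1.2)) := by
    rw [continuous_iff_continuousAt]
    intro r
    have h5 : Continuous fun r : {p : T × V | p.2 ∈ O} × ℝ =>
        (r.1.1.1, coneMap q (r.2, r.1.1.2)) := by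
      have := (contDiff_coneMap q).continuous
      fun_prop
    exact ContinuousAt.comp
      (f := fun r : {p : T × V | p.2 ∈ O} × ℝ => (r.1.1.1, coneMap q (r.2, r.1.1.2)))
      (g := fun p : T × V => w p.1 p.2) (hw _ _ (coneMap_mem hOc hq r.2 r.1.2)) h5.continuousAt
  have h8 : Continuous fun r : {p : T × V | p.2 ∈ O} × ℝ =>
      fderiv ℝ (coneMap q) (r.2, r.1.1.2) := by
    have := (contDiff_coneMap q).continuous_fderiv (by simp)
    fun_prop
  refine (continuous_timeContract_comp.comp (h4.prodMk h8)).congr fun r => ?_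
  ext v
  simp only [Function.comp_apply, Function.uncurry, timeContract_apply]
  rfl

end Linearity

/-! ### Primitives and potentials depending linearly and continuously on the form -/

section Primitives

variable {m : ℕ} {X : Type*} [TopologicalSpace X] [ChartedSpace (Model m) X]

variable (m) in
/-- Open subsets of `X` that are convex in some chart. -/
def ChartConvex (C : Set X) : Prop :=
  IsOpen C ∧ ∃ e ∈ IsManifold.maximalAtlas (𝓡 m) ∞ X, C ⊆ e.source ∧ Convex ℝ (e '' C)

variable [IsManifold (𝓡 m) ∞ X]

lemma chartForm_add {k : ℕ} (e : OpenPartialHomeomorph X (Model m))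
    {f g h : Model m → Model m [⋀^Fin k]→L[ℝ] ℝ} {x : X} (hfg : h (e x) = f (e x) + g (e x)) :
    chartForm e h x = chartForm e f x + chartForm e g x := by
  simp only [chartForm, hfg]
  rfl

lemma chartForm_smul {k : ℕ} (e : OpenPartialHomeomorph X (Model m)) (c : ℝ)
    {f h : Model m → Model m [⋀^Fin k]→L[ℝ] ℝ} {x : X} (hf : h (e x) = c • f (e x)) :
    chartForm e h x = c • chartForm e f x := by
  simp only [chartForm, hf]
  rfl

/-- Closed 2-forms have primitives on chart-convex sets, depending linearly and continuously on
the form. -/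
lemma exists_primitive {C : Set X} (hC : ChartConvex m C) {x₀ : X} (hx₀ : x₀ ∈ C) :
    ∃ A : ClosedForm m X 2 →ₗ[ℝ] RawForm m X 1, ∀ x ∈ C,
      (∀ w, SmoothFormAt (A w) x ∧ IsExtDerivAt (A w) w.1.1 x) ∧ JointContAt A x := by
  classical
  obtain ⟨hCo, e, he, hCe, hconv⟩ := hC
  set O := e '' C with hOdef
  have hO : IsOpen O := e.isOpen_image_of_subset_source hCo hCe
  have hOt : O ⊆ e.target := by
    rintro _ ⟨x, hx, rfl⟩
    exact e.map_source (hCe hx)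
  have hsymm : ∀ y ∈ O, e.symm y ∈ C := by
    rintro _ ⟨x, hx, rfl⟩
    rwa [e.left_inv (hCe hx)]
  have hq : e x₀ ∈ O := ⟨x₀, hx₀, rfl⟩
  set q := e x₀
  have hw : ∀ w : ClosedForm m X 2, ContDiffOn ℝ ∞ (localRep e w.1.1) O := fun w =>
    (w.1.2 e he).mono hOt
  have hcone := fun w : ClosedForm m X 2 => contDiffOn_coneForm hO hconv hq (hw w)
  let F : ClosedForm m X 2 → Model m → Model m [⋀^Fin 1]→L[ℝ] ℝ := fun w =>
    fiberIntegral (coneForm q (localRep e w.1.1))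
  have hFadd : ∀ w w', ∀ y ∈ O, F (w + w') y = F w y + F w' y := fun w w' y hy => by
    have h1 : localRep e (w + w').1.1 = localRep e w.1.1 + localRep e w'.1.1 := localRep_add _ _ _
    simp only [F, h1, coneForm_add]
    exact fiberIntegral_add (hcone w) (hcone w') hy
  have hFsmul : ∀ (c : ℝ) w y, F (c • w) y = c • F w y := fun c w y => by
    have h1 : localRep e (c • w).1.1 = c • localRep e w.1.1 := localRep_smul _ _ _
    simp only [F, h1, coneForm_smul]
    exact fiberIntegral_smul c _ y
  let A : ClosedForm m X 2 →ₗ[ℝ] RawForm m X 1 :=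
    -- Extension by zero off C gives a linear map into global fields of forms; nothing is claimed
    -- about it outside C.
    { toFun := fun w x => if x ∈ C then chartForm e (F w) x else 0
      map_add' := fun w w' => by
        funext x
        by_cases hx : x ∈ C
        · have h1 : (if x ∈ C then chartForm e (F (w + w')) x else 0) =
              (if x ∈ C then chartForm e (F w) x else 0) +
                (if x ∈ C then chartForm e (F w') x else 0) := by
            rw [if_pos hx, if_pos hx, if_pos hx]
            exact chartForm_add e (hFadd w w' _ ⟨x, hx, rfl⟩)
          exact h1
        · have h1 : (if x ∈ C then chartForm e (F (w + w')) x else 0) =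
              (if x ∈ C then chartForm e (F w) x else 0) +
                (if x ∈ C then chartForm e (F w') x else 0) := by
            rw [if_neg hx, if_neg hx, if_neg hx, add_zero]
          exact h1
      map_smul' := fun c w => by
        funext x
        by_cases hx : x ∈ C
        · have h1 : (if x ∈ C then chartForm e (F (c • w)) x else 0) =
              c • (if x ∈ C then chartForm e (F w) x else 0) := by
            rw [if_pos hx, if_pos hx]
            exact chartForm_smul e c (hFsmul c w _)
          exact h1
        · have h1 : (if x ∈ C then chartForm e (F (c • w)) x else 0) =
              c • (if x ∈ C then chartForm e (F w) x else 0) := by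
            rw [if_neg hx, if_neg hx, smul_zero]
          exact h1 }
  have hA : ∀ w, ∀ x ∈ C, A w x = chartForm e (F w) x := fun w x hx => if_pos hx
  have hloc : ∀ w, ∀ y ∈ O, localRep e (A w) y = F w y := by
    rintro w _ ⟨x, hx, rfl⟩
    exact localRep_of_eq_chartForm he (hCe hx) (hA w x hx)
  refine ⟨A, fun x hx => ⟨fun w => ?_, ?_⟩⟩
  · have hy : e x ∈ O := ⟨x, hx, rfl⟩
    have h1 : localRep e (A w) =ᶠ[𝓝 (e x)] F w := by
      filter_upwards [hO.mem_nhds hy] with y hy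
      exact hloc w y hy
    have h2 : ContDiffAt ℝ ∞ (localRep e (A w)) (e x) :=
      (((contDiffOn_fiberIntegral hO (hcone w)).contDiffAt (hO.mem_nhds hy))).congr_of_eventuallyEq
        h1
    refine ⟨smoothFormAt_of_chart he (hCe hx) h2, isExtDerivAt_of_chart he (hCe hx) h2 ?_⟩
    rw [h1.extDeriv_eq]
    exact (extDeriv_fiberIntegral_coneForm hO hconv hq (hw w) (fun y hy =>
      (w.2 e he y (hOt hy)).symm.trans (congrFun (localRep_zero e) y)) hy).symm
  · have hy : e x ∈ O := ⟨x, hx, rfl⟩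
    have hS : IsOpen {p : ClosedForm m X 2 × Model m | p.2 ∈ O} := hO.preimage continuous_snd
    have h3 := continuousOn_fiberIntegral_coneForm hconv hq
      (w := fun w : ClosedForm m X 2 => localRep e w.1.1) (by
        rintro w _ ⟨z, hz, rfl⟩
        exact jointContAt_closedForm z e he (hCe hz) w)
    refine JointContAt.of_chart he (hCe hx) fun w => ?_
    refine (h3.continuousAt (hS.mem_nhds hy)).congr ?_
    filter_upwards [hS.mem_nhds (show (w, e x) ∈ _ from hy)] with p hp
    exact (hloc p.1 p.2 hp).symm

/-- Closed 1-forms, given as a linear and continuous family, have potentials on chart-convex sets,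
depending linearly and continuously on the parameter. -/
lemma exists_potential {C : Set X} (hC : ChartConvex m C) {x₀ : X} (hx₀ : x₀ ∈ C)
    (A : ClosedForm m X 2 →ₗ[ℝ] RawForm m X 1)
    (hA : ∀ x ∈ C, (∀ w, SmoothFormAt (A w) x ∧ IsExtDerivAt (A w) 0 x) ∧ JointContAt A x) :
    ∃ f : ClosedForm m X 2 →ₗ[ℝ] RawForm m X 0, ∀ x ∈ C,
      (∀ w, SmoothFormAt (f w) x ∧ IsExtDerivAt (f w) (A w) x) ∧
        Continuous fun w => f w x ![] := by
  classical
  obtain ⟨hCo, e, he, hCe, hconv⟩ := hC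
  set O := e '' C with hOdef
  have hO : IsOpen O := e.isOpen_image_of_subset_source hCo hCe
  have hOt : O ⊆ e.target := by
    rintro _ ⟨x, hx, rfl⟩
    exact e.map_source (hCe hx)
  have hq : e x₀ ∈ O := ⟨x₀, hx₀, rfl⟩
  set q := e x₀
  have ha : ∀ w, ContDiffOn ℝ ∞ (localRep e (A w)) O := by
    rintro w _ ⟨x, hx, rfl⟩
    exact (((hA x hx).1 w).1 e he (hCe hx)).contDiffWithinAt
  have had : ∀ w, ∀ y ∈ O, extDeriv (localRep e (A w)) y = 0 := by
    rintro w _ ⟨x, hx, rfl⟩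
    exact (((hA x hx).1 w).2 e he (hCe hx)).symm.trans (congrFun (localRep_zero e) (e x))
  let F : ClosedForm m X 2 → Model m → ℝ := fun w => segmentIntegral q (localRep e (A w))
  have hFadd : ∀ w w', ∀ y ∈ O, F (w + w') y = F w y + F w' y := fun w w' y hy => by
    simp only [F, map_add, localRep_add]
    exact segmentIntegral_add hconv hq (ha w) (ha w') hy
  have hFsmul : ∀ (c : ℝ) w y, F (c • w) y = c • F w y := fun c w y => by
    simp only [F, map_smul, localRep_smul]
    exact segmentIntegral_smul c q _ y
  let Z : ∀ x : X, ℝ → TangentSpace (𝓡 m) x [⋀^Fin 0]→L[ℝ] ℝ := fun x c =>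
    ContinuousAlternatingMap.constOfIsEmpty ℝ (TangentSpace (𝓡 m) x) (Fin 0) c
  let f : ClosedForm m X 2 →ₗ[ℝ] RawForm m X 0 :=
    { toFun := fun w x => Z x (if x ∈ C then F w (e x) else 0)
      map_add' := fun w w' => by
        funext x
        have h1 : (if x ∈ C then F (w + w') (e x) else 0) =
            (if x ∈ C then F w (e x) else 0) + (if x ∈ C then F w' (e x) else 0) := by
          by_cases hx : x ∈ C
          · rw [if_pos hx, if_pos hx, if_pos hx, hFadd w w' _ ⟨x, hx, rfl⟩]
          · rw [if_neg hx, if_neg hx, if_neg hx, add_zero]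
        rw [h1]
        rfl
      map_smul' := fun c w => by
        funext x
        have h1 : (if x ∈ C then F (c • w) (e x) else 0) =
            c • (if x ∈ C then F w (e x) else 0) := by
          by_cases hx : x ∈ C
          · rw [if_pos hx, if_pos hx, hFsmul]
          · rw [if_neg hx, if_neg hx, smul_zero]
        rw [h1]
        rfl }
  have hf : ∀ w, ∀ x ∈ C, f w x ![] = F w (e x) := fun w x hx => if_pos hx
  have hloc : ∀ w, ∀ y ∈ O, ∀ v, localRep e (f w) y v = F w y := by
    rintro w _ ⟨x, hx, rfl⟩ v
    have h1 : e.symm (e x) = x := e.left_inv (hCe hx)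
    have h2 : localRep e (f w) (e x) v =
      (if e.symm (e x) ∈ C then F w (e (e.symm (e x))) else 0) := rfl
    rw [h2, h1, if_pos hx]
  refine ⟨f, fun x hx => ⟨fun w => ?_, ?_⟩⟩
  · have hy : e x ∈ O := ⟨x, hx, rfl⟩
    have h1 : ∀ v, (fun y => localRep e (f w) y v) =ᶠ[𝓝 (e x)] F w := fun v => by
      filter_upwards [hO.mem_nhds hy] with y hy
      exact hloc w y hy v
    have h2 : ContDiffAt ℝ ∞ (localRep e (f w)) (e x) := contDiffAt_alt fun v =>
      ((contDiffOn_segmentIntegral hO hconv hq (ha w) (had w)).contDiffAt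
        (hO.mem_nhds hy)).congr_of_eventuallyEq (h1 v)
    refine ⟨smoothFormAt_of_chart he (hCe hx) h2, isExtDerivAt_of_chart he (hCe hx) h2 ?_⟩
    ext v
    rw [extDeriv_zero_apply (h2.differentiableAt (by simp)), (h1 ![]).fderiv_eq,
      (hasFDerivAt_segmentIntegral hO hconv hq (ha w) (had w) hy).fderiv]
    refine congrArg (localRep e (A w) (e x)) (funext fun i => ?_)
    fin_cases i
    rfl
  · have hy : e x ∈ O := ⟨x, hx, rfl⟩
    simp only [hf _ x hx]
    -- The segment is known to lie in O only for times in [0,1]. Clamping time there makes the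
    -- integrand continuous for all real times and leaves the integral unchanged.
    have h3 : Continuous fun w : ClosedForm m X 2 => ∫ t in (0 : ℝ)..1,
        localRep e (A w) (AffineMap.lineMap q (e x) (projIcc (0 : ℝ) 1 zero_le_one t : ℝ))
          ![e x - q] := by
      refine intervalIntegral.continuous_parametric_intervalIntegral_of_continuous' ?_ 0 1
      have hap : Continuous fun a : Model m [⋀^Fin 1]→L[ℝ] ℝ => a ![e x - q] :=
        (ContinuousAlternatingMap.apply ℝ (Model m) ℝ ![e x - q]).continuous
      refine hap.comp (f := fun r : ClosedForm m X 2 × ℝ => localRep e (A r.1)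
        (AffineMap.lineMap q (e x) (projIcc (0 : ℝ) 1 zero_le_one r.2 : ℝ))) ?_
      rw [continuous_iff_continuousAt]
      rintro ⟨w, t⟩
      have hl : Continuous fun s : ℝ => (AffineMap.lineMap q (e x) s : Model m) :=
        AffineMap.lineMap_continuous
      have hp : Continuous fun r : ClosedForm m X 2 × ℝ =>
          (projIcc (0 : ℝ) 1 zero_le_one r.2 : ℝ) :=
        continuous_subtype_val.comp ((continuous_projIcc (h := zero_le_one)).comp continuous_snd)
      have h4 : Continuous fun r : ClosedForm m X 2 × ℝ =>
          (r.1, (AffineMap.lineMap q (e x) (projIcc (0 : ℝ) 1 zero_le_one r.2 : ℝ) : Model m)) :=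
        continuous_fst.prodMk (hl.comp hp)
      have h5 := lineMap_mem_of_mem hconv hq hy (projIcc (0 : ℝ) 1 zero_le_one t).2
      obtain ⟨z, hz, hze⟩ := h5
      have h6 := (hA z hz).2 e he (hCe hz) w
      rw [hze] at h6
      exact ContinuousAt.comp (f := fun r : ClosedForm m X 2 × ℝ =>
          (r.1, (AffineMap.lineMap q (e x) (projIcc (0 : ℝ) 1 zero_le_one r.2 : ℝ) : Model m)))
        (g := fun p : ClosedForm m X 2 × Model m => localRep e (A p.1) p.2) (x := (w, t)) h6
        h4.continuousAt
    refine h3.congr fun w => ?_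
    refine intervalIntegral.integral_congr fun t ht => ?_
    rw [uIcc_of_le zero_le_one] at ht
    simp only [projIcc_of_mem zero_le_one ht]

end Primitives

/-! ### Nested chart-convex families replacing a good cover -/

section Cover

variable {m : ℕ} {X : Type*} [TopologicalSpace X] [ChartedSpace (Model m) X]
  [IsManifold (𝓡 m) ∞ X]

lemma exists_chartConvex_subset {W : Set X} {z : X} (hW : W ∈ 𝓝 z) :
    ∃ C, ChartConvex m C ∧ z ∈ C ∧ C ⊆ W := by
  set e := chartAt (Model m) z
  have hz : z ∈ e.source := mem_chart_source (Model m) z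
  have h1 : e.target ∩ e.symm ⁻¹' W ∈ 𝓝 (e z) := by
    refine Filter.inter_mem (e.open_target.mem_nhds (e.map_source hz)) ?_
    refine (e.continuousAt_symm (e.map_source hz)).preimage_mem_nhds ?_
    rwa [e.left_inv hz]
  obtain ⟨r, hr, hball⟩ := Metric.mem_nhds_iff.1 h1
  refine ⟨e.source ∩ e ⁻¹' Metric.ball (e z) r, ⟨e.isOpen_inter_preimage Metric.isOpen_ball, e,
    IsManifold.chart_mem_maximalAtlas z, inter_subset_left, ?_⟩,
    ⟨hz, Metric.mem_ball_self hr⟩, ?_⟩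
  · have h2 : e '' (e.source ∩ e ⁻¹' Metric.ball (e z) r) = Metric.ball (e z) r := by
      apply Subset.antisymm
      · rintro _ ⟨x, hx, rfl⟩
        exact hx.2
      · intro y hy
        have hyt := (hball hy).1
        refine ⟨e.symm y, ⟨e.map_target hyt, ?_⟩, e.right_inv hyt⟩
        rw [mem_preimage, e.right_inv hyt]
        exact hy
    rw [h2]
    exact convex_ball _ _
  · rintro x ⟨hx, hxr⟩
    have := (hball hxr).2
    rwa [mem_preimage, e.left_inv hx] at this

/-- A compact manifold has three nested families of chart-convex sets around its points, such that
the sets of the first family that meet are contained in each other's larger sets. -/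
lemma exists_nested_chartConvex [CompactSpace X] [T2Space X] :
    ∃ U V B : X → Set X, (∀ x, ChartConvex m (U x) ∧ ChartConvex m (V x) ∧ ChartConvex m (B x)) ∧
      (∀ x, x ∈ U x) ∧ ∀ x y, (U x ∩ U y).Nonempty → U x ⊆ V y ∧ V x ⊆ B y := by
  have := Manifold.metrizableSpace (𝓡 m) X
  let _ := TopologicalSpace.metrizableSpaceMetric X
  -- Intersections of chart-convex sets need not be convex in any chart, so three scales of sets are
  -- used in place of a good cover. A Lebesgue number yields, at each scale, sets squeezed between
  -- concentric metric balls.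
  have key : ∀ ρ : ℝ, 0 < ρ → ∃ σ, 0 < σ ∧ σ ≤ ρ ∧ ∃ C : X → Set X, ∀ x, ChartConvex m (C x) ∧
      Metric.ball x σ ⊆ C x ∧ C x ⊆ Metric.ball x ρ := by
    intro ρ hρ
    choose C hC hzC hCρ using fun z : X =>
      exists_chartConvex_subset (m := m) (Metric.ball_mem_nhds z (half_pos hρ))
    obtain ⟨δ, hδ, h⟩ := lebesgue_number_lemma_of_metric (s := (univ : Set X)) (c := C)
      isCompact_univ (fun z => (hC z).1) fun z _ => mem_iUnion.2 ⟨z, hzC z⟩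
    choose i hi using fun x : X => h x (mem_univ x)
    refine ⟨min δ ρ, lt_min hδ hρ, min_le_right _ _, fun x => C (i x), fun x => ⟨hC _,
      (Metric.ball_subset_ball (min_le_left _ _)).trans (hi x), fun y hy => ?_⟩⟩
    have h1 := hCρ _ hy
    have h2 := hCρ _ (hi x (Metric.mem_ball_self hδ))
    rw [Metric.mem_ball] at h1 h2 ⊢
    linarith [dist_triangle_right y x (i x)]
  obtain ⟨ρ, hρ, -, B, hB⟩ := key 1 one_pos
  obtain ⟨σ, hσ, hσρ, V, hV⟩ := key (ρ / 4) (by positivity)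
  obtain ⟨τ, hτ, hτσ, U, hU⟩ := key (σ / 4) (by positivity)
  refine ⟨U, V, B, fun x => ⟨(hU x).1, (hV x).1, (hB x).1⟩,
    fun x => (hU x).2.1 (Metric.mem_ball_self hτ), ?_⟩
  rintro x y ⟨p, hpx, hpy⟩
  have h1 := (hU x).2.2 hpx
  have h2 := (hU y).2.2 hpy
  rw [Metric.mem_ball] at h1 h2
  -- The factors 1/4 suffice: U x lies within σ/4 + σ/2 < σ of y, and V x lies within ρ/4 + σ/2 < ρ
  -- of y because σ ≤ ρ/4.
  have h3 : dist x y < σ / 2 := by linarith [dist_triangle_left x y p]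
  constructor
  · intro z hz
    have h4 := (hU x).2.2 hz
    refine (hV y).2.1 ?_
    rw [Metric.mem_ball] at h4 ⊢
    linarith [dist_triangle z x y]
  · intro z hz
    have h4 := (hV x).2.2 hz
    refine (hB y).2.1 ?_
    rw [Metric.mem_ball] at h4 ⊢
    linarith [dist_triangle z x y]

end Cover

/-! ### Closed 0-forms are locally constant -/

section ZeroForms

variable {m : ℕ} {X : Type*} [TopologicalSpace X] [ChartedSpace (Model m) X]

lemma zeroForm_ext {h h' : RawForm m X 0} {x : X} (hx : h x ![] = h' x ![]) : h x = h' x := by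
  ext v
  rw [Subsingleton.elim v ![]]
  exact hx

variable (m) in
/-- The value of a 0-form at a point. -/
def evalZeroForm (x : X) : RawForm m X 0 →ₗ[ℝ] ℝ where
  toFun h := h x ![]
  map_add' _ _ := rfl
  map_smul' _ _ := rfl

variable [IsManifold (𝓡 m) ∞ X]

/-- A closed 0-form is constant on chart-convex sets. -/
lemma zeroForm_const {C : Set X} (hC : ChartConvex m C) {h : RawForm m X 0}
    (hh : ∀ x ∈ C, SmoothFormAt h x ∧ IsExtDerivAt h 0 x) {x y : X} (hx : x ∈ C) (hy : y ∈ C) :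
    h x ![] = h y ![] := by
  obtain ⟨hCo, e, he, hCe, hconv⟩ := hC
  have hO : IsOpen (e '' C) := e.isOpen_image_of_subset_source hCo hCe
  have hval : ∀ z ∈ C, localRep e h (e z) ![] = h z ![] := by
    intro z hz
    have h1 : localRep e h (e z) ![] = h (e.symm (e z)) ![] :=
      congrArg (h (e.symm (e z))) (Subsingleton.elim _ _)
    rw [h1, e.left_inv (hCe hz)]
  have hsm : ∀ z ∈ C, ContDiffAt ℝ ∞ (localRep e h) (e z) := fun z hz => (hh z hz).1 e he (hCe hz)
  have h2 : DifferentiableOn ℝ (fun p => localRep e h p ![]) (e '' C) := by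
    rintro _ ⟨z, hz, rfl⟩
    exact ((contDiffAt_alt_apply (v := fun i _ => (![] : Fin 0 → Model m) i) (hsm z hz)
      fun _ => contDiffAt_const).differentiableAt (by simp)).differentiableWithinAt
  have h3 : EqOn (fderiv ℝ (fun p => localRep e h p ![])) 0 (e '' C) := by
    rintro _ ⟨z, hz, rfl⟩
    ext v
    have h4 := extDeriv_zero_apply ((hsm z hz).differentiableAt (by simp)) ![v]
    rw [← (hh z hz).2 e he (hCe hz), localRep_zero] at h4
    exact h4.symm
  have h5 := hO.is_const_of_fderiv_eq_zero hconv.isPreconnected h2 h3 ⟨x, hx, rfl⟩ ⟨y, hy, rfl⟩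
  rwa [hval x hx, hval y hy] at h5

end ZeroForms

/-! ### The Čech–de Rham obstruction to exactness -/

section Obstruction

universe u

variable {m : ℕ} {X : Type u} [TopologicalSpace X] [ChartedSpace (Model m) X]
  [IsManifold (𝓡 m) ∞ X]

/-- Exactness of closed 2-forms is detected by finitely many continuous linear functionals. -/
lemma exists_finite_obstruction [CompactSpace X] [T2Space X] :
    ∃ (N : Type u) (_ : Fintype N) (Φ : ClosedForm m X 2 →ₗ[ℝ] (N → ℝ)), Continuous Φ ∧
      ∀ w, Φ w = 0 → w ∈ ExactTwoForm m X := by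
  classical
  obtain ⟨U, V, B, hconv, hxU, hUVB⟩ := exists_nested_chartConvex (m := m) (X := X)
  have hUV : ∀ x, U x ⊆ V x := fun x => (hUVB x x ⟨x, hxU x, hxU x⟩).1
  have hVB : ∀ x, V x ⊆ B x := fun x => (hUVB x x ⟨x, hxU x, hxU x⟩).2
  obtain ⟨t, -, ht⟩ := (isCompact_univ (X := X)).elim_nhds_subcover U
    fun x _ => (hconv x).1.1.mem_nhds (hxU x)
  have hcov : ∀ z : X, ∃ i : t, z ∈ U i := fun z => by
    obtain ⟨x, hx, hz⟩ := mem_iUnion₂.1 (ht (mem_univ z))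
    exact ⟨⟨x, hx⟩, hz⟩
  -- Primitives live on the largest sets B. Their differences on V i, for indices whose U-sets meet,
  -- are closed and have potentials f i j there.
  choose A hA using fun i : t => exists_primitive (hconv i).2.2 (hVB i (hUV i (hxU i)))
  have hAsub : ∀ i j : t, (U i ∩ U j).Nonempty → ∀ x ∈ V i,
      (∀ w, SmoothFormAt ((A i - A j) w) x ∧ IsExtDerivAt ((A i - A j) w) 0 x) ∧
        JointContAt (A i - A j) x := by
    intro i j hij x hx
    have hi := hA i x (hVB i hx)
    have hj := hA j x ((hUVB i j hij).2 hx)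
    refine ⟨fun w => ⟨(hi.1 w).1.sub (hj.1 w).1, ?_⟩, hi.2.sub hj.2⟩
    have h1 := (hi.1 w).2.sub (hj.1 w).2 (hi.1 w).1 (hj.1 w).1
    rwa [sub_self] at h1
  have hfex : ∀ i j : t, ∃ f : ClosedForm m X 2 →ₗ[ℝ] RawForm m X 0, (U i ∩ U j).Nonempty →
      ∀ x ∈ V i, (∀ w, SmoothFormAt (f w) x ∧ IsExtDerivAt (f w) ((A i - A j) w) x) ∧
        Continuous fun w => f w x ![] := by
    intro i j
    by_cases hij : (U i ∩ U j).Nonempty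
    · obtain ⟨f, hf⟩ := exists_potential (hconv i).2.1 (hUV i (hxU i)) (A i - A j) (hAsub i j hij)
      exact ⟨f, fun _ => hf⟩
    · exact ⟨0, fun h => absurd h hij⟩
  choose f hf using hfex
  -- On U i with nonempty triple intersection, this Čech coboundary is a closed 0-form, hence
  -- constant; its value at the centre of U i is the obstruction. It is linear and continuous in the
  -- form because the primitives and potentials are.
  let c : t × t × t → ClosedForm m X 2 →ₗ[ℝ] RawForm m X 0 := fun p =>
    f p.1 p.2.1 + f p.2.1 p.2.2 - f p.1 p.2.2
  let Φ : ClosedForm m X 2 →ₗ[ℝ] (t × t × t → ℝ) := LinearMap.pi fun p =>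
    if (U p.1 ∩ U p.2.1 ∩ U p.2.2).Nonempty then (evalZeroForm m p.1.1) ∘ₗ c p else 0
  have hΦ : ∀ w p, Φ w p = (if (U p.1 ∩ U p.2.1 ∩ U p.2.2).Nonempty then
      (evalZeroForm m p.1.1) ∘ₗ c p else 0) w := fun _ _ => rfl
  have hne : ∀ i j k : t, (U i ∩ U j ∩ U k).Nonempty →
      (U i ∩ U j).Nonempty ∧ (U j ∩ U k).Nonempty ∧ (U i ∩ U k).Nonempty := by
    rintro i j k ⟨x, ⟨hi, hj⟩, hk⟩
    exact ⟨⟨x, hi, hj⟩, ⟨x, hj, hk⟩, ⟨x, hi, hk⟩⟩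
  refine ⟨t × t × t, inferInstance, Φ, continuous_pi fun p => ?_, fun w hw => ?_⟩
  · by_cases hp : (U p.1 ∩ U p.2.1 ∩ U p.2.2).Nonempty
    · have h1 : (fun w => Φ w p) = fun w => f p.1 p.2.1 w p.1 ![] + f p.2.1 p.2.2 w p.1 ![] -
          f p.1 p.2.2 w p.1 ![] := by
        funext w
        rw [hΦ, if_pos hp]
        rfl
      rw [h1]
      obtain ⟨h12, h23, h13⟩ := hne _ _ _ hp
      exact (((hf _ _ h12 _ (hUV _ (hxU _))).2).add
        (hf _ _ h23 _ ((hUVB _ _ h12).1 (hxU _))).2).sub (hf _ _ h13 _ (hUV _ (hxU _))).2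
    · have h1 : (fun w => Φ w p) = fun _ => 0 := by
        funext w
        rw [hΦ, if_neg hp]
        rfl
      rw [h1]
      exact continuous_const
  have hcoc : ∀ i j k : t, ∀ x ∈ U i, x ∈ U j → x ∈ U k →
      f i j w x ![] + f j k w x ![] - f i k w x ![] = 0 := by
    intro i j k x hi hj hk
    have hp : (U i ∩ U j ∩ U k).Nonempty := ⟨x, ⟨hi, hj⟩, hk⟩
    obtain ⟨h12, h23, h13⟩ := hne _ _ _ hp
    have h1 : Φ w (i, j, k) = 0 := congrFun hw _
    rw [hΦ, if_pos hp] at h1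
    have h2 := zeroForm_const (hconv i).1 (h := c (i, j, k) w) (fun z hz => ?_) (hxU i) hi
    · exact h2.symm.trans h1
    · have a := (hf i j h12 z (hUV i hz)).1 w
      have b := (hf j k h23 z ((hUVB _ _ h12).1 hz)).1 w
      have d := (hf i k h13 z (hUV i hz)).1 w
      refine ⟨(a.1.add b.1).sub d.1, ?_⟩
      have h3 := (a.2.add b.2 a.1 b.1).sub d.2 (a.1.add b.1) d.1
      have h4 : (A i - A j) w + (A j - A k) w - (A i - A k) w = 0 := by
        simp only [LinearMap.sub_apply]
        abel
      rwa [h4] at h3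
  obtain ⟨ρ, hρ⟩ := SmoothPartitionOfUnity.exists_isSubordinate (𝓡 m) isClosed_univ
    (fun i : t => U i) (fun i => (hconv i).1.1) fun z _ => mem_iUnion.2 (hcov z)
  have hρ0 : ∀ (k : t) (x : X), x ∉ U k → ρ k x = 0 := fun k x hx =>
    image_eq_zero_of_notMem_tsupport fun h => hx (hρ k h)
  -- The partition of unity splits the cocycle: once the obstruction vanishes, g i − g j = f i j on
  -- overlaps.
  let g : t → RawForm m X 0 := fun i => ∑ k, mulForm (ρ k) (f i k w)
  have hgval : ∀ i x, g i x ![] = ∑ k, ρ k x * f i k w x ![] := fun i x =>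
    map_sum (evalZeroForm m x) _ _
  have hUo : ∀ i : t, ∀ x ∈ U i, ∀ᶠ z in 𝓝 x, z ∈ U i := fun i x hx => (hconv i).1.1.mem_nhds hx
  have hgs : ∀ i : t, ∀ x ∈ U i, SmoothFormAt (g i) x := by
    intro i x hx
    refine SmoothFormAt.sum _ fun k _ => ?_
    by_cases hik : (U i ∩ U k).Nonempty
    · exact ((hf i k hik x (hUV i hx)).1 w).1.mulForm ((ρ k).contMDiff x)
    -- When U i and U k are disjoint, nothing is known about f i k, but ρ k vanishes on U i and
    -- removes the term.
    · refine SmoothFormAt.zero.congr ((hUo i x hx).mono fun z hz => ?_)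
      have h1 : ρ k z = 0 := hρ0 k z fun h => hik ⟨z, hz, h⟩
      simp only [mulForm, h1, zero_smul]
      rfl
  have hgsub : ∀ i j : t, ∀ x ∈ U i, x ∈ U j → (g i - g j) x = f i j w x := by
    intro i j x hi hj
    refine zeroForm_ext ?_
    have h1 : (g i - g j) x ![] = g i x ![] - g j x ![] := rfl
    have h2 := ρ.sum_eq_one (mem_univ x)
    rw [finsum_eq_sum_of_fintype] at h2
    rw [h1, hgval, hgval, ← Finset.sum_sub_distrib, ← one_mul (f i j w x ![]), ← h2,
      Finset.sum_mul]
    refine Finset.sum_congr rfl fun k _ => ?_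
    by_cases hk : x ∈ U k
    · rw [← mul_sub]
      congr 1
      linarith [hcoc i j k x hi hj hk]
    · rw [hρ0 k x hk]
      ring
  -- Subtracting d(g i) leaves the exterior derivative unchanged and makes the local primitives
  -- agree on overlaps, so they glue to a global primitive.
  let α' : t → RawForm m X 1 := fun i => A i w - rawD (g i)
  have hα' : ∀ i j : t, ∀ x ∈ U i, x ∈ U j → α' i x = α' j x := by
    intro i j x hi hj
    have h1 := (isExtDerivAt_rawD (hgs i x hi)).sub (isExtDerivAt_rawD (hgs j x hj)) (hgs i x hi)
      (hgs j x hj)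
    have h2 := ((hf i j ⟨x, hi, hj⟩ x (hUV i hi)).1 w).2
    have h3 := (h2.congr (((hUo i x hi).and (hUo j x hj)).mono
      fun z hz => hgsub i j z hz.1 hz.2)).unique h1
    have h4 : A i w x - A j w x = rawD (g i) x - rawD (g j) x := h3
    have h5 : A i w x - rawD (g i) x = A j w x - rawD (g j) x := by
      rw [sub_eq_sub_iff_add_eq_add] at h4 ⊢
      rw [h4, add_comm]
    exact h5
  choose idx hidx using hcov
  let α : RawForm m X 1 := fun x => α' (idx x) x
  have hα : ∀ x, ∀ᶠ z in 𝓝 x, α z = α' (idx x) z := fun x =>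
    (hUo _ x (hidx x)).mono fun z hz => hα' _ _ z (hidx z) hz
  have hlocal : ∀ x, SmoothFormAt α x ∧ IsExtDerivAt α w.1.1 x := by
    intro x
    have hx := hidx x
    have h1 := (hA (idx x) x (hVB _ (hUV _ hx))).1 w
    have h2 : ∀ᶠ z in 𝓝 x, SmoothFormAt (g (idx x)) z := (hUo _ x hx).mono (hgs (idx x))
    have h3 := SmoothFormAt.rawD h2
    refine ⟨(h1.1.sub h3).congr (hα x), ?_⟩
    have h4 := h1.2.sub (isExtDerivAt_rawD_zero h2) h1.1 h3
    rw [sub_zero] at h4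
    exact h4.congr (hα x)
  exact ⟨⟨α, mem_smoothForm_iff.2 fun x => (hlocal x).1⟩,
    isExtDeriv_iff.2 fun x => (hlocal x).2⟩

end Obstruction

/-! ### The class map is continuous and open -/

section Cohomology

variable {m : ℕ} {X : Type*} [TopologicalSpace X] [ChartedSpace (Model m) X]
  [IsManifold (𝓡 m) ∞ X]

instance : IsModuleTopology ℝ (H2 m X) := ⟨rfl⟩

instance : IsTopologicalAddGroup (H2 m X) := IsModuleTopology.topologicalAddGroup ℝ _

instance : ContinuousSMul ℝ (H2 m X) := IsModuleTopology.toContinuousSMul ℝ _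

/-- The class map kills the kernel of the obstruction map, so it factors linearly through a finite
power of ℝ, where every linear map into a topological vector space is continuous. -/
lemma continuous_cohomClass [CompactSpace X] [T2Space X] :
    Continuous (cohomClass : ClosedForm m X 2 → H2 m X) := by
  obtain ⟨N, hN, Φ, hΦ, hker⟩ := exists_finite_obstruction (m := m) (X := X)
  obtain ⟨s, hs⟩ := Φ.rangeRestrict.exists_rightInverse_of_surjective Φ.range_rangeRestrict
  let q : ClosedForm m X 2 →ₗ[ℝ] H2 m X := (ExactTwoForm m X).mkQ
  -- A linear section over the range of the obstruction map defines the factorization there; it is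
  -- then extended to all of ℝ^N.
  obtain ⟨L, hL⟩ := (q ∘ₗ s).exists_extend
  have h1 : (cohomClass : ClosedForm m X 2 → H2 m X) = L ∘ Φ := by
    funext w
    have h2 : L (Φ w) = q (s (Φ.rangeRestrict w)) := LinearMap.congr_fun hL (Φ.rangeRestrict w)
    have h3 : Φ.rangeRestrict (s (Φ.rangeRestrict w)) = Φ.rangeRestrict w :=
      LinearMap.congr_fun hs _
    have h4 : Φ (s (Φ.rangeRestrict w)) = Φ w := congrArg Subtype.val h3
    refine Eq.trans ?_ h2.symm
    refine (Submodule.Quotient.eq (ExactTwoForm m X)).2 (hker _ ?_)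
    rw [map_sub, h4, sub_self]
  rw [h1]
  exact L.continuous_of_finiteDimensional.comp hΦ

/-- The projection is open for the quotient topology, which is a vector space topology. The module
topology is the finest such topology, so the image is open for it too. -/
lemma isOpenMap_cohomClass : IsOpenMap (cohomClass : ClosedForm m X 2 → H2 m X) := by
  intro U hU
  have h1 := (ExactTwoForm m X).isOpenMap_mkQ U hU
  exact moduleTopology_le ℝ (ClosedForm m X 2 ⧸ ExactTwoForm m X) _ h1

end Cohomology

/-! ### The period map is a local homeomorphism -/

section Period

variable {n : ℕ} {X : Type*} [TopologicalSpace X] [ChartedSpace (Model (2 * n)) X]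
  [IsManifold (𝓡 (2 * n)) ∞ X] {o : ManifoldOrientation n X}

/-- The map induced by the cohomology class on the quotient of the space of symplectic forms by
`Diff₀(X)`. -/
def periodMap (o : ManifoldOrientation n X) : ModuliTilde o → H2 (2 * n) X :=
  Quotient.lift (fun w => cohomClass w.1) (by
    rintro w η ⟨φ, hφ, h⟩
    have h1 : pullbackClosed φ w.1 = η.1 := Subtype.ext (Subtype.ext h)
    exact (cohomClass_pullback hφ w.1).symm.trans (congrArg _ h1))

variable [CompactSpace X] [T2Space X]

lemma continuous_periodMap : Continuous (periodMap o) :=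
  (continuous_cohomClass.comp continuous_subtype_val).quotient_lift _

lemma isOpenMap_periodMap : IsOpenMap (periodMap o) := by
  intro U hU
  have h1 := hU.preimage (continuous_quotient_mk' (s := orbitSetoid o))
  have h2 := isOpenMap_cohomClass _ ((isOpen_symplectic o).isOpenMap_subtype_val _ h1)
  convert h2 using 1
  ext c
  constructor
  · rintro ⟨x, hx, rfl⟩
    obtain ⟨w, rfl⟩ := Quotient.exists_rep x
    exact ⟨w.1, ⟨w, hx, rfl⟩, rfl⟩
  · rintro ⟨_, ⟨w, hw, rfl⟩, rfl⟩
    exact ⟨_, hw, rfl⟩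

/-- The image in the quotient of a small Moser neighbourhood is open. On it the map is continuous
and open, and it is injective because cohomologous forms in that neighbourhood share an orbit. -/
lemma isLocalHomeomorph_periodMap : IsLocalHomeomorph (periodMap o) := by
  rw [isLocalHomeomorph_iff_isOpenEmbedding_restrict]
  intro x
  obtain ⟨w, rfl⟩ := Quotient.exists_rep x
  obtain ⟨U, hU, h⟩ := exists_nhds_equiv w
  obtain ⟨V, hVU, hV, hwV⟩ := mem_nhds_iff.1 hU
  have hV' : IsOpen (Quotient.mk (orbitSetoid o) '' V) := isOpenMap_quotient_mk o
    (isOpen_symplectic o) _ hV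
  refine ⟨_, hV'.mem_nhds ⟨w, hwV, rfl⟩, .of_continuous_injective_isOpenMap
    (continuous_periodMap.comp continuous_subtype_val) ?_
    (isOpenMap_periodMap.comp hV'.isOpenMap_subtype_val)⟩
  rintro ⟨_, η, hη, rfl⟩ ⟨_, η', hη', rfl⟩ hc
  exact Subtype.ext (Quotient.sound (h η (hVU hη) η' (hVU hη') hc))

end Period

end SymplecticModuli

end

theorem mainTheorem8 (n : ℕ) (X : Type*) [TopologicalSpace X] [T2Space X] [CompactSpace X]
    [ChartedSpace (SymplecticModuli.Model (2 * n)) X] [IsManifold (𝓡 (2 * n)) ∞ X]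
    (o : SymplecticModuli.ManifoldOrientation n X) :
    ∃ sTilde : SymplecticModuli.ModuliTilde o → SymplecticModuli.H2 (2 * n) X,
      (∀ w : SymplecticModuli.SymplecticForm o,
        sTilde (Quotient.mk (SymplecticModuli.orbitSetoid o) w) =
          SymplecticModuli.cohomClass w.1) ∧
      IsLocalHomeomorph sTilde := by
  exact ⟨SymplecticModuli.periodMap o, fun _ => rfl, SymplecticModuli.isLocalHomeomorph_periodMap⟩
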